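/- **Setting.** On $\mathbb C^3$ let $\langle u,v\rangle=\mathrm{Re}\,(\bar u\cdot v)$, $\omega=\frac i2\sum_i dz_i\wedge d\bar z_i$, $\psi=-i\,dz_1\wedge dz_2\wedge dz_3$. Let $M=G/H$ be a homogeneous nearly Kähler 6-manifold: $G$ is a Lie group acting smoothly and transitively on $M$, $H$ is the stabiliser of a point $o$, $\mathfrak g=\mathfrak h\oplus\mathfrak m$ with $\mathrm{Ad}_H(\mathfrak m)\subset\mathfrak m$, and $\mathfrak m\cong\mathbb C^3$ is an identification for which $H$ acts on $\mathfrak m$ through $\mathrm{SU}(3)$, the representation $\mathfrak h\to\mathfrak{su}(3)$ being faithful. The induced invariant metric $g$, 2-form $\omega$ and complex 3-form $\psi$ on $M$ satisfy $d\omega=3\,\mathrm{Re}\,\psi$, $d\,\mathrm{Im}\,\psi=-2\,\omega\wedge\omega$, and the presentation $G/H$ is such that the characteristic connection $\bar\nabla$, given by $g(\bar\nabla_XY,Z)=g(\nabla_XY,Z)+\frac12\mathrm{Re}\,\psi(X,Y,JZ)$ with $\nabla$ the Levi-Civita connection, is the canonical homogeneous connection of $G\to M$ (this is so for $S^6=G_2/\mathrm{SU}(3)$,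 $S^3\times S^3=\mathrm{SU}(2)^3/\Delta\mathrm{SU}(2)$, $\mathbb{CP}^3=\mathrm{Sp}(2)/(\mathrm U(1)\times\mathrm{Sp}(1))$ and $\mathrm{SU}(3)/\mathbb T^2$). Each $a\in G$ gives the special unitary frame $u_a\colon\mathbb C^3\cong\mathfrak m\to T_{a\cdot o}M$. **Structure equations.** Let $L$ be a simply connected 3-manifold with smooth forms $\sigma\in\Omega^1(L,\mathbb R^3)$, a coframe at each point, $\alpha\in\Omega^1(L,\mathfrak{so}(3))$, $\beta\in\Omega^1(L,S^2\mathbb R^3)$, and let $T\colon L\to\mathrm{SU}(3)$ be smooth (for instance constant). Let $\Omega_{ij}$ be the components, in the basis of $\mathfrak m\cong\mathbb C^3$ formed by the columns of $T$, of the curvature of $\bar\nabla$ evaluated on $T\sigma\wedge T\sigma$, and write $(R\,\sigma\wedge\sigma)_{ij}=-\mathrm{Re}\,\Omega_{ij}$, $(S\,\sigma\wedge\sigma)_{ij}=-\mathrm{Im}\,\Omega_{ij}$. Let $[\sigma]=\begin{pmatrix}0&\sigma_3&-\sigma_2\\-\sigma_3&0&\sigma_1\\ \sigma_2&-\sigma_1&0\end{pmatrix}$.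 We say that $(\sigma,\alpha,\beta)$ solves the Lagrangian structure equations of $M$ in the gauge $T$ if $$\beta\wedge\sigma=0,\qquad d\sigma=-\alpha\wedge\sigma-\tfrac12[\sigma]\wedge\sigma,$$ $$d\alpha=-\alpha\wedge\alpha+\beta\wedge\beta-R\,\sigma\wedge\sigma,\qquad d\beta=-\beta\wedge\alpha-\alpha\wedge\beta-S\,\sigma\wedge\sigma,$$ and $\alpha+i\beta=T^{-1}AT+T^{-1}dT$ for a 1-form $A$ with values in $\mathfrak h\subset\mathfrak{su}(3)$ (for $T\equiv1$: $\alpha+i\beta$ takes values in $\mathfrak h$). **Proposition.** Let $(\sigma,\alpha,\beta)$ solve the Lagrangian structure equations of $M$ in the gauge $T$. Then there are a special Lagrangian immersion $f\colon L\to M$ (a smooth immersion with $f^*\omega=0$, $f^*\mathrm{Re}\,\psi=0$) and a smooth lift $F\colon L\to G$, $f(x)=F(x)\cdot o$, which is adapted, i.e. $df_x=u_{F(x)}\circ T(x)\circ\sigma_x$, such that, with $e_1,e_2,e_3$ the frame of $TL$ dual to $\sigma$: 1. $f^*g=\sum_i\sigma_i^2$; 2. the tangential part of $\nabla_v\,df(e_j)$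 is $\sum_i(\alpha+\frac12[\sigma])_{ij}(v)\,df(e_i)$; 3. the second fundamental form is $\mathrm{I\!I}(v,e_j)=\sum_i\beta_{ij}(v)\,J\,df(e_i)$. Moreover $f$ is unique up to isometries: if $f'\colon L\to M$ is another special Lagrangian immersion which has a smooth lift adapted to $(\sigma,T)$, and whose second fundamental form is given by $\beta$ as in (3), then $f'=a\cdot f$ for some $a\in G$, and $p\mapsto a\cdot p$ is an isometry of $M$. -/

import Mathlib

open scoped Manifold ContDiff Matrix
open Complex

noncomputable section

/-! ### The flat model `ℂ³` with its special unitary structure -/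

namespace FlatModel

/-- The Euclidean inner product `Re ⟨u, v⟩` on `ℂ³`. -/
def inner (u v : Fin 3 → ℂ) : ℝ := (star u ⬝ᵥ v).re

/-- The Hermitian form `ω = (i/2) ∑ dz_i ∧ dz̄_i`, that is `ω(u, v) = Re ⟨i u, v⟩`. -/
def kahler (u v : Fin 3 → ℂ) : ℝ := inner (I • u) v

/-- The complex volume form `ψ = -i dz₁ ∧ dz₂ ∧ dz₃`. -/
def psi (u v w : Fin 3 → ℂ) : ℂ := -I * Matrix.det (Matrix.of ![u, v, w])

/-- The vector of `ℂ³` which represents the real linear functional `κ`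
for the Euclidean inner product. -/
def riesz (κ : (Fin 3 → ℂ) → ℝ) : Fin 3 → ℂ := fun i =>
  (κ (Pi.single i 1) : ℂ) + I * (κ (Pi.single i I) : ℂ)

/-- The `4`-form `ω ∧ ω`. -/
def kahlerSq (X Y Z W : Fin 3 → ℂ) : ℝ :=
  2 * (kahler X Y * kahler Z W - kahler X Z * kahler Y W + kahler X W * kahler Y Z)

end FlatModel

/-! ### Differential forms on a 3-manifold -/

section Forms

variable (L : Type*) [TopologicalSpace L] [ChartedSpace (EuclideanSpace ℝ (Fin 3)) L]

/-- Real `1`-forms on `L` (smoothness is the separate predicate `OneForm.IsSmooth`). -/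
abbrev OneForm : Type _ := ∀ x : L, TangentSpace (𝓡 3) x →L[ℝ] ℝ

/-- Real functions of a point of `L` and two tangent vectors there; they carry `2`-forms. -/
abbrev TwoForm : Type _ := ∀ x : L, TangentSpace (𝓡 3) x → TangentSpace (𝓡 3) x → ℝ

variable {L}

namespace OneForm

/-- The `1`-form `θ` in the chart around `x₀`: the pullback of `θ` by the inverse of the chart. -/
def inChart (θ : OneForm L) (x₀ : L) (y : EuclideanSpace ℝ (Fin 3)) :
    EuclideanSpace ℝ (Fin 3) →L[ℝ] ℝ :=
  (θ ((extChartAt (𝓡 3) x₀).symm y)).comp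
    (mfderiv 𝓘(ℝ, EuclideanSpace ℝ (Fin 3)) (𝓡 3) (extChartAt (𝓡 3) x₀).symm y)

/-- Smoothness of a `1`-form: it is smooth in every chart. -/
def IsSmooth (θ : OneForm L) : Prop :=
  ∀ x₀ : L, ContDiffOn ℝ ∞ (θ.inChart x₀) (extChartAt (𝓡 3) x₀).target

/-- The exterior derivative `dθ`, computed in the chart around the point. -/
def d (θ : OneForm L) : TwoForm L := fun x v w =>
  let v' : EuclideanSpace ℝ (Fin 3) :=
    mfderiv (𝓡 3) 𝓘(ℝ, EuclideanSpace ℝ (Fin 3)) (extChartAt (𝓡 3) x) x v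
  let w' : EuclideanSpace ℝ (Fin 3) :=
    mfderiv (𝓡 3) 𝓘(ℝ, EuclideanSpace ℝ (Fin 3)) (extChartAt (𝓡 3) x) x w
  fderiv ℝ (θ.inChart x) (extChartAt (𝓡 3) x x) v' w'
    - fderiv ℝ (θ.inChart x) (extChartAt (𝓡 3) x x) w' v'

/-- The wedge product of two `1`-forms. -/
def wedge (θ η : OneForm L) : TwoForm L := fun x v w => θ x v * η x w - θ x w * η x v

/-- The matrix `[σ]` of `1`-forms attached to `σ = (σ₁, σ₂, σ₃)`. -/
def bracket (σ : Fin 3 → OneForm L) : Matrix (Fin 3) (Fin 3) (OneForm L) :=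
  !![0, σ 2, -σ 1; -σ 2, 0, σ 0; σ 1, -σ 0, 0]

/-- `σ(v)` as a real vector in `ℂ³`. -/
def vec (σ : Fin 3 → OneForm L) (x : L) (v : TangentSpace (𝓡 3) x) : Fin 3 → ℂ :=
  fun i => (σ i x v : ℂ)

end OneForm

/-- The derivative at `x` in the direction `v` of a complex valued function on `L`. -/
def dirDeriv (u : L → ℂ) (x : L) (v : TangentSpace (𝓡 3) x) : ℂ :=
  mfderiv (𝓡 3) 𝓘(ℝ, ℂ) u x v

end Forms

/-! ### Homogeneous nearly Kähler 6-manifolds -/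

section Homogeneous

open FlatModel

variable {E : Type*} [NormedAddCommGroup E] [NormedSpace ℝ E]
  (G : Type*) [TopologicalSpace G] [ChartedSpace E G] [Group G]
  (M : Type*) [TopologicalSpace M] [ChartedSpace (EuclideanSpace ℝ (Fin 6)) M] [MulAction G M]

variable {G} in
/-- The adjoint action of `h` on the Lie algebra of `G`. -/
def adjointAction (h : G) (X : GroupLieAlgebra 𝓘(ℝ, E) G) : GroupLieAlgebra 𝓘(ℝ, E) G :=
  mfderiv 𝓘(ℝ, E) 𝓘(ℝ, E) (fun g : G => h * g * h⁻¹) 1 X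

variable {G M} in
/-- The derivative at `g` of the orbit map `g ↦ g • o`. -/
def orbitDeriv (o : M) (g : G) (X : TangentSpace 𝓘(ℝ, E) g) : TangentSpace (𝓡 6) (g • o) :=
  mfderiv 𝓘(ℝ, E) (𝓡 6) (fun g' : G => g' • o) g X

/-- A reductive decomposition `𝔤 = 𝔥 ⊕ 𝔪` of the homogeneous space `M = G/H`, `H` the stabiliser
of `o`, together with an `H`-invariant special unitary identification of `𝔪` with `ℂ³`.
Here `𝔪` is the range of `b`, and `𝔥` is the kernel of `ζ`. -/
structure InvariantSU3Structure where
  /-- The base point of `M = G/H`. -/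
  o : M
  /-- The special unitary identification of `ℂ³` with `𝔪 ⊆ 𝔤`. -/
  b : (Fin 3 → ℂ) →ₗ[ℝ] GroupLieAlgebra 𝓘(ℝ, E) G
  /-- The projection of `𝔤` to `𝔪 ≅ ℂ³` along `𝔥`. -/
  ζ : GroupLieAlgebra 𝓘(ℝ, E) G →ₗ[ℝ] (Fin 3 → ℂ)
  ζ_b : ∀ z, ζ (b z) = z
  /-- The kernel `𝔥` of `ζ` is the Lie algebra of the stabiliser of `o`. -/
  ζ_eq_zero_iff : ∀ X, ζ X = 0 ↔ orbitDeriv o (1 : G) X = 0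
  /-- `Ad(H)` preserves `𝔪` and acts there by special unitary transformations. -/
  Ad_mem : ∀ h ∈ MulAction.stabilizer G o, ∃ U ∈ Matrix.specialUnitaryGroup (Fin 3) ℂ,
    ∀ z, adjointAction h (b z) = b (U *ᵥ z)
  /-- The infinitesimal form: `ad(𝔥)` preserves `𝔪` and acts there through `𝔰𝔲(3)`. -/
  ad_mem : ∀ X, ζ X = 0 → ∃ A : Matrix (Fin 3) (Fin 3) ℂ, Aᴴ = -A ∧ A.trace = 0 ∧
    ∀ z, ⁅X, b z⁆ = b (A *ᵥ z)
  /-- The isotropy representation of `𝔥` on `𝔪` is faithful: up to a cover, `G` embeds into the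
  special unitary frame bundle of `M`. -/
  faithful : ∀ X, ζ X = 0 → (∀ z, ⁅X, b z⁆ = 0) → X = 0

namespace InvariantSU3Structure

variable {G M} (S : InvariantSU3Structure (E := E) G M)

/-- The `𝔥`-component of an element of `𝔤`. -/
def hPart (X : GroupLieAlgebra 𝓘(ℝ, E) G) : GroupLieAlgebra 𝓘(ℝ, E) G := X - S.b (S.ζ X)

/-- The `𝔪`-component `[X, Y]_𝔪` of the bracket of two elements of `𝔪 ≅ ℂ³`. -/
def brM (X Y : Fin 3 → ℂ) : Fin 3 → ℂ := S.ζ ⁅S.b X, S.b Y⁆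

/-- The exterior derivative on `M` of the invariant `2`-form `ω`. -/
def dKahler (X Y Z : Fin 3 → ℂ) : ℝ :=
  -kahler (S.brM X Y) Z + kahler (S.brM X Z) Y - kahler (S.brM Y Z) X

/-- The exterior derivative on `M` of the invariant `3`-form `Im ψ`. -/
def dImPsi (X Y Z W : Fin 3 → ℂ) : ℝ :=
  -(psi (S.brM X Y) Z W).im + (psi (S.brM X Z) Y W).im - (psi (S.brM X W) Y Z).im
    - (psi (S.brM Y Z) X W).im + (psi (S.brM Y W) X Z).im - (psi (S.brM Z W) X Y).im

/-- The Levi-Civita connection of the invariant metric of `M`, as a bilinear map on `𝔪`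
(Koszul formula): for `X, Y, Z ∈ 𝔪`,
`2 ⟨Λ(X) Y, Z⟩ = ⟨[X, Y]_𝔪, Z⟩ - ⟨[Y, Z]_𝔪, X⟩ + ⟨[Z, X]_𝔪, Y⟩`. -/
def leviCivita (X Y : Fin 3 → ℂ) : Fin 3 → ℂ :=
  riesz fun Z => (inner (S.brM X Y) Z - inner (S.brM Y Z) X + inner (S.brM Z X) Y) / 2

/-- The characteristic (nearly Kähler) connection `∇̄` of `M`, as a bilinear map on `𝔪`:
`g(∇̄_X Y, Z) = g(∇_X Y, Z) + ½ Re ψ(X, Y, J Z)`. -/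
def characteristic (X Y : Fin 3 → ℂ) : Fin 3 → ℂ :=
  S.leviCivita X Y + riesz fun Z => (psi X Y (I • Z)).re / 2

/-- The curvature of the characteristic connection, on `𝔪 ≅ ℂ³`. -/
def curvature (X Y Z : Fin 3 → ℂ) : Fin 3 → ℂ :=
  S.characteristic X (S.characteristic Y Z) - S.characteristic Y (S.characteristic X Z)
    - S.characteristic (S.brM X Y) Z - S.ζ ⁅S.hPart ⁅S.b X, S.b Y⁆, S.b Z⁆

/-- `M = G/H` is a homogeneous nearly Kähler manifold: the invariant forms satisfy
`dω = 3 Re ψ` and `d Im ψ = -2 ω ∧ ω`, and the canonical homogeneous connection of `G → M`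
is the characteristic connection. -/
structure IsNearlyKahler : Prop where
  dKahler_eq : ∀ X Y Z, S.dKahler X Y Z = 3 * (psi X Y Z).re
  dImPsi_eq : ∀ X Y Z W, S.dImPsi X Y Z W = -2 * kahlerSq X Y Z W
  canonical : ∀ X Y, S.characteristic X Y = 0

/-! #### The nearly Kähler structure on the manifold `M` -/

/-- The frame `ℂ³ ≅ T_{g • o} M` of `M` given by `g ∈ G`. -/
def frame (g : G) (z : Fin 3 → ℂ) : TangentSpace (𝓡 6) (g • S.o) :=
  orbitDeriv S.o g (mulInvariantVectorField (S.b z) g)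

variable [MulAction.IsPretransitive G M]

/-- Some element of `G` which maps `o` to `p`. -/
def rep (p : M) : G := (MulAction.exists_smul_eq G S.o p).choose

/-- The coordinates in `ℂ³` of a tangent vector of `M` at `p`, in the frame given by `rep p`. -/
def coords (p : M) (v : TangentSpace (𝓡 6) p) : Fin 3 → ℂ :=
  Classical.epsilon fun z => (S.frame (S.rep p) z : EuclideanSpace ℝ (Fin 6)) = v

/-- The Riemannian metric of `M`. -/
def metric (p : M) (v w : TangentSpace (𝓡 6) p) : ℝ :=
  inner (S.coords p v) (S.coords p w)

/-- The fundamental `2`-form `ω` of `M`. -/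
def kahlerForm (p : M) (v w : TangentSpace (𝓡 6) p) : ℝ :=
  kahler (S.coords p v) (S.coords p w)

/-- The complex volume form `ψ` of `M`. -/
def volForm (p : M) (u v w : TangentSpace (𝓡 6) p) : ℂ :=
  psi (S.coords p u) (S.coords p v) (S.coords p w)

/-- Isometries of `M`. -/
structure IsIsometry (Φ : M → M) : Prop where
  bijective : Function.Bijective Φ
  smooth : ContMDiff (𝓡 6) (𝓡 6) ∞ Φ
  metric_eq : ∀ (p : M) (v w : TangentSpace (𝓡 6) p),
    S.metric (Φ p) (mfderiv (𝓡 6) (𝓡 6) Φ p v) (mfderiv (𝓡 6) (𝓡 6) Φ p w) = S.metric p v w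

/-! #### Special Lagrangian immersions and the structure equations -/

variable {L : Type*} [TopologicalSpace L] [ChartedSpace (EuclideanSpace ℝ (Fin 3)) L]

/-- Special Lagrangian immersions `L → M`: smooth, with injective differential,
and `ω` and `Re ψ` vanish on `L`. -/
structure IsSpecialLagrangianImmersion (f : L → M) : Prop where
  smooth : ContMDiff (𝓡 3) (𝓡 6) ∞ f
  immersion : ∀ x, Function.Injective (mfderiv (𝓡 3) (𝓡 6) f x)
  lagrangian : ∀ (x : L) (v w : TangentSpace (𝓡 3) x),
    S.kahlerForm (f x) (mfderiv (𝓡 3) (𝓡 6) f x v) (mfderiv (𝓡 3) (𝓡 6) f x w) = 0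
  special : ∀ (x : L) (u v w : TangentSpace (𝓡 3) x),
    (S.volForm (f x) (mfderiv (𝓡 3) (𝓡 6) f x u) (mfderiv (𝓡 3) (𝓡 6) f x v)
      (mfderiv (𝓡 3) (𝓡 6) f x w)).re = 0


/-- The curvature form of the characteristic connection in the frame field given by
`σ` and the gauge `T`: its value on `(v, w)` is the matrix, in the unitary basis of `ℂ³` given by
the columns of `T`, of the curvature at the vectors `T σ(v)`, `T σ(w)`. -/
def curvatureForm (σ : Fin 3 → OneForm L) (T : L → Matrix (Fin 3) (Fin 3) ℂ) (i j : Fin 3)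
    (x : L) (v w : TangentSpace (𝓡 3) x) : ℂ :=
  ((T x)ᴴ *ᵥ S.curvature (T x *ᵥ OneForm.vec σ x v) (T x *ᵥ OneForm.vec σ x w)
    (fun k => T x k j)) i

/-- The matrix of `2`-forms `R σ ∧ σ`: minus the real part of the curvature form. -/
def Rσσ (σ : Fin 3 → OneForm L) (T : L → Matrix (Fin 3) (Fin 3) ℂ) (i j : Fin 3) : TwoForm L :=
  fun x v w => -(S.curvatureForm σ T i j x v w).re

/-- The matrix of `2`-forms `S σ ∧ σ`: minus the imaginary part of the curvature form. -/
def Sσσ (σ : Fin 3 → OneForm L) (T : L → Matrix (Fin 3) (Fin 3) ℂ) (i j : Fin 3) : TwoForm L :=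
  fun x v w => -(S.curvatureForm σ T i j x v w).im

/-- The matrix `φ = α + i β` at a tangent vector. -/
def connMatrix (α β : Matrix (Fin 3) (Fin 3) (OneForm L)) (x : L) (v : TangentSpace (𝓡 3) x) :
    Matrix (Fin 3) (Fin 3) ℂ :=
  Matrix.of fun i j => (α i j x v : ℂ) + I * (β i j x v : ℂ)

/-- The derivative of a matrix valued function on `L`. -/
def _root_.matrixDeriv (T : L → Matrix (Fin 3) (Fin 3) ℂ) (x : L) (v : TangentSpace (𝓡 3) x) :
    Matrix (Fin 3) (Fin 3) ℂ :=
  Matrix.of fun i j => dirDeriv (fun y => T y i j) x v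

/-- `(σ, α, β)` is a solution of the Lagrangian structure equations of `M = G/H` in the gauge
`T : L → SU(3)`. -/
structure IsLagrangianSolution (σ : Fin 3 → OneForm L)
    (α β : Matrix (Fin 3) (Fin 3) (OneForm L)) (T : L → Matrix (Fin 3) (Fin 3) ℂ) : Prop where
  smooth_σ : ∀ i, (σ i).IsSmooth
  smooth_α : ∀ i j, (α i j).IsSmooth
  smooth_β : ∀ i j, (β i j).IsSmooth
  smooth_T : ∀ i j, ContMDiff (𝓡 3) 𝓘(ℝ, ℂ) ∞ fun x => T x i j
  /-- `σ` is a coframe. -/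
  coframe : ∀ x, LinearIndependent ℝ fun i => σ i x
  /-- `α` takes values in `𝔰𝔬(3)`. -/
  skew : ∀ i j, α j i = -α i j
  /-- `β` takes values in the symmetric matrices. -/
  symm : ∀ i j, β j i = β i j
  gauge_mem : ∀ x, T x ∈ Matrix.specialUnitaryGroup (Fin 3) ℂ
  /-- `φ = α + i β` is a connection form with values in `𝔥` in the gauge `T`:
  `φ = T⁻¹ A T + T⁻¹ dT` for some `A` with values in `𝔥 ⊆ 𝔰𝔲(3)`. -/
  gauge_eq : ∀ (x : L) (v : TangentSpace (𝓡 3) x),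
    ∃ X : GroupLieAlgebra 𝓘(ℝ, E) G, S.ζ X = 0 ∧ ∀ z : Fin 3 → ℂ,
      ⁅X, S.b z⁆ = S.b
        ((T x * connMatrix α β x v * (T x)ᴴ - matrixDeriv T x v * (T x)ᴴ) *ᵥ z)
  /-- `β ∧ σ = 0` -/
  eq₁ : ∀ i, ∑ j, (β i j).wedge (σ j) = 0
  /-- `dσ = -α ∧ σ - ½ [σ] ∧ σ` -/
  eq₂ : ∀ i, (σ i).d = -∑ j, (α i j).wedge (σ j)
    - (1 / 2 : ℝ) • ∑ j, (OneForm.bracket σ i j).wedge (σ j)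
  /-- `dα = -α ∧ α + β ∧ β - R σ ∧ σ` -/
  eq₃ : ∀ i j, (α i j).d = -∑ k, (α i k).wedge (α k j) + ∑ k, (β i k).wedge (β k j)
    - S.Rσσ σ T i j
  /-- `dβ = -β ∧ α - α ∧ β - S σ ∧ σ` -/
  eq₄ : ∀ i j, (β i j).d = -∑ k, (β i k).wedge (α k j) - ∑ k, (α i k).wedge (β k j)
    - S.Sσσ σ T i j

/-- `F : L → G` is a smooth lift of `f : L → M` for which the tangent frame of `f` dual to `σ` is
the frame `F` of `M`, rotated by `T`: `df(v) = F (T σ(v))`. -/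
structure IsAdaptedLift (σ : Fin 3 → OneForm L) (T : L → Matrix (Fin 3) (Fin 3) ℂ)
    (f : L → M) (F : L → G) : Prop where
  smooth : ContMDiff (𝓡 3) 𝓘(ℝ, E) ∞ F
  lift : ∀ x, F x • S.o = f x
  adapted : ∀ (x : L) (v : TangentSpace (𝓡 3) x),
    (mfderiv (𝓡 3) (𝓡 6) f x v : EuclideanSpace ℝ (Fin 6))
      = S.frame (F x) (T x *ᵥ OneForm.vec σ x v)

/-- The pullback by `F : L → G` of the Maurer-Cartan form of `G`. -/
def maurerCartan (F : L → G) (x : L) (v : TangentSpace (𝓡 3) x) : GroupLieAlgebra 𝓘(ℝ, E) G :=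
  mfderiv 𝓘(ℝ, E) 𝓘(ℝ, E) (fun g : G => (F x)⁻¹ * g) (F x) (mfderiv (𝓡 3) 𝓘(ℝ, E) F x v)

/-- The Levi-Civita covariant derivative, in the direction `v`, of the vector field
`y ↦ frame (F y) (ξ y)` along `y ↦ F y • o`, expressed in the frame `F x`. -/
def leviCivitaAlong (F : L → G) (ξ : L → Fin 3 → ℂ) (x : L) (v : TangentSpace (𝓡 3) x) :
    Fin 3 → ℂ :=
  (fun i => dirDeriv (fun y => ξ y i) x v)
    + S.ζ ⁅S.hPart (maurerCartan F x v), S.b (ξ x)⁆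
    + S.leviCivita (S.ζ (maurerCartan F x v)) (ξ x)

/-- Let `f` have the adapted lift `F`, and let `e₁, e₂, e₃` be the tangent frame of `L` dual to `σ`.
The components of `∇_v df(e_j)`, for the Levi-Civita connection of `M`, in the unitary frame
`df(e₁), df(e₂), df(e₃)` of `(TM, J)` along `f`. -/
def leviCivitaFrame (T : L → Matrix (Fin 3) (Fin 3) ℂ) (F : L → G) (i j : Fin 3) (x : L)
    (v : TangentSpace (𝓡 3) x) : ℂ :=
  ((T x)ᴴ *ᵥ S.leviCivitaAlong F (fun y k => T y k j) x v) i

/-- The tangential part: `(∇_v df(e_j))ᵀ = ∑ i, tangentialForm i j (v) df(e_i)`. -/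
def tangentialForm (T : L → Matrix (Fin 3) (Fin 3) ℂ) (F : L → G) (i j : Fin 3) (x : L)
    (v : TangentSpace (𝓡 3) x) : ℝ := (S.leviCivitaFrame T F i j x v).re

/-- The second fundamental form: `II(v, e_j) = ∑ i, secondFundamentalForm i j (v) J df(e_i)`. -/
def secondFundamentalForm (T : L → Matrix (Fin 3) (Fin 3) ℂ) (F : L → G) (i j : Fin 3) (x : L)
    (v : TangentSpace (𝓡 3) x) : ℝ := (S.leviCivitaFrame T F i j x v).im

end InvariantSU3Structure

end Homogeneous

end

/-! The proof is Cartan's method of moving frames. Since the isotropy representation is faithful, an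
element of 𝔤 is determined by its 𝔪-part `ζ` in ℂ³ and the matrix `isotropy` of its 𝔥-part
(`ext_of_isotropy`). A solution with φ = α + iβ defines the 𝔤-valued 1-form η (`cartanForm`) with
𝔪-part Tσ and isotropy matrix TφT⁻¹ - dT T⁻¹; the gauge condition says exactly that the latter is
the matrix of an element of 𝔥.

As the canonical connection is the characteristic one, [X, Y]_𝔪 = -conj(X × Y) (`brM_eq`), and the
curvature is minus the isotropy action of [X, Y]_𝔥 (`curvature_eq`). Hence the 𝔪-part of dη + ½[η ∧
η] = 0 has the equation for dσ and β ∧ σ = 0 as its real and imaginary parts in the gauge T, and the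
𝔥-part likewise consists of the equations for dα and dβ (`maurerCartanEq_cartanForm`).

Cartan's theorem (`exists_contMDiff_hasLogDerivAt`) gives F : L → G with F⁻¹dF = η, and f = F · o.
In the chart of G around 1, F⁻¹dF = η is a total differential equation whose integrability condition
is the Maurer-Cartan equation. Frobenius' theorem (`exists_hasFDerivAt_of_fderiv_symm`) solves it
locally; the local solutions are unique up to left translation and are glued by a section of a
covering of the simply connected L (`exists_eventually_eq_mul_of_simplyConnected`).

In the frame F rotated by T, df is the real vector σ. So the metric is ∑ σᵢ², ω vanishes, and ψ = -i
det is imaginary. The Levi-Civita connection is the canonical one minus ½ conj(X × Y), so its matrix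
in this frame is α + iβ + ½[σ]: the real part is tangential and the imaginary part is the second
fundamental form.

For uniqueness, a second adapted lift F' has the same 𝔪-part Tσ, and its 𝔥-part differs in the gauge
T by a skew-Hermitian κ. The Maurer-Cartan equation of F' gives κ ∧ σ = 0, equality of second
fundamental forms makes κ real, and a skew κ with κ ∧ σ = 0 vanishes
(`eq_zero_of_skew_of_wedge_eq_zero`). Thus F and F' have the same logarithmic derivative and F' = aF
(`HasLogDerivAt.exists_eq_mul`). -/

/-! ### Frobenius' theorem for total differential equations du = Θ(x, u). -/

section TotalDifferentialEquations

open Set Metric Filter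
open scoped Topology NNReal

variable {X E : Type*} [NormedAddCommGroup X] [NormedSpace ℝ X]
  [NormedAddCommGroup E] [NormedSpace ℝ E]

/-- The Picard fixed point lives in a space of curves with values in the ball, so the solution never
leaves the region where the bounds on `f` are known. This confinement is what the later estimates
need. -/
theorem IsPicardLindelof.exists_eq_forall_mem_Icc_hasDerivWithinAt_mem_closedBall [CompleteSpace E]
    {f : ℝ → E → E} {tmin tmax : ℝ} {t₀ : Icc tmin tmax} {x₀ x : E} {a r L K : ℝ≥0}
    (hf : IsPicardLindelof f t₀ x₀ a r L K) (hx : x ∈ closedBall x₀ r) :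
    ∃ α : ℝ → E, α t₀ = x ∧ ∀ t ∈ Icc tmin tmax,
      HasDerivWithinAt α (f t (α t)) (Icc tmin tmax) t ∧ α t ∈ closedBall x₀ a := by
  obtain ⟨α, hα⟩ := ODE.FunSpace.exists_isFixedPt_next hf hx
  refine ⟨α.compProj, by rw [ODE.FunSpace.compProj_val, ← hα, ODE.FunSpace.next_apply₀],
    fun t ht ↦ ⟨?_, α.compProj_mem_closedBall hf.mul_max_le⟩⟩
  apply ODE.hasDerivWithinAt_picard_Icc t₀.2 hf.continuousOn_uncurry
    α.continuous_compProj.continuousOn (fun _ ht' ↦ α.compProj_mem_closedBall hf.mul_max_le)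
    x ht |>.congr_of_mem _ ht
  intro t' ht'
  nth_rw 1 [← hα]
  rw [ODE.FunSpace.compProj_of_mem ht', ODE.FunSpace.next_apply]

/-- Bounds, on a closed ball around `(x₀, p₀)`, for the right-hand side of the total differential
equation `du = Θ(x, u)`, together with its integrability. -/
structure IsIntegrableOnBall (Θ : X × E → X →L[ℝ] E) (z₀ : X × E) (K ρ : ℝ) : Prop where
  one_le : 1 ≤ K
  pos : 0 < ρ
  differentiableAt : ∀ z ∈ closedBall z₀ ρ, DifferentiableAt ℝ Θ z
  norm_le : ∀ z ∈ closedBall z₀ ρ, ‖Θ z‖ ≤ K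
  norm_fderiv_le : ∀ z ∈ closedBall z₀ ρ, ‖fderiv ℝ Θ z‖ ≤ K
  norm_fderiv_sub_le : ∀ z ∈ closedBall z₀ ρ, ∀ w ∈ closedBall z₀ ρ,
    ‖fderiv ℝ Θ z - fderiv ℝ Θ w‖ ≤ K * ‖z - w‖
  symm : ∀ z ∈ closedBall z₀ ρ, ∀ v w : X,
    fderiv ℝ Θ z (v, Θ z v) w = fderiv ℝ Θ z (w, Θ z w) v

/-- For Θ of class C² the derivative is C¹, hence Lipschitz near the point; the other bounds follow
by continuity. -/
theorem ContDiffAt.exists_isIntegrableOnBall {Θ : X × E → X →L[ℝ] E} {z₀ : X × E}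
    (hΘ : ContDiffAt ℝ 2 Θ z₀)
    (hsymm : ∀ᶠ z in 𝓝 z₀, ∀ v w : X,
      fderiv ℝ Θ z (v, Θ z v) w = fderiv ℝ Θ z (w, Θ z w) v) :
    ∃ K ρ : ℝ, IsIntegrableOnBall Θ z₀ K ρ := by
  have h1 : ContDiffAt ℝ 1 (fderiv ℝ Θ) z₀ := hΘ.fderiv_right (by norm_num)
  obtain ⟨K₀, t, ht, hlip⟩ := h1.exists_lipschitzOnWith
  have hd : ∀ᶠ z in 𝓝 z₀, DifferentiableAt ℝ Θ z :=
    (hΘ.eventually (by decide)).mono fun z hz => hz.differentiableAt (by norm_num)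
  have hb1 : ∀ᶠ z in 𝓝 z₀, ‖Θ z‖ < ‖Θ z₀‖ + 1 :=
    hΘ.continuousAt.norm.eventually_lt continuousAt_const (lt_add_one _)
  have := ((hd.and hb1).and hsymm).and ht
  obtain ⟨ρ, hρ, hball⟩ := (nhds_basis_closedBall.eventually_iff).1 this
  have n1 := norm_nonneg (Θ z₀)
  have n2 := norm_nonneg (fderiv ℝ Θ z₀)
  have n3 := K₀.coe_nonneg
  have n4 : 0 ≤ K₀ * ρ := by positivity
  -- One constant dominates all bounds: the 1 gives `1 ≤ K` and the slack in the bound of Θ, `K₀` is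
  -- the Lipschitz constant of the derivative, and `K₀ * ρ` bounds its drift from the value at `z₀`.
  refine ⟨‖Θ z₀‖ + ‖fderiv ℝ Θ z₀‖ + 1 + K₀ + K₀ * ρ, ρ, ⟨by linarith, hρ,
    fun z hz => (hball hz).1.1.1, fun z hz => ?_, fun z hz => ?_, fun z hz w hw => ?_,
    fun z hz => (hball hz).1.2⟩⟩
  · have := (hball hz).1.1.2; linarith
  · have h2 := hlip.norm_sub_le (hball hz).2 (mem_of_mem_nhds ht)
    have h3 := norm_le_norm_add_norm_sub' (fderiv ℝ Θ z) (fderiv ℝ Θ z₀)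
    have h4 : K₀ * ‖z - z₀‖ ≤ K₀ * ρ := by gcongr; exact mem_closedBall_iff_norm.1 hz
    linarith
  · have := hlip.norm_sub_le (hball hz).2 (hball hw).2
    refine this.trans ?_
    gcongr
    linarith

namespace IsIntegrableOnBall

variable {Θ : X × E → X →L[ℝ] E} {p₀ : E} {K ρ : ℝ}

/-- First-order Taylor estimate: along the segment the derivative deviates from its value at `z` by
at most `K * ‖w - z‖`, so the mean value inequality applies. -/
theorem norm_sub_sub_le (h : IsIntegrableOnBall Θ ((0 : X), p₀) K ρ) {z w : X × E}
    (hz : z ∈ closedBall ((0 : X), p₀) ρ) (hw : w ∈ closedBall ((0 : X), p₀) ρ) :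
    ‖Θ w - Θ z - fderiv ℝ Θ z (w - z)‖ ≤ K * ‖w - z‖ ^ 2 := by
  have hK : 0 ≤ K := zero_le_one.trans h.one_le
  have hseg : segment ℝ z w ⊆ closedBall ((0 : X), p₀) ρ :=
    (convex_closedBall _ _).segment_subset hz hw
  have := (convex_segment (𝕜 := ℝ) z w).norm_image_sub_le_of_norm_fderiv_le' (f := Θ)
    (φ := fderiv ℝ Θ z) (C := K * ‖w - z‖)
    (fun x hx => h.differentiableAt x (hseg hx)) (fun x hx => ?_)
    (left_mem_segment ℝ z w) (right_mem_segment ℝ z w)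
  · refine this.trans (le_of_eq (by ring))
  · refine (h.norm_fderiv_sub_le x (hseg hx) z hz).trans ?_
    gcongr
    obtain ⟨a, b, ha, hb, hab, rfl⟩ := hx
    have : a • z + b • w - z = b • (w - z) := by
      rw [← eq_sub_iff_add_eq] at hab; subst hab; module
    rw [this, norm_smul, Real.norm_of_nonneg hb]
    exact mul_le_of_le_one_left (norm_nonneg _) (by linarith)

theorem prod_mem_closedBall {z : X × E} (h1 : ‖z.1‖ ≤ ρ) (h2 : ‖z.2 - p₀‖ ≤ ρ) :
    z ∈ closedBall ((0 : X), p₀) ρ := by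
  obtain ⟨x, p⟩ := z
  rw [Metric.mem_closedBall, Prod.dist_eq, dist_zero_right, dist_eq_norm]
  exact sup_le h1 h2

theorem lipschitzOnWith (h : IsIntegrableOnBall Θ ((0 : X), p₀) K ρ) {x y : X} (hx : ‖x‖ ≤ ρ)
    (hy : ‖y‖ ≤ 1) :
    LipschitzOnWith K.toNNReal (fun p => Θ (x, p) y) (closedBall p₀ ρ) := by
  have hK : 0 ≤ K := zero_le_one.trans h.one_le
  refine LipschitzOnWith.of_dist_le_mul fun p hp q hq => ?_
  rw [Real.coe_toNNReal _ hK, dist_eq_norm, dist_eq_norm, ← sub_apply]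
  rw [mem_closedBall_iff_norm] at hp hq
  have := (convex_closedBall ((0 : X), p₀) ρ).norm_image_sub_le_of_norm_fderiv_le (f := Θ)
    (fun z hz => h.differentiableAt z hz) (fun z hz => h.norm_fderiv_le z hz)
    (prod_mem_closedBall (z := (x, q)) hx hq) (prod_mem_closedBall (z := (x, p)) hx hp)
  refine ((Θ (x, p) - Θ (x, q)).le_opNorm y).trans ?_
  have e : ‖((x, p) : X × E) - (x, q)‖ = ‖p - q‖ := by simp [Prod.norm_def]
  rw [e] at this
  calc _ ≤ K * ‖p - q‖ * 1 := by gcongr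
    _ = _ := by ring

/-- The equation restricted to the ray through `x` is an ODE whose speed is at most `K * ‖x‖ ≤ ρ /
2`, so in unit time the solution stays in the ball of half the radius. The other half is room for
the comparison curve in `norm_radial_sub_le`. -/
theorem exists_radial [CompleteSpace E] (h : IsIntegrableOnBall Θ ((0 : X), p₀) K ρ) {x : X}
    (hx : ‖x‖ ≤ 1) (hxρ : K * ‖x‖ ≤ ρ / 2) :
    ∃ α : ℝ → E, α 0 = p₀ ∧ ∀ t ∈ Icc (0 : ℝ) 1,
      HasDerivWithinAt α (Θ (t • x, α t) x) (Icc 0 1) t ∧ α t ∈ closedBall p₀ (ρ / 2) := by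
  have hK : 0 ≤ K := zero_le_one.trans h.one_le
  have hρ := h.pos
  have hxρ' : ‖x‖ ≤ ρ := by nlinarith [norm_nonneg x, h.one_le]
  have htx : ∀ t ∈ Icc (0 : ℝ) 1, ‖t • x‖ ≤ ρ := fun t ht => by
    rw [norm_smul, Real.norm_of_nonneg ht.1]
    exact (mul_le_of_le_one_left (norm_nonneg _) ht.2).trans hxρ'
  have hsub : closedBall p₀ ((ρ / 2).toNNReal : ℝ) ⊆ closedBall p₀ ρ := by
    rw [Real.coe_toNNReal _ (by positivity)]
    exact closedBall_subset_closedBall (by linarith)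
  have key : IsPicardLindelof (fun t p => Θ (t • x, p) x) (tmin := 0) (tmax := 1)
      ⟨0, by simp⟩ p₀ (ρ / 2).toNNReal 0 (ρ / 2).toNNReal K.toNNReal := by
    refine ⟨fun t ht => (h.lipschitzOnWith (htx t ht) hx).mono hsub, fun p hp => ?_,
      fun t ht p hp => ?_, by simp⟩
    · intro t ht
      have hz := prod_mem_closedBall (p₀ := p₀) (z := (t • x, p)) (htx t ht)
        (mem_closedBall_iff_norm.1 (hsub hp))
      have := (h.differentiableAt _ hz).continuousAt.comp
        (f := fun s : ℝ => ((s • x, p) : X × E)) (x := t) (by fun_prop)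
      exact (this.clm_apply continuousAt_const).continuousWithinAt
    · have hz := prod_mem_closedBall (p₀ := p₀) (z := (t • x, p)) (htx t ht)
        (mem_closedBall_iff_norm.1 (hsub hp))
      rw [Real.coe_toNNReal _ (by positivity)]
      refine ((Θ _).le_opNorm x).trans (le_trans ?_ hxρ)
      gcongr
      exact h.norm_le _ hz
  obtain ⟨α, h0, hα⟩ := key.exists_eq_forall_mem_Icc_hasDerivWithinAt_mem_closedBall
    (x := p₀) (by simp)
  refine ⟨α, h0, fun t ht => ⟨(hα t ht).1, ?_⟩⟩
  simpa [Real.coe_toNNReal _ (by positivity : 0 ≤ ρ / 2)] using (hα t ht).2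

/-- The variation of the radial solutions is known in advance: by integrability, moving α in the
direction `t • Θ(t • x, α t) (y - x)` gives a curve that solves the ray equation of `y` up to a
quadratic error. Gronwall's inequality compares it with γ. -/
theorem norm_radial_sub_le (h : IsIntegrableOnBall Θ ((0 : X), p₀) K ρ) {x y : X}
    (hxρ : K * ‖x‖ ≤ ρ / 2) (hy : ‖y‖ ≤ 1) (hyρ : K * ‖y‖ ≤ ρ / 2)
    (hxy : K * ‖y - x‖ ≤ ρ / 2) {α γ : ℝ → E} (hα0 : α 0 = p₀) (hγ0 : γ 0 = p₀)
    (hα : ∀ t ∈ Icc (0 : ℝ) 1,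
      HasDerivWithinAt α (Θ (t • x, α t) x) (Icc 0 1) t ∧ α t ∈ closedBall p₀ (ρ / 2))
    (hγ : ∀ t ∈ Icc (0 : ℝ) 1,
      HasDerivWithinAt γ (Θ (t • y, γ t) y) (Icc 0 1) t ∧ γ t ∈ closedBall p₀ (ρ / 2)) :
    ‖γ 1 - α 1 - Θ (x, α 1) (y - x)‖ ≤
      gronwallBound 0 K (K ^ 2 * (K + 1) * ‖y - x‖ ^ 2) 1 := by
  have hK1 := h.one_le
  have hK : 0 ≤ K := zero_le_one.trans h.one_le
  have hρ := h.pos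
  set v := y - x with hv
  have hnorm : ∀ {x : X}, K * ‖x‖ ≤ ρ / 2 → ∀ t ∈ Icc (0 : ℝ) 1, ‖t • x‖ ≤ ρ :=
      fun {x} hxρ t ht => by
    rw [norm_smul, Real.norm_of_nonneg ht.1]
    have := mul_le_of_le_one_left (norm_nonneg x) ht.2
    nlinarith [norm_nonneg x, h.one_le]
  have hsub : closedBall p₀ (ρ / 2) ⊆ closedBall p₀ ρ := closedBall_subset_closedBall (by linarith)
  set z : ℝ → X × E := fun t => (t • x, α t) with hzdef
  have hz : ∀ t ∈ Icc (0 : ℝ) 1, z t ∈ closedBall ((0 : X), p₀) ρ := fun t ht =>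
    prod_mem_closedBall (hnorm hxρ t ht) (mem_closedBall_iff_norm.1 (hsub (hα t ht).2))
  -- The candidate for γ to first order. At `t = 1` its displacement from α is `Θ (x, α 1) (y - x)`,
  -- the expected derivative.
  set w : ℝ → E := fun t => α t + t • Θ (z t) v with hwdef
  have hΘv : ∀ t ∈ Icc (0 : ℝ) 1, ‖Θ (z t) v‖ ≤ K * ‖v‖ := fun t ht =>
    ((Θ _).le_opNorm v).trans (by gcongr; exact h.norm_le _ (hz t ht))
  have hwmem : ∀ t ∈ Icc (0 : ℝ) 1, w t ∈ closedBall p₀ ρ := fun t ht => by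
    rw [mem_closedBall_iff_norm]
    have h1 := mem_closedBall_iff_norm.1 (hα t ht).2
    have h2 := hΘv t ht
    have h3 : ‖t • Θ (z t) v‖ ≤ ‖Θ (z t) v‖ := by
      rw [norm_smul, Real.norm_of_nonneg ht.1]
      exact mul_le_of_le_one_left (norm_nonneg _) ht.2
    calc ‖w t - p₀‖ = ‖(α t - p₀) + t • Θ (z t) v‖ := by rw [hwdef]; congr 1; simp only; abel
      _ ≤ _ := norm_add_le _ _
      _ ≤ ρ := by linarith
  have hzd : ∀ t ∈ Icc (0 : ℝ) 1, HasDerivWithinAt z (x, Θ (z t) x) (Icc 0 1) t := fun t ht => by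
    refine HasDerivWithinAt.prodMk ?_ (hα t ht).1
    simpa using ((hasDerivAt_id t).smul_const x).hasDerivWithinAt
  set w' : ℝ → E := fun t => Θ (z t) x + (t • fderiv ℝ Θ (z t) (x, Θ (z t) x) v + Θ (z t) v)
    with hw'def
  have hwd : ∀ t ∈ Icc (0 : ℝ) 1, HasDerivWithinAt w (w' t) (Icc 0 1) t := fun t ht => by
    have h1 := (h.differentiableAt _ (hz t ht)).hasFDerivAt.comp_hasDerivWithinAt t (hzd t ht)
    have h2 := h1.clm_apply (hasDerivWithinAt_const t (Icc (0 : ℝ) 1) v)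
    have h3 := (hasDerivAt_id t).hasDerivWithinAt (s := Icc (0 : ℝ) 1) |>.smul h2
    have h4 := (hα t ht).1.add h3
    convert! h4 using 1
    simp [hw'def, z]
  have hbound : ∀ t ∈ Icc (0 : ℝ) 1,
      dist (w' t) (Θ (t • y, w t) y) ≤ K ^ 2 * (K + 1) * ‖v‖ ^ 2 := fun t ht => by
    set k : X × E := (t • v, t • Θ (z t) v) with hk
    have hzk : z t + k = (t • y, w t) := by
      rw [hk, hwdef, hv]
      refine Prod.ext ?_ rfl
      simp only [hzdef, Prod.mk_add_mk]
      module
    have hkn : ‖k‖ ≤ K * ‖v‖ := by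
      rw [hk, Prod.norm_def, sup_le_iff, norm_smul, norm_smul, Real.norm_of_nonneg ht.1]
      constructor
      · exact (mul_le_of_le_one_left (norm_nonneg _) ht.2).trans
          (le_mul_of_one_le_left (norm_nonneg _) hK1)
      · exact (mul_le_of_le_one_left (norm_nonneg _) ht.2).trans (hΘv t ht)
    have hmem : z t + k ∈ closedBall ((0 : X), p₀) ρ := by
      rw [hzk]
      exact prod_mem_closedBall (hnorm hyρ t ht) (mem_closedBall_iff_norm.1 (hwmem t ht))
    have hR := h.norm_sub_sub_le (hz t ht) hmem
    rw [add_sub_cancel_left] at hR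
    -- The only use of integrability: it exchanges `x` and `v`, so that this term cancels against
    -- the derivative of `t • Θ (z t) v`.
    have hkx : fderiv ℝ Θ (z t) k x = t • fderiv ℝ Θ (z t) (x, Θ (z t) x) v := by
      have : k = t • (v, Θ (z t) v) := rfl
      rw [this, map_smul, smul_apply, h.symm _ (hz t ht)]
    rw [← hzk, dist_comm, dist_eq_norm]
    -- With `y = x + v` all first-order terms cancel; what is left is one term bilinear in `(k, v)`
    -- and the Taylor remainder, both quadratic in `v`.
    have e : Θ (z t + k) y - w' t =
        fderiv ℝ Θ (z t) k v + (Θ (z t + k) - Θ (z t) - fderiv ℝ Θ (z t) k) y := by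
      have hy : y = x + v := by rw [hv]; abel
      simp only [hw'def, ← hkx, sub_apply]
      rw [hy]; simp only [map_add]; abel
    rw [e]
    have b1 : ‖fderiv ℝ Θ (z t) k v‖ ≤ K * (K * ‖v‖) * ‖v‖ :=
      ((fderiv ℝ Θ (z t) k).le_opNorm v).trans (by
        gcongr
        exact ((fderiv ℝ Θ (z t)).le_opNorm k).trans (by
          gcongr; exact h.norm_fderiv_le _ (hz t ht)))
    have b2 : ‖(Θ (z t + k) - Θ (z t) - fderiv ℝ Θ (z t) k) y‖ ≤ K * (K * ‖v‖) ^ 2 * 1 :=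
      (ContinuousLinearMap.le_opNorm _ y).trans (by
        gcongr
        exact hR.trans (by gcongr))
    refine (norm_add_le _ _).trans ((add_le_add b1 b2).trans (le_of_eq (by ring)))
  have hIci : ∀ t ∈ Ico (0 : ℝ) 1, Icc (0 : ℝ) 1 ∈ 𝓝[≥] t := fun t ht =>
    mem_of_superset (Icc_mem_nhdsGE ht.2) (Icc_subset_Icc_left ht.1)
  have hIcc : ∀ t ∈ Ico (0 : ℝ) 1, t ∈ Icc (0 : ℝ) 1 := fun t ht => ⟨ht.1, ht.2.le⟩
  have := dist_le_of_approx_trajectories_ODE_of_mem (K := K.toNNReal)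
    (v := fun t p => Θ (t • y, p) y)
    (s := fun _ => closedBall p₀ ρ) (f := γ) (g := w) (a := 0) (b := 1) (δ := 0) (εf := 0)
    (f' := fun t => Θ (t • y, γ t) y) (g' := w') (εg := K ^ 2 * (K + 1) * ‖v‖ ^ 2)
    (fun t ht => h.lipschitzOnWith (hnorm hyρ t (hIcc t ht)) hy)
    (fun t ht => (hγ t ht).1.continuousWithinAt)
    (fun t ht => (hγ t (hIcc t ht)).1.mono_of_mem_nhdsWithin (hIci t ht))
    (fun t ht => by simp)
    (fun t ht => hsub (hγ t (hIcc t ht)).2)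
    (fun t ht => (hwd t ht).continuousWithinAt)
    (fun t ht => (hwd t (hIcc t ht)).mono_of_mem_nhdsWithin (hIci t ht))
    (fun t ht => hbound t (hIcc t ht))
    (fun t ht => hwmem t (hIcc t ht))
    (by simp [hwdef, hα0, hγ0]) 1 (by simp)
  rw [dist_eq_norm, Real.coe_toNNReal _ hK, zero_add, sub_zero] at this
  simpa [hwdef, hzdef, sub_sub] using this

theorem exists_hasFDerivAt [CompleteSpace E] (h : IsIntegrableOnBall Θ ((0 : X), p₀) K ρ) :
    ∃ u : X → E, u 0 = p₀ ∧ ∀ᶠ x in 𝓝 0, HasFDerivAt u (Θ (x, u x)) x := by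
  have hK1 := h.one_le
  have hK : 0 < K := zero_lt_one.trans_le h.one_le
  have hρ := h.pos
  -- The factor 4 makes `K * ‖y - x‖ ≤ ρ / 2` hold for any two points of the ball, as
  -- `norm_radial_sub_le` requires.
  set r : ℝ := min 1 (ρ / (4 * K)) with hr
  have hr0 : 0 < r := by positivity
  have hr1 : ∀ x ∈ ball (0 : X) r, ‖x‖ ≤ 1 ∧ K * ‖x‖ ≤ ρ / 4 := fun x hx => by
    rw [mem_ball_zero_iff, hr, lt_min_iff] at hx
    refine ⟨hx.1.le, ?_⟩
    calc K * ‖x‖ ≤ K * (ρ / (4 * K)) := by gcongr; exact hx.2.le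
      _ = ρ / 4 := by field_simp
  have : ∀ x : X, ∃ α : ℝ → E, x ∈ ball (0 : X) r → α 0 = p₀ ∧ ∀ t ∈ Icc (0 : ℝ) 1,
      HasDerivWithinAt α (Θ (t • x, α t) x) (Icc 0 1) t ∧ α t ∈ closedBall p₀ (ρ / 2) := fun x => by
    by_cases hx : x ∈ ball (0 : X) r
    · obtain ⟨α, hα⟩ := h.exists_radial (hr1 x hx).1 ((hr1 x hx).2.trans (by linarith))
      exact ⟨α, fun _ => hα⟩
    · exact ⟨0, fun h => absurd h hx⟩
  choose α hα using this
  refine ⟨fun x => α x 1, ?_, ?_⟩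
  -- On the ray through the origin the equation is `α' = 0`, so the chosen solution is constant.
  · obtain ⟨h0, h1⟩ := hα 0 (mem_ball_self hr0)
    rw [← h0]
    refine constant_of_derivWithin_zero (a := 0) (b := 1)
      (fun t ht => (h1 t ht).1.differentiableWithinAt) (fun t ht => ?_) 1 (by simp)
    have := (h1 t ⟨ht.1, ht.2.le⟩).1
    rw [map_zero] at this
    exact this.derivWithin ((uniqueDiffOn_Icc zero_lt_one) t ⟨ht.1, ht.2.le⟩)
  · filter_upwards [ball_mem_nhds (0 : X) hr0] with x hx
    obtain ⟨C, hC⟩ : ∃ C : ℝ, ∀ y ∈ ball (0 : X) r,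
        ‖α y 1 - α x 1 - Θ (x, α x 1) (y - x)‖ ≤ C * ‖y - x‖ ^ 2 := by
      refine ⟨K ^ 2 * (K + 1) / K * (Real.exp (K * 1) - 1), fun y hy => ?_⟩
      have := h.norm_radial_sub_le ((hr1 x hx).2.trans (by linarith)) (hr1 y hy).1
        ((hr1 y hy).2.trans (by linarith)) ?_ (hα x hx).1 (hα y hy).1 (hα x hx).2 (hα y hy).2
      · rw [gronwallBound_of_K_ne_0 hK.ne'] at this
        refine this.trans (le_of_eq (by ring))
      · have := norm_sub_le y x
        have h1 := (hr1 x hx).2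
        have h2 := (hr1 y hy).2
        nlinarith
    rw [hasFDerivAt_iff_isLittleO]
    have hO : (fun y => α y 1 - α x 1 - Θ (x, α x 1) (y - x)) =O[𝓝 x] fun y => ‖y - x‖ ^ 2 := by
      refine Asymptotics.IsBigO.of_bound C ?_
      filter_upwards [isOpen_ball.mem_nhds hx] with y hy
      simpa using hC y hy
    refine hO.trans_isLittleO ?_
    have : Tendsto (fun y => y - x) (𝓝 x) (𝓝 0) := by
      simpa using (continuous_sub_right x).tendsto x
    exact (Asymptotics.isLittleO_norm_pow_id one_lt_two).comp_tendsto this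

end IsIntegrableOnBall

/-- **Frobenius' theorem** for total differential equations. -/
theorem exists_hasFDerivAt_of_fderiv_symm [CompleteSpace E] {Θ : X × E → X →L[ℝ] E} {x₀ : X}
    {p₀ : E} (hΘ : ContDiffAt ℝ 2 Θ (x₀, p₀))
    (hsymm : ∀ᶠ z in 𝓝 (x₀, p₀), ∀ v w : X,
      fderiv ℝ Θ z (v, Θ z v) w = fderiv ℝ Θ z (w, Θ z w) v) :
    ∃ u : X → E, u x₀ = p₀ ∧ ∀ᶠ x in 𝓝 x₀, HasFDerivAt u (Θ (x, u x)) x := by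
  set s : X × E → X × E := fun z => z + (x₀, 0) with hs
  have hs0 : s (0, p₀) = (x₀, p₀) := by simp [hs]
  have hfd : ∀ z, fderiv ℝ (Θ ∘ s) z = fderiv ℝ Θ (s z) := fun z => fderiv_comp_add_right _
  have h1 : ContDiffAt ℝ 2 (Θ ∘ s) (0, p₀) :=
    ContDiffAt.comp _ (by rwa [hs0]) (by fun_prop)
  have h2 : Tendsto s (𝓝 (0, p₀)) (𝓝 (x₀, p₀)) := by
    rw [← hs0]; exact Continuous.tendsto (by fun_prop) _
  obtain ⟨K, ρ, h⟩ := h1.exists_isIntegrableOnBall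
    ((h2.eventually hsymm).mono fun z hz v w => by rw [hfd]; exact hz v w)
  obtain ⟨u, hu0, hu⟩ := h.exists_hasFDerivAt
  refine ⟨fun x => u (x - x₀), by simpa using hu0, ?_⟩
  have h3 : Tendsto (fun x => x - x₀) (𝓝 x₀) (𝓝 0) := by
    simpa using (continuous_sub_right x₀).tendsto x₀
  filter_upwards [h3.eventually hu] with x hx
  have := hx.comp x ((hasFDerivAt_id x).sub_const x₀)
  simpa [hs, Function.comp_def] using! this

/-- Solutions of a smooth total differential equation are smooth. -/
theorem ContDiffOn.of_hasFDerivAt {Θ : X × E → X →L[ℝ] E} {s : Set (X × E)} {t : Set X}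
    (hΘ : ContDiffOn ℝ ∞ Θ s) (ht : IsOpen t) {u : X → E}
    (hu : ∀ x ∈ t, HasFDerivAt u (Θ (x, u x)) x) (hmem : ∀ x ∈ t, (x, u x) ∈ s) :
    ContDiffOn ℝ ∞ u t := by
  rw [contDiffOn_infty]
  intro n
  have hd : DifferentiableOn ℝ u t := fun x hx => (hu x hx).differentiableAt.differentiableWithinAt
  -- Bootstrap: if `u` is Cⁿ then so is its derivative `Θ (x, u x)`.
  induction n with
  | zero => exact contDiffOn_zero.2 hd.continuousOn
  | succ n ih =>
    rw [Nat.cast_succ, contDiffOn_succ_iff_fderiv_of_isOpen ht]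
    refine ⟨hd, by simp, ?_⟩
    refine ((hΘ.of_le (by exact_mod_cast le_top)).comp (contDiffOn_id.prodMk ih) hmem).congr
      fun x hx => (hu x hx).fderiv

/-- Two solutions of a total differential equation which agree at a point agree near it. -/
theorem eventually_eq_of_hasFDerivAt {Θ : X × E → X →L[ℝ] E} {x₀ : X} {p₀ : E}
    (hΘ : ContDiffAt ℝ 1 Θ (x₀, p₀)) {u₁ u₂ : X → E} (h₁ : u₁ x₀ = p₀) (h₂ : u₂ x₀ = p₀)
    (hu₁ : ∀ᶠ x in 𝓝 x₀, HasFDerivAt u₁ (Θ (x, u₁ x)) x)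
    (hu₂ : ∀ᶠ x in 𝓝 x₀, HasFDerivAt u₂ (Θ (x, u₂ x)) x) :
    ∀ᶠ x in 𝓝 x₀, u₁ x = u₂ x := by
  obtain ⟨K, s, hs, hlip⟩ := hΘ.exists_lipschitzOnWith
  have hc : ∀ {u : X → E}, u x₀ = p₀ → (∀ᶠ x in 𝓝 x₀, HasFDerivAt u (Θ (x, u x)) x) →
      ∀ᶠ x in 𝓝 x₀, (x, u x) ∈ s := fun {u} h hu => by
    have : ContinuousAt (fun x => (x, u x)) x₀ :=
      continuousAt_id.prodMk hu.self_of_nhds.continuousAt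
    exact this.eventually (by simp only [h]; exact hs)
  obtain ⟨ρ, hρ, hball⟩ := (nhds_basis_ball.eventually_iff).1
    (((hu₁.and hu₂).and (hc h₁ hu₁)).and (hc h₂ hu₂))
  filter_upwards [ball_mem_nhds x₀ hρ] with x hx
  -- Along the segment from `x₀` to `x` both functions solve the same ODE, with Lipschitz constant
  -- `K * ‖x - x₀‖`.
  set g : ℝ → X := fun t => x₀ + t • (x - x₀) with hg
  have hgm : ∀ t ∈ Icc (0 : ℝ) 1, g t ∈ ball x₀ ρ := fun t ht => by
    rw [mem_ball_iff_norm] at hx ⊢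
    rw [hg, add_sub_cancel_left, norm_smul, Real.norm_of_nonneg ht.1]
    exact (mul_le_of_le_one_left (norm_nonneg _) ht.2).trans_lt hx
  have hgd : ∀ t, HasDerivAt g (x - x₀) t := fun t => by
    simpa [hg] using ((hasDerivAt_id t).smul_const (x - x₀))
  have hd₁ : ∀ t ∈ Icc (0 : ℝ) 1,
      HasDerivAt (u₁ ∘ g) (Θ (g t, u₁ (g t)) (x - x₀)) t := fun t ht =>
    (hball (hgm t ht)).1.1.1.comp_hasDerivAt t (hgd t)
  have hd₂ : ∀ t ∈ Icc (0 : ℝ) 1,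
      HasDerivAt (u₂ ∘ g) (Θ (g t, u₂ (g t)) (x - x₀)) t := fun t ht =>
    (hball (hgm t ht)).1.1.2.comp_hasDerivAt t (hgd t)
  have hIcc : ∀ t ∈ Ico (0 : ℝ) 1, t ∈ Icc (0 : ℝ) 1 := fun t ht => ⟨ht.1, ht.2.le⟩
  have := ODE_solution_unique_of_mem_Icc_right (a := 0) (b := 1) (K := K * ‖x - x₀‖₊)
    (v := fun t p => Θ (g t, p) (x - x₀)) (s := fun t => {p | (g t, p) ∈ s})
    (f := u₁ ∘ g) (g := u₂ ∘ g) (fun t ht => ?_)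
    (fun t ht => (hd₁ t ht).continuousAt.continuousWithinAt)
    (fun t ht => (hd₁ t (hIcc t ht)).hasDerivWithinAt)
    (fun t ht => (hball (hgm t (hIcc t ht))).1.2)
    (fun t ht => (hd₂ t ht).continuousAt.continuousWithinAt)
    (fun t ht => (hd₂ t (hIcc t ht)).hasDerivWithinAt)
    (fun t ht => (hball (hgm t (hIcc t ht))).2)
    (by simp [hg, h₁, h₂]) (show (1 : ℝ) ∈ Icc 0 1 by simp)
  · simpa [hg] using this
  · refine LipschitzOnWith.of_dist_le_mul fun p hp q hq => ?_
    have := hlip.dist_le_mul _ hp _ hq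
    rw [dist_eq_norm, ← sub_apply]
    refine (ContinuousLinearMap.le_opNorm _ _).trans ?_
    rw [dist_eq_norm, Prod.dist_eq, dist_self, max_eq_right dist_nonneg] at this
    rw [NNReal.coe_mul, coe_nnnorm]
    calc _ ≤ K * dist p q * ‖x - x₀‖ := by gcongr
      _ = _ := by ring

end TotalDifferentialEquations

/-! ### Left invariant vector fields in the chart around the identity. -/

section LieGroupChart

open Set Filter VectorField
open scoped Topology

theorem three_le_infty : (3 : ℕ∞ω) ≤ ∞ := WithTop.coe_le_coe.2 (le_top : (3 : ℕ∞) ≤ ⊤)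

theorem two_le_infty : (2 : ℕ∞ω) ≤ ∞ := WithTop.coe_le_coe.2 (le_top : (2 : ℕ∞) ≤ ⊤)

theorem mdifferentiableAt_extChartAt_symm {H M : Type*} [NormedAddCommGroup H] [NormedSpace ℝ H]
    [TopologicalSpace M] [ChartedSpace H M] [IsManifold 𝓘(ℝ, H) 1 M] {x : M} {p : H}
    (hp : p ∈ (extChartAt 𝓘(ℝ, H) x).target) :
    MDifferentiableAt 𝓘(ℝ, H) 𝓘(ℝ, H) (extChartAt 𝓘(ℝ, H) x).symm p :=
  ((contMDiffOn_extChartAt_symm (n := 1) x).contMDiffAt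
    ((isOpen_extChartAt_target x).mem_nhds hp)).mdifferentiableAt one_ne_zero

theorem mfderiv_extChartAt_symm_self {H M : Type*} [NormedAddCommGroup H] [NormedSpace ℝ H]
    [TopologicalSpace M] [ChartedSpace H M] [IsManifold 𝓘(ℝ, H) 1 M] (x : M) :
    (mfderiv 𝓘(ℝ, H) 𝓘(ℝ, H) (extChartAt 𝓘(ℝ, H) x).symm (extChartAt 𝓘(ℝ, H) x x) : H →L[ℝ] H)
      = ContinuousLinearMap.id ℝ H := by
  have := mfderivWithin_range_extChartAt_symm (I := 𝓘(ℝ, H)) (x := x)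
  rw [ModelWithCorners.range_eq_univ, mfderivWithin_univ] at this
  exact this

variable {E : Type*} [NormedAddCommGroup E] [NormedSpace ℝ E]
  {G : Type*} [TopologicalSpace G] [ChartedSpace E G] [Group G]

/-- The derivative at `g` of the left translation by `a`. -/
noncomputable def leftDeriv (a g : G) : E →L[ℝ] E :=
  mfderiv 𝓘(ℝ, E) 𝓘(ℝ, E) (fun h : G => a * h) g

theorem leftDeriv_one_left (g : G) : (leftDeriv 1 g : E →L[ℝ] E) = ContinuousLinearMap.id ℝ E := by
  have : (fun g : G => 1 * g) = id := by ext; simp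
  rw [leftDeriv, this]
  exact mfderiv_id

/-- The bracket of the Lie algebra of `G`, on the model vector space. -/
noncomputable def modelBracket (G : Type*) [TopologicalSpace G] [ChartedSpace E G] [Group G]
    (X Y : E) : E :=
  (⁅(show GroupLieAlgebra 𝓘(ℝ, E) G from X), (show GroupLieAlgebra 𝓘(ℝ, E) G from Y)⁆ :
    GroupLieAlgebra 𝓘(ℝ, E) G)

/-- The derivative of the chart of `G` around `1`. -/
noncomputable def chartDeriv (g : G) : E →L[ℝ] E :=
  mfderiv 𝓘(ℝ, E) 𝓘(ℝ, E) (extChartAt 𝓘(ℝ, E) (1 : G)) g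

/-- The derivative of the inverse of the chart of `G` around `1`. -/
noncomputable def chartSymmDeriv (G : Type*) [TopologicalSpace G] [ChartedSpace E G] [Group G]
    (p : E) : E →L[ℝ] E :=
  mfderiv 𝓘(ℝ, E) 𝓘(ℝ, E) (extChartAt 𝓘(ℝ, E) (1 : G)).symm p

/-- The left invariant vector fields of `G`, in the chart around `1`. -/
noncomputable def chartField (G : Type*) [TopologicalSpace G] [ChartedSpace E G] [Group G]
    (p : E) : E →L[ℝ] E :=
  fderiv ℝ (fun q => extChartAt 𝓘(ℝ, E) (1 : G) ((extChartAt 𝓘(ℝ, E) (1 : G)).symm p *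
    (extChartAt 𝓘(ℝ, E) (1 : G)).symm q)) (extChartAt 𝓘(ℝ, E) (1 : G) 1)

variable [LieGroup 𝓘(ℝ, E) ∞ G]

theorem LieGroup.minSmoothness_real : LieGroup 𝓘(ℝ, E) (minSmoothness ℝ 3) G :=
  LieGroup.of_le (n := ∞) (by simpa using three_le_infty)

theorem hasMFDerivAt_mul_left (a g : G) :
    HasMFDerivAt 𝓘(ℝ, E) 𝓘(ℝ, E) (fun h : G => a * h) g (leftDeriv a g : E →L[ℝ] E) :=
  ((contMDiff_mul_left (n := ∞)).mdifferentiable (by simp) g).hasMFDerivAt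

theorem leftDeriv_comp (a b c : G) :
    (leftDeriv a (b * c) : E →L[ℝ] E).comp (leftDeriv b c) = leftDeriv (a * b) c := by
  have h := (hasMFDerivAt_mul_left (E := E) a (b * c)).comp c (hasMFDerivAt_mul_left b c)
  have h' : (fun g : G => a * g) ∘ (fun g : G => b * g) = fun g : G => a * b * g := by
    ext g; simp [mul_assoc]
  rw [h'] at h
  exact hasMFDerivAt_unique h (hasMFDerivAt_mul_left _ _)

theorem leftDeriv_comp_apply (a b c : G) (v : E) :
    leftDeriv a (b * c) (leftDeriv b c v) = leftDeriv (a * b) c v :=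
  DFunLike.congr_fun (leftDeriv_comp a b c) v

theorem leftDeriv_inv_mul_apply (g : G) (v : E) :
    leftDeriv g⁻¹ g (leftDeriv g 1 v) = v := by
  have := leftDeriv_comp_apply g⁻¹ g 1 v
  rwa [mul_one, inv_mul_cancel, leftDeriv_one_left] at this

theorem leftDeriv_mul_inv_apply (g : G) (v : E) :
    leftDeriv g 1 (leftDeriv g⁻¹ g v) = v := by
  have := leftDeriv_comp_apply g g⁻¹ g v
  rwa [inv_mul_cancel, mul_inv_cancel, leftDeriv_one_left] at this

/-- The field is the partial derivative in the second variable of the multiplication read in the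
chart, which is jointly smooth. -/
theorem contDiffOn_chartField :
    ContDiffOn ℝ ∞ (chartField (E := E) G) (extChartAt 𝓘(ℝ, E) (1 : G)).target := by
  intro p hp
  refine ContDiffAt.contDiffWithinAt ?_
  have hm : ContMDiffAt 𝓘(ℝ, E × E) 𝓘(ℝ, E) ∞ (fun z : E × E => extChartAt 𝓘(ℝ, E) (1 : G)
      ((extChartAt 𝓘(ℝ, E) (1 : G)).symm z.1 * (extChartAt 𝓘(ℝ, E) (1 : G)).symm z.2))
      (p, extChartAt 𝓘(ℝ, E) (1 : G) 1) := by
    have hs : ∀ q ∈ (extChartAt 𝓘(ℝ, E) (1 : G)).target,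
        ContMDiffAt 𝓘(ℝ, E) 𝓘(ℝ, E) ∞ (extChartAt 𝓘(ℝ, E) (1 : G)).symm q := fun q hq =>
      (contMDiffOn_extChartAt_symm (n := ∞) (1 : G)).contMDiffAt
        ((isOpen_extChartAt_target (1 : G)).mem_nhds hq)
    have h1 : ContMDiffAt 𝓘(ℝ, E × E) 𝓘(ℝ, E) ∞ (fun z : E × E =>
      (extChartAt 𝓘(ℝ, E) (1 : G)).symm z.1 * (extChartAt 𝓘(ℝ, E) (1 : G)).symm z.2)
      (p, extChartAt 𝓘(ℝ, E) (1 : G) 1) := by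
      refine ContMDiffAt.mul (I := 𝓘(ℝ, E)) ?_ ?_
      · exact (hs p hp).comp (x := (p, extChartAt 𝓘(ℝ, E) (1 : G) 1)) (f := Prod.fst)
          (contDiff_fst.contDiffAt.contMDiffAt)
      · exact (hs _ (mem_extChartAt_target 1)).comp (x := (p, extChartAt 𝓘(ℝ, E) (1 : G) 1))
          (f := Prod.snd) (contDiff_snd.contDiffAt.contMDiffAt)
    refine ContMDiffAt.comp _ (contMDiffAt_extChartAt' (I := 𝓘(ℝ, E)) ?_) h1
    have := (extChartAt 𝓘(ℝ, E) (1 : G)).map_target hp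
    rw [extChartAt_to_inv, mul_one]
    rwa [extChartAt_source] at this
  exact ContDiffAt.fderiv (n := ∞) hm.contDiffAt contDiffAt_const (by simp)

theorem hasMFDerivAt_extChartAt_one {g : G} (hg : g ∈ (extChartAt 𝓘(ℝ, E) (1 : G)).source) :
    HasMFDerivAt 𝓘(ℝ, E) 𝓘(ℝ, E) (extChartAt 𝓘(ℝ, E) (1 : G)) g (chartDeriv g : E →L[ℝ] E) :=
  (mdifferentiableAt_extChartAt (by rwa [extChartAt_source] at hg)).hasMFDerivAt

theorem hasMFDerivAt_extChartAt_one_symm {p : E}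
    (hp : p ∈ (extChartAt 𝓘(ℝ, E) (1 : G)).target) :
    HasMFDerivAt 𝓘(ℝ, E) 𝓘(ℝ, E) (extChartAt 𝓘(ℝ, E) (1 : G)).symm p
      (chartSymmDeriv G p : E →L[ℝ] E) :=
  (mdifferentiableAt_extChartAt_symm hp).hasMFDerivAt

theorem chartDeriv_comp_chartSymmDeriv {p : E}
    (hp : p ∈ (extChartAt 𝓘(ℝ, E) (1 : G)).target) :
    (chartDeriv ((extChartAt 𝓘(ℝ, E) (1 : G)).symm p)).comp (chartSymmDeriv G p)
      = ContinuousLinearMap.id ℝ E := by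
  have h2 := mfderiv_extChartAt_comp_mfderivWithin_extChartAt_symm (I := 𝓘(ℝ, E)) hp
  rw [ModelWithCorners.range_eq_univ, mfderivWithin_univ] at h2
  exact h2

theorem chartSymmDeriv_comp_chartDeriv {p : E}
    (hp : p ∈ (extChartAt 𝓘(ℝ, E) (1 : G)).target) :
    (chartSymmDeriv G p).comp (chartDeriv ((extChartAt 𝓘(ℝ, E) (1 : G)).symm p))
      = ContinuousLinearMap.id ℝ E := by
  have h2 := mfderivWithin_extChartAt_symm_comp_mfderiv_extChartAt (I := 𝓘(ℝ, E)) hp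
  rw [ModelWithCorners.range_eq_univ, mfderivWithin_univ] at h2
  exact h2

theorem chartField_eq {p : E} (hp : p ∈ (extChartAt 𝓘(ℝ, E) (1 : G)).target) :
    chartField G p = (chartDeriv ((extChartAt 𝓘(ℝ, E) (1 : G)).symm p)).comp
      (leftDeriv ((extChartAt 𝓘(ℝ, E) (1 : G)).symm p) 1) := by
  set φ := extChartAt 𝓘(ℝ, E) (1 : G) with hφ
  have hs : φ.symm (φ 1) = 1 := extChartAt_to_inv 1
  -- The tangent space at 1 is identified with `E` through this very chart, so the inverse chart has
  -- the identity as its derivative there.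
  have h1 : HasMFDerivAt 𝓘(ℝ, E) 𝓘(ℝ, E) φ.symm (φ 1) (ContinuousLinearMap.id ℝ E) := by
    have := (mdifferentiableAt_extChartAt_symm
      (mem_extChartAt_target (I := 𝓘(ℝ, E)) (1 : G))).hasMFDerivAt
    rwa [mfderiv_extChartAt_symm_self] at this
  have h2 : HasMFDerivAt 𝓘(ℝ, E) 𝓘(ℝ, E) (fun g : G => φ.symm p * g) (φ.symm (φ 1))
      (leftDeriv (φ.symm p) 1 : E →L[ℝ] E) := by
    rw [hs]; exact hasMFDerivAt_mul_left _ _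
  have h3 : HasMFDerivAt 𝓘(ℝ, E) 𝓘(ℝ, E) φ (φ.symm p * φ.symm (φ 1))
      (chartDeriv (φ.symm p) : E →L[ℝ] E) := by
    rw [hs, mul_one]; exact hasMFDerivAt_extChartAt_one (φ.map_target hp)
  have h4 : HasMFDerivAt 𝓘(ℝ, E) 𝓘(ℝ, E) (φ ∘ (fun g : G => φ.symm p * g) ∘ φ.symm) (φ 1)
      ((chartDeriv (φ.symm p)).comp (leftDeriv (φ.symm p) 1) : E →L[ℝ] E) :=
    h3.comp (φ 1) (h2.comp (φ 1) h1)
  have h5 : HasFDerivAt (φ ∘ (fun g : G => φ.symm p * g) ∘ φ.symm)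
      ((chartDeriv (φ.symm p)).comp (leftDeriv (φ.symm p) 1) : E →L[ℝ] E) (φ 1) :=
    hasMFDerivAt_iff_hasFDerivAt.1 h4
  exact h5.fderiv

theorem chartSymmDeriv_chartField {p : E}
    (hp : p ∈ (extChartAt 𝓘(ℝ, E) (1 : G)).target) (X : E) :
    chartSymmDeriv G p (chartField G p X) =
      leftDeriv ((extChartAt 𝓘(ℝ, E) (1 : G)).symm p) 1 X := by
  rw [chartField_eq hp]
  exact DFunLike.congr_fun (chartSymmDeriv_comp_chartDeriv hp) _

theorem chartField_injective {p : E} (hp : p ∈ (extChartAt 𝓘(ℝ, E) (1 : G)).target) :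
    Function.Injective (chartField G p) := fun X Y h => by
  have h' := congrArg (chartSymmDeriv G p) h
  rw [chartSymmDeriv_chartField hp, chartSymmDeriv_chartField hp] at h'
  have := congrArg (leftDeriv ((extChartAt 𝓘(ℝ, E) (1 : G)).symm p)⁻¹
    ((extChartAt 𝓘(ℝ, E) (1 : G)).symm p)) h'
  rwa [leftDeriv_inv_mul_apply, leftDeriv_inv_mul_apply] at this

theorem mpullback_extChartAt_symm {p : E} (hp : p ∈ (extChartAt 𝓘(ℝ, E) (1 : G)).target)
    (X : GroupLieAlgebra 𝓘(ℝ, E) G) :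
    mpullback 𝓘(ℝ, E) 𝓘(ℝ, E) (extChartAt 𝓘(ℝ, E) (1 : G)).symm (mulInvariantVectorField X) p
      = chartField G p (show E from X) := by
  rw [chartField_eq hp]
  have h : (chartSymmDeriv G p).inverse = chartDeriv ((extChartAt 𝓘(ℝ, E) (1 : G)).symm p) :=
    ContinuousLinearMap.inverse_eq (chartSymmDeriv_comp_chartDeriv hp)
      (chartDeriv_comp_chartSymmDeriv hp)
  exact DFunLike.congr_fun h _

/-- The left side is the Lie bracket of the two left invariant fields in coordinates, and that
bracket is again left invariant with value `[X, Y]` at 1. This is the structure equation of `G` in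
the chart. -/
theorem fderiv_chartField_sub [CompleteSpace E] {p : E}
    (hp : p ∈ (extChartAt 𝓘(ℝ, E) (1 : G)).target) (X Y : E) :
    fderiv ℝ (chartField G) p (chartField G p X) Y - fderiv ℝ (chartField G) p (chartField G p Y) X
      = chartField G p (modelBracket G X Y) := by
  have : LieGroup 𝓘(ℝ, E) (minSmoothness ℝ 3) G := LieGroup.minSmoothness_real
  have : IsManifold 𝓘(ℝ, E) (minSmoothness ℝ 2) G :=
    IsManifold.of_le (n := ∞) (by simpa using two_le_infty)
  have : IsManifold 𝓘(ℝ, E) (minSmoothness ℝ 2) E :=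
    IsManifold.of_le (n := ∞) (by simpa using two_le_infty)
  have hnhds := (isOpen_extChartAt_target (I := 𝓘(ℝ, E)) (1 : G)).mem_nhds hp
  have hd : DifferentiableAt ℝ (chartField (E := E) G) p :=
    (contDiffOn_chartField.contDiffAt hnhds).differentiableAt (by simp)
  -- Brackets of vector fields commute with the pullback by the inverse chart.
  have hb := mpullback_mlieBracket (n := ∞) (I := 𝓘(ℝ, E)) (I' := 𝓘(ℝ, E))
    (f := (extChartAt 𝓘(ℝ, E) (1 : G)).symm) (x₀ := p)
    (mdifferentiableAt_mulInvariantVectorField (show GroupLieAlgebra 𝓘(ℝ, E) G from X))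
    (mdifferentiableAt_mulInvariantVectorField (show GroupLieAlgebra 𝓘(ℝ, E) G from Y))
    ((contMDiffOn_extChartAt_symm (n := ∞) (1 : G)).contMDiffAt hnhds)
    (by simpa using two_le_infty)
  have he : ∀ Z : GroupLieAlgebra 𝓘(ℝ, E) G,
      mpullback 𝓘(ℝ, E) 𝓘(ℝ, E) (extChartAt 𝓘(ℝ, E) (1 : G)).symm (mulInvariantVectorField Z)
        =ᶠ[𝓝 p] fun q => chartField G q (show E from Z) := fun Z =>
    mem_of_superset hnhds fun q hq => mpullback_extChartAt_symm hq Z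
  rw [(he _).mlieBracket_vectorField_eq (he _), ← mulInvariantVector_mlieBracket] at hb
  have hm : ∀ V W : (q : E) → TangentSpace 𝓘(ℝ, E) q,
      mlieBracket 𝓘(ℝ, E) V W p = lieBracket ℝ V W p := fun V W => by
    rw [← mlieBracketWithin_univ, mlieBracketWithin_eq_lieBracketWithin]
    exact congrFun lieBracketWithin_univ p
  have h3 := mpullback_extChartAt_symm hp (⁅(show GroupLieAlgebra 𝓘(ℝ, E) G from X),
    (show GroupLieAlgebra 𝓘(ℝ, E) G from Y)⁆ : GroupLieAlgebra 𝓘(ℝ, E) G)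
  have hf : ∀ (Z : E) (v : E), fderiv ℝ (fun q => chartField G q Z) p v =
      fderiv ℝ (chartField G) p v Z := fun Z v => by
    rw [fderiv_clm_apply hd (differentiableAt_const _)]
    simp
  rw [← hf, ← hf]
  exact (hm _ _).symm.trans (hb.symm.trans h3)

end LieGroupChart

/-! ### Logarithmic derivatives of maps to `G` and the local form of Cartan's theorem. -/

section LogDeriv

theorem one_le_infty : (1 : ℕ∞ω) ≤ ∞ := WithTop.coe_le_coe.2 (le_top : (1 : ℕ∞) ≤ ⊤)

open Set Filter
open scoped Topology

variable {E : Type*} [NormedAddCommGroup E] [NormedSpace ℝ E]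
  {G : Type*} [TopologicalSpace G] [ChartedSpace E G] [Group G]

section Manifold

variable {H L : Type*} [NormedAddCommGroup H] [NormedSpace ℝ H] [TopologicalSpace L]
  [ChartedSpace H L]

/-- `f'` is the derivative of `f : L → N` at `x`, as a linear map between the model spaces. -/
def HasModelDerivAt {K N : Type*} [NormedAddCommGroup K] [NormedSpace ℝ K] [TopologicalSpace N]
    [ChartedSpace K N] (f : L → N) (x : L) (f' : H →L[ℝ] K) : Prop :=
  HasMFDerivAt 𝓘(ℝ, H) 𝓘(ℝ, K) f x f'

/-- The derivative of `f : L → N` at `x`, as a linear map between the model spaces. -/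
noncomputable def modelDeriv {K N : Type*} [NormedAddCommGroup K] [NormedSpace ℝ K]
    [TopologicalSpace N] [ChartedSpace K N] (f : L → N) (x : L) : H →L[ℝ] K :=
  mfderiv 𝓘(ℝ, H) 𝓘(ℝ, K) f x

section ModelDeriv

variable {K N : Type*} [NormedAddCommGroup K] [NormedSpace ℝ K] [TopologicalSpace N]
  [ChartedSpace K N] {H' L' : Type*} [NormedAddCommGroup H'] [NormedSpace ℝ H']
  [TopologicalSpace L'] [ChartedSpace H' L']

theorem HasModelDerivAt.mdifferentiableAt {f : L → N} {x : L} {f' : H →L[ℝ] K}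
    (h : HasModelDerivAt f x f') : MDifferentiableAt 𝓘(ℝ, H) 𝓘(ℝ, K) f x :=
  HasMFDerivAt.mdifferentiableAt h

theorem MDifferentiableAt.hasModelDerivAt {f : L → N} {x : L}
    (h : MDifferentiableAt 𝓘(ℝ, H) 𝓘(ℝ, K) f x) :
    HasModelDerivAt f x (modelDeriv f x : H →L[ℝ] K) :=
  h.hasMFDerivAt

theorem HasModelDerivAt.modelDeriv_eq {f : L → N} {x : L} {f' : H →L[ℝ] K}
    (h : HasModelDerivAt f x f') : modelDeriv f x = f' :=
  HasMFDerivAt.mfderiv h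

theorem HasModelDerivAt.unique {f : L → N} {x : L} {f' f'' : H →L[ℝ] K}
    (h : HasModelDerivAt f x f') (h' : HasModelDerivAt f x f'') : f' = f'' :=
  h.modelDeriv_eq.symm.trans h'.modelDeriv_eq

theorem HasModelDerivAt.comp {f : L → N} {ψ : L' → L} {y : L'} {f' : H →L[ℝ] K}
    {ψ' : H' →L[ℝ] H} (h : HasModelDerivAt f (ψ y) f') (hψ : HasModelDerivAt ψ y ψ') :
    HasModelDerivAt (fun z => f (ψ z)) y (f'.comp ψ') :=
  HasMFDerivAt.comp y h hψ

theorem HasModelDerivAt.congr {f g : L → N} {x : L} {f' : H →L[ℝ] K}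
    (h : HasModelDerivAt f x f') (hg : g =ᶠ[𝓝 x] f) : HasModelDerivAt g x f' :=
  HasMFDerivAt.congr_of_eventuallyEq h hg

theorem hasModelDerivAt_id (x : L) :
    HasModelDerivAt (fun y : L => y) x (ContinuousLinearMap.id ℝ H) :=
  hasMFDerivAt_id x

theorem hasModelDerivAt_iff_hasFDerivAt {f : H → K} {x : H} {f' : H →L[ℝ] K} :
    HasModelDerivAt f x f' ↔ HasFDerivAt f f' x :=
  hasMFDerivAt_iff_hasFDerivAt

theorem hasModelDerivAt_extChartAt [IsManifold 𝓘(ℝ, H) 1 L] {x y : L}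
    (hy : y ∈ (extChartAt 𝓘(ℝ, H) x).source) :
    HasModelDerivAt (extChartAt 𝓘(ℝ, H) x) y
      (modelDeriv (extChartAt 𝓘(ℝ, H) x) y : H →L[ℝ] H) :=
  (mdifferentiableAt_extChartAt (by rwa [extChartAt_source] at hy)).hasModelDerivAt

theorem hasModelDerivAt_extChartAt_symm [IsManifold 𝓘(ℝ, H) 1 L] {x : L} {p : H}
    (hp : p ∈ (extChartAt 𝓘(ℝ, H) x).target) :
    HasModelDerivAt (extChartAt 𝓘(ℝ, H) x).symm p
      (modelDeriv (extChartAt 𝓘(ℝ, H) x).symm p : H →L[ℝ] H) :=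
  (mdifferentiableAt_extChartAt_symm hp).hasModelDerivAt

theorem modelDeriv_extChartAt_symm_self [IsManifold 𝓘(ℝ, H) 1 L] (x : L) :
    (modelDeriv (extChartAt 𝓘(ℝ, H) x).symm (extChartAt 𝓘(ℝ, H) x x) : H →L[ℝ] H) =
      ContinuousLinearMap.id ℝ H :=
  mfderiv_extChartAt_symm_self x

theorem modelDeriv_extChartAt_self [IsManifold 𝓘(ℝ, H) 1 L] (x : L) :
    (modelDeriv (extChartAt 𝓘(ℝ, H) x) x : H →L[ℝ] H) = ContinuousLinearMap.id ℝ H :=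
  mfderiv_extChartAt_self

end ModelDeriv

/-- `F : L → G` is differentiable at `x`, and the pullback of the Maurer-Cartan form of `G` by `F`
is `η` there. -/
def HasLogDerivAt (F : L → G) (x : L) (η : H →L[ℝ] E) : Prop :=
  HasModelDerivAt F x ((leftDeriv (F x) 1 : E →L[ℝ] E).comp η)

theorem HasLogDerivAt.congr {F F' : L → G} {x : L} {η : H →L[ℝ] E} (h : HasLogDerivAt F x η)
    (hF : F' =ᶠ[𝓝 x] F) : HasLogDerivAt F' x η := by
  unfold HasLogDerivAt
  rw [hF.self_of_nhds]
  exact HasModelDerivAt.congr h hF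

theorem HasLogDerivAt.mdifferentiableAt {F : L → G} {x : L} {η : H →L[ℝ] E}
    (h : HasLogDerivAt F x η) : MDifferentiableAt 𝓘(ℝ, H) 𝓘(ℝ, E) F x :=
  HasModelDerivAt.mdifferentiableAt h

theorem HasLogDerivAt.comp {H' L' : Type*} [NormedAddCommGroup H'] [NormedSpace ℝ H']
    [TopologicalSpace L'] [ChartedSpace H' L'] {F : L → G} {ψ : L' → L} {y : L'} {η : H →L[ℝ] E}
    {ψ' : H' →L[ℝ] H} (h : HasLogDerivAt F (ψ y) η)
    (hψ : HasModelDerivAt ψ y ψ') : HasLogDerivAt (fun z => F (ψ z)) y (η.comp ψ') :=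
  HasModelDerivAt.comp (f := F) (f' := (leftDeriv (F (ψ y)) 1 : E →L[ℝ] E).comp η) h hψ

variable [LieGroup 𝓘(ℝ, E) ∞ G]

theorem hasModelDerivAt_mul_left (a g : G) :
    HasModelDerivAt (fun h : G => a * h) g (leftDeriv a g : E →L[ℝ] E) :=
  hasMFDerivAt_mul_left a g

theorem MDifferentiableAt.hasLogDerivAt {F : L → G} {x : L}
    (h : MDifferentiableAt 𝓘(ℝ, H) 𝓘(ℝ, E) F x) :
    HasLogDerivAt F x ((leftDeriv (F x)⁻¹ (F x) : E →L[ℝ] E).comp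
      (modelDeriv F x : H →L[ℝ] E)) := by
  have : (leftDeriv (F x) 1 : E →L[ℝ] E).comp ((leftDeriv (F x)⁻¹ (F x) : E →L[ℝ] E).comp
      (modelDeriv F x : H →L[ℝ] E)) = modelDeriv F x :=
    ContinuousLinearMap.ext fun v => leftDeriv_mul_inv_apply _ _
  unfold HasLogDerivAt
  rw [this]
  exact h.hasModelDerivAt

theorem HasLogDerivAt.mul_left {F : L → G} {x : L} {η : H →L[ℝ] E} (h : HasLogDerivAt F x η)
    (a : G) : HasLogDerivAt (fun y => a * F y) x η := by
  have h' : HasModelDerivAt (fun y => a * F y) x ((leftDeriv a (F x) : E →L[ℝ] E).comp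
      ((leftDeriv (F x) 1 : E →L[ℝ] E).comp η)) :=
    HasModelDerivAt.comp (hasModelDerivAt_mul_left a (F x)) h
  have : (leftDeriv a (F x) : E →L[ℝ] E).comp ((leftDeriv (F x) 1 : E →L[ℝ] E).comp η) =
      (leftDeriv (a * F x) 1 : E →L[ℝ] E).comp η := ContinuousLinearMap.ext fun v => by
    have := leftDeriv_comp_apply a (F x) 1 (η v)
    rwa [mul_one] at this
  rwa [this] at h'

theorem HasLogDerivAt.modelDeriv_apply {F : L → G} {x : L} {η : H →L[ℝ] E}
    (h : HasLogDerivAt F x η) (v : H) :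
    (leftDeriv (F x)⁻¹ (F x) : E →L[ℝ] E) ((modelDeriv F x : H →L[ℝ] E) v) = η v := by
  rw [HasModelDerivAt.modelDeriv_eq h]
  exact leftDeriv_inv_mul_apply _ _

theorem HasLogDerivAt.unique {F : L → G} {x : L} {η η' : H →L[ℝ] E}
    (h : HasLogDerivAt F x η) (h' : HasLogDerivAt F x η') : η = η' :=
  ContinuousLinearMap.ext fun v => (h.modelDeriv_apply v).symm.trans (h'.modelDeriv_apply v)

end Manifold

variable {X : Type*} [NormedAddCommGroup X] [NormedSpace ℝ X] [LieGroup 𝓘(ℝ, E) ∞ G]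

/-- Turns F⁻¹dF = η into the total differential equation du = V(u) ∘ η, with V the left invariant
frame in the chart; the next lemma is the converse. -/
theorem HasLogDerivAt.hasFDerivAt {F : X → G} {y : X} {η : X →L[ℝ] E} (h : HasLogDerivAt F y η)
    (hy : F y ∈ (extChartAt 𝓘(ℝ, E) (1 : G)).source) :
    HasFDerivAt (fun z => extChartAt 𝓘(ℝ, E) (1 : G) (F z))
      ((chartField G (extChartAt 𝓘(ℝ, E) (1 : G) (F y))).comp η) y := by
  have h1 : HasModelDerivAt (fun z => extChartAt 𝓘(ℝ, E) (1 : G) (F z)) y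
      ((chartDeriv (F y) : E →L[ℝ] E).comp ((leftDeriv (F y) 1 : E →L[ℝ] E).comp η)) :=
    HasModelDerivAt.comp (hasMFDerivAt_extChartAt_one hy) h
  rw [chartField_eq ((extChartAt 𝓘(ℝ, E) (1 : G)).map_source hy), PartialEquiv.left_inv _ hy]
  exact hasModelDerivAt_iff_hasFDerivAt.1 h1

theorem HasFDerivAt.hasLogDerivAt {u : X → E} {y : X} {η : X →L[ℝ] E}
    (h : HasFDerivAt u ((chartField G (u y)).comp η) y)
    (hy : u y ∈ (extChartAt 𝓘(ℝ, E) (1 : G)).target) :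
    HasLogDerivAt (fun z => (extChartAt 𝓘(ℝ, E) (1 : G)).symm (u z)) y η := by
  have h1 : HasModelDerivAt (fun z => (extChartAt 𝓘(ℝ, E) (1 : G)).symm (u z)) y
      ((chartSymmDeriv G (u y)).comp ((chartField G (u y)).comp η)) :=
    HasModelDerivAt.comp (hasMFDerivAt_extChartAt_one_symm hy) (hasModelDerivAt_iff_hasFDerivAt.2 h)
  have : (chartSymmDeriv G (u y)).comp ((chartField G (u y)).comp η) =
      (leftDeriv ((extChartAt 𝓘(ℝ, E) (1 : G)).symm (u y)) 1 : E →L[ℝ] E).comp η :=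
    ContinuousLinearMap.ext fun v => chartSymmDeriv_chartField hy _
  rwa [this] at h1

/-- The Maurer-Cartan equation `dη + ½ [η ∧ η] = 0` at a point, where the derivative of `η` is
`η'`. -/
def MaurerCartanEq (G : Type*) [TopologicalSpace G] [ChartedSpace E G] [Group G]
    (η : X →L[ℝ] E) (η' : X →L[ℝ] X →L[ℝ] E) : Prop :=
  ∀ v w, η' v w - η' w v + modelBracket G (η v) (η w) = 0

theorem ContinuousAt.eventually_mem_extChartAt_one_source {F : X → G} {y : X}
    (h : ContinuousAt F y) (hy : F y = 1) :
    ∀ᶠ z in 𝓝 y, F z ∈ (extChartAt 𝓘(ℝ, E) (1 : G)).source :=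
  h.eventually (by rw [hy]; exact extChartAt_source_mem_nhds 1)

/-- Two maps to `G` with the same logarithmic derivative which agree at a point agree near it. -/
theorem HasLogDerivAt.eventually_eq {F₁ F₂ : X → G} {η : X → X →L[ℝ] E} {x₀ : X}
    (hη : ContDiffAt ℝ 1 η x₀) (h₁ : ∀ᶠ y in 𝓝 x₀, HasLogDerivAt F₁ y (η y))
    (h₂ : ∀ᶠ y in 𝓝 x₀, HasLogDerivAt F₂ y (η y)) (h : F₁ x₀ = F₂ x₀) : F₁ =ᶠ[𝓝 x₀] F₂ := by
  set φ := extChartAt 𝓘(ℝ, E) (1 : G)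
  -- Left translation preserves the logarithmic derivative, so both maps may be assumed to pass
  -- through 1, where the chart is centred.
  set a := (F₁ x₀)⁻¹
  have key : ∀ {F : X → G}, F x₀ = F₁ x₀ → (∀ᶠ y in 𝓝 x₀, HasLogDerivAt F y (η y)) →
      ∀ᶠ y in 𝓝 x₀, a * F y ∈ φ.source ∧
        HasFDerivAt (fun z => φ (a * F z)) ((chartField G (φ (a * F y))).comp (η y)) y := by
    intro F hF hd
    have hc : ContinuousAt (fun y => a * F y) x₀ :=
      (hd.self_of_nhds.mul_left a).mdifferentiableAt.continuousAt
    filter_upwards [hd, hc.eventually_mem_extChartAt_one_source (E := E) (by simp [a, hF])]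
      with y hy1 hy2 using ⟨hy2, (hy1.mul_left a).hasFDerivAt hy2⟩
  have k₁ := key rfl h₁
  have k₂ := key h.symm h₂
  have hΘ : ContDiffAt ℝ 1 (fun z : X × E => (chartField G z.2).comp (η z.1)) (x₀, φ 1) := by
    refine ContDiffAt.clm_comp ?_ ?_
    · exact ((contDiffOn_chartField.contDiffAt (extChartAt_target_mem_nhds (1 : G))).of_le
        one_le_infty).comp (x₀, φ 1) contDiffAt_snd
    · exact hη.comp (x₀, φ 1) contDiffAt_fst
  have := eventually_eq_of_hasFDerivAt hΘ (u₁ := fun z => φ (a * F₁ z))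
    (u₂ := fun z => φ (a * F₂ z)) (by simp [a]) (by simp [a, ← h]) (k₁.mono fun y hy => hy.2)
    (k₂.mono fun y hy => hy.2)
  filter_upwards [this, k₁, k₂] with y h1 h2 h3
  exact mul_left_cancel (φ.injOn h2.1 h3.1 h1)

theorem fderiv_comp_chartField_apply {η : X → X →L[ℝ] E} {x : X} {p : E}
    (hη : DifferentiableAt ℝ η x) (hp : p ∈ (extChartAt 𝓘(ℝ, E) (1 : G)).target) (v w : X) (k : E) :
    fderiv ℝ (fun z : X × E => (chartField G z.2).comp (η z.1)) (x, p) (v, k) w =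
      fderiv ℝ (chartField G) p k (η x w) + chartField G p (fderiv ℝ η x v w) := by
  have hV : DifferentiableAt ℝ (chartField (E := E) G) p :=
    (contDiffOn_chartField.contDiffAt ((isOpen_extChartAt_target (1 : G)).mem_nhds
      hp)).differentiableAt
      (by simp)
  have h1 : HasFDerivAt (fun z : X × E => chartField G z.2)
      ((fderiv ℝ (chartField G) p).comp (ContinuousLinearMap.snd ℝ X E)) (x, p) :=
    HasFDerivAt.comp (x, p) (f := Prod.snd) hV.hasFDerivAt hasFDerivAt_snd
  have h2 : HasFDerivAt (fun z : X × E => η z.1)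
      ((fderiv ℝ η x).comp (ContinuousLinearMap.fst ℝ X E)) (x, p) :=
    HasFDerivAt.comp (x, p) (f := Prod.fst) hη.hasFDerivAt hasFDerivAt_fst
  rw [(h1.clm_comp h2).fderiv]
  simp [add_comm]

/-- The difference of the two sides is V applied to dη(v, w) + [η(v), η(w)], by the bracket formula
for V. So the Maurer-Cartan equation is the integrability condition in Frobenius' theorem. -/
theorem MaurerCartanEq.fderiv_symm [CompleteSpace E] {η : X → X →L[ℝ] E} {x : X} {p : E}
    (h : MaurerCartanEq G (η x) (fderiv ℝ η x))
    (hp : p ∈ (extChartAt 𝓘(ℝ, E) (1 : G)).target) (v w : X) :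
    fderiv ℝ (chartField G) p (chartField G p (η x v)) (η x w) + chartField G p (fderiv ℝ η x v w) =
    fderiv ℝ (chartField G) p (chartField G p (η x w)) (η x v)
      + chartField G p (fderiv ℝ η x w v) := by
  have h1 := fderiv_chartField_sub hp (η x v) (η x w)
  have h2 := congrArg (chartField G p) (h v w)
  rw [map_add, map_sub, map_zero, ← h1] at h2
  rw [← sub_eq_zero, ← h2]
  abel

/-- **Cartan's theorem**, local form. -/
theorem exists_hasLogDerivAt [CompleteSpace E] {η : X → X →L[ℝ] E} {t : Set X} (ht : IsOpen t)
    (hη : ContDiffOn ℝ ∞ η t) (hflat : ∀ x ∈ t, MaurerCartanEq G (η x) (fderiv ℝ η x))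
    {x₀ : X} (hx₀ : x₀ ∈ t) :
    ∃ (F : X → G) (t' : Set X), IsOpen t' ∧ x₀ ∈ t' ∧ t' ⊆ t ∧
      ContMDiffOn 𝓘(ℝ, X) 𝓘(ℝ, E) ∞ F t' ∧ ∀ y ∈ t', HasLogDerivAt F y (η y) := by
  set φ := extChartAt 𝓘(ℝ, E) (1 : G)
  have hφ : IsOpen φ.target := isOpen_extChartAt_target (1 : G)
  set Θ : X × E → X →L[ℝ] E := fun z => (chartField G z.2).comp (η z.1) with hΘdef
  have hΘ : ContDiffOn ℝ ∞ Θ (t ×ˢ φ.target) := by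
    refine ContDiffOn.clm_comp ?_ ?_
    · exact contDiffOn_chartField.comp contDiff_snd.contDiffOn fun z hz => hz.2
    · exact hη.comp contDiff_fst.contDiffOn fun z hz => hz.1
  have hmem : (x₀, φ 1) ∈ t ×ˢ φ.target := ⟨hx₀, mem_extChartAt_target 1⟩
  have hopen : IsOpen (t ×ˢ φ.target) := ht.prod hφ
  obtain ⟨u, hu0, hu⟩ := exists_hasFDerivAt_of_fderiv_symm
    ((hΘ.contDiffAt (hopen.mem_nhds hmem)).of_le two_le_infty)
    (mem_of_superset (hopen.mem_nhds hmem) fun z hz v w => by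
      obtain ⟨x, p⟩ := z
      have hηx : DifferentiableAt ℝ η x :=
        (hη.contDiffAt (ht.mem_nhds hz.1)).differentiableAt (by simp)
      rw [fderiv_comp_chartField_apply hηx hz.2, fderiv_comp_chartField_apply hηx hz.2]
      exact (hflat x hz.1).fderiv_symm hz.2 v w)
  have hc : ∀ᶠ x in 𝓝 x₀, u x ∈ φ.target :=
    hu.self_of_nhds.continuousAt.eventually (by rw [hu0]; exact hφ.mem_nhds hmem.2)
  obtain ⟨t', ht', ht'o, hx₀'⟩ := _root_.eventually_nhds_iff.1 ((hu.and hc).and (ht.mem_nhds hx₀))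
  have hus : ContDiffOn ℝ ∞ u t' :=
    ContDiffOn.of_hasFDerivAt hΘ ht'o (fun x hx => (ht' x hx).1.1)
      fun x hx => ⟨(ht' x hx).2, (ht' x hx).1.2⟩
  refine ⟨fun z => φ.symm (u z), t', ht'o, hx₀', fun x hx => (ht' x hx).2, ?_, fun y hy =>
    (ht' y hy).1.1.hasLogDerivAt (ht' y hy).1.2⟩
  exact (contMDiffOn_extChartAt_symm (n := ∞) (1 : G)).comp hus.contMDiffOn
    fun x hx => (ht' x hx).1.2

/-- The pullback of the Maurer-Cartan form satisfies the Maurer-Cartan equation. -/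
theorem HasLogDerivAt.maurerCartanEq [CompleteSpace E] {F : X → G} {η : X → X →L[ℝ] E} {x₀ : X}
    (hη : DifferentiableAt ℝ η x₀) (h : ∀ᶠ y in 𝓝 x₀, HasLogDerivAt F y (η y)) :
    MaurerCartanEq G (η x₀) (fderiv ℝ η x₀) := by
  set φ := extChartAt 𝓘(ℝ, E) (1 : G)
  set a := (F x₀)⁻¹
  have hc : ContinuousAt (fun y => a * F y) x₀ :=
    (h.self_of_nhds.mul_left a).mdifferentiableAt.continuousAt
  set u : X → E := fun z => φ (a * F z) with hu
  have hux : u x₀ = φ 1 := by simp [hu, a]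
  have hp : φ 1 ∈ φ.target := mem_extChartAt_target 1
  have hd : ∀ᶠ y in 𝓝 x₀, HasFDerivAt u ((chartField G (u y)).comp (η y)) y := by
    filter_upwards [h, hc.eventually_mem_extChartAt_one_source (E := E) (by simp [a])]
      with y hy1 hy2 using (hy1.mul_left a).hasFDerivAt hy2
  have hV : DifferentiableAt ℝ (chartField (E := E) G) (φ 1) :=
    (contDiffOn_chartField.contDiffAt (extChartAt_target_mem_nhds (1 : G))).differentiableAt
      (by simp)
  have hud := hd.self_of_nhds
  have h1 : HasFDerivAt (fun y => chartField G (u y))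
      ((fderiv ℝ (chartField G) (φ 1)).comp ((chartField G (u x₀)).comp (η x₀))) x₀ := by
    refine HasFDerivAt.comp x₀ (g := chartField (E := E) G) (f := u) ?_ hud
    rw [hux]; exact hV.hasFDerivAt
  have h2 : HasFDerivAt (fun y => (chartField G (u y)).comp (η y)) _ x₀ :=
    h1.clm_comp hη.hasFDerivAt
  intro v w
  -- Differentiating du = V(u) ∘ η once more, the symmetry of the second derivative of `u` becomes V
  -- applied to the Maurer-Cartan equation; V is injective.
  have h3 := second_derivative_symmetric_of_eventually hd h2 v w
  simp only [hux, add_apply, ContinuousLinearMap.comp_apply,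
    ContinuousLinearMap.compL_apply, ContinuousLinearMap.flip_apply] at h3
  have h4 := fderiv_chartField_sub hp (η x₀ v) (η x₀ w)
  refine chartField_injective hp ?_
  rw [map_add, map_sub, map_zero, ← h4, ← sub_eq_zero.2 h3]
  abel

theorem chartField_extChartAt_one :
    chartField G (extChartAt 𝓘(ℝ, E) (1 : G) 1) = ContinuousLinearMap.id ℝ E := by
  rw [chartField_eq (mem_extChartAt_target 1), extChartAt_to_inv, leftDeriv_one_left,
    ContinuousLinearMap.comp_id]
  exact modelDeriv_extChartAt_self (1 : G)

/-- The logarithmic derivative of a smooth map is smooth. -/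
theorem ContMDiffAt.exists_hasLogDerivAt {F : X → G} {x₀ : X}
    (hF : ∀ᶠ y in 𝓝 x₀, ContMDiffAt 𝓘(ℝ, X) 𝓘(ℝ, E) ∞ F y) :
    ∃ η : X → X →L[ℝ] E, ContDiffAt ℝ ∞ η x₀ ∧ ∀ᶠ y in 𝓝 x₀, HasLogDerivAt F y (η y) := by
  set φ := extChartAt 𝓘(ℝ, E) (1 : G)
  -- F(y)⁻¹F(z) passes through 1 at `z = y`, where the chart has the identity as its derivative. Its
  -- joint smoothness in `(y, z)` makes the form smooth in `y`.
  refine ⟨fun y => fderiv ℝ (fun z => φ ((F y)⁻¹ * F z)) y, ?_, ?_⟩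
  · have hm : ContMDiffAt 𝓘(ℝ, X × X) 𝓘(ℝ, E) ∞ (fun z : X × X => φ ((F z.1)⁻¹ * F z.2))
        (x₀, x₀) := by
      have h1 : ContMDiffAt 𝓘(ℝ, X × X) 𝓘(ℝ, E) ∞ (fun z : X × X => (F z.1)⁻¹ * F z.2)
          (x₀, x₀) := by
        refine ContMDiffAt.mul (I := 𝓘(ℝ, E)) (ContMDiffAt.inv ?_) ?_
        · exact hF.self_of_nhds.comp (x := (x₀, x₀)) (f := Prod.fst)
            (contDiff_fst.contDiffAt.contMDiffAt)
        · exact hF.self_of_nhds.comp (x := (x₀, x₀)) (f := Prod.snd)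
            (contDiff_snd.contDiffAt.contMDiffAt)
      refine ContMDiffAt.comp _ (contMDiffAt_extChartAt' (I := 𝓘(ℝ, E)) ?_) h1
      simp
    exact ContDiffAt.fderiv (n := ∞) hm.contDiffAt contDiffAt_id (by simp)
  · filter_upwards [hF] with y hy
    have h := MDifferentiableAt.hasLogDerivAt (hy.mdifferentiableAt (by simp))
    convert h using 1
    have h' := (h.mul_left (F y)⁻¹).hasFDerivAt (by simp)
    rw [h'.fderiv, inv_mul_cancel, chartField_extChartAt_one, ContinuousLinearMap.id_comp]

end LogDeriv

/-! ### Gluing local solutions over a simply connected space. -/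

section Gluing

open Set Filter
open scoped Topology

/-- Local `G`-valued functions on a simply connected space which differ by locally constant left
factors on overlaps come from a global function. -/
theorem exists_eventually_eq_mul_of_simplyConnected {L G ι : Type*} [TopologicalSpace L]
    [SimplyConnectedSpace L] [LocallyPathConnectedSpace L] [Group G] (U : ι → Set L)
    (hU : ∀ i, IsOpen (U i)) (hcover : ∀ x, ∃ i, x ∈ U i) (F : ι → L → G)
    (hF : ∀ i j x, x ∈ U i → x ∈ U j →
      ∀ᶠ y in 𝓝 x, F i y * (F j y)⁻¹ = F i x * (F j x)⁻¹) :
    ∃ g : L → G, ∀ i, ∀ x ∈ U i, ∀ᶠ y in 𝓝 x, g y = g x * (F i x)⁻¹ * F i y := by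
  -- With the discrete topology on `G`, the locally constant transition factors define a bundle with
  -- discrete fibre, that is, a covering of `L`. Simple connectivity provides a global section.
  let _ : TopologicalSpace G := ⊥
  have : DiscreteTopology G := ⟨rfl⟩
  choose idx hidx using hcover
  let B : FiberBundleCore ι L G :=
    { baseSet := U
      isOpen_baseSet := hU
      indexAt := idx
      mem_baseSet_at := hidx
      coordChange := fun i j x a => a * (F i x * (F j x)⁻¹)
      coordChange_self := fun i x _ v => by simp
      continuousOn_coordChange := fun i j => by
        rintro ⟨x, a⟩ ⟨⟨hi, hj⟩, -⟩
        refine ContinuousAt.continuousWithinAt ?_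
        have h1 : ∀ᶠ p : L × G in 𝓝 (x, a), F i p.1 * (F j p.1)⁻¹ = F i x * (F j x)⁻¹ :=
          (continuous_fst.tendsto (x, a)).eventually (hF i j x hi hj)
        have h2 : ∀ᶠ p : L × G in 𝓝 (x, a), p.2 = a :=
          (continuous_snd.tendsto (x, a)).eventually (p := fun q => q = a) (by
            rw [nhds_discrete]; exact Filter.eventually_pure.2 rfl)
        refine continuousAt_const.congr (f := fun _ => a * (F i x * (F j x)⁻¹)) ?_
        filter_upwards [h1, h2] with p hp1 hp2
        rw [hp1, hp2]
      coordChange_comp := fun i j k x _ v => by group }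
  have hcov : IsCoveringMap B.proj := FiberBundle.isCoveringMap (F := G) (E := B.Fiber)
  have x₀ : L := Classical.arbitrary L
  obtain ⟨s, ⟨-, hs⟩, -⟩ := hcov.existsUnique_continuousMap_lifts (ContinuousMap.id L) x₀
    (⟨x₀, (1 : G)⟩ : B.TotalSpace) rfl
  have hproj : ∀ x, (s x).1 = x := fun x => congrFun hs x
  -- If a point has coordinate `a` in the `i`-th trivialisation, then `a * F i x` does not depend on
  -- `i`: the transition factor cancels. On the section, `a` is locally constant, so the value is
  -- locally a left translate of `F i`.
  let val : B.TotalSpace → G := fun p => (show G from p.2) * F (idx p.1) p.1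
  refine ⟨fun x => val (s x), fun i x hx => ?_⟩
  have hmem : s x ∈ (B.localTriv i).source := by
    rw [B.mem_localTriv_source, hproj]; exact hx
  have hc : ContinuousAt (fun y => (B.localTriv i (s y)).2) x :=
    ContinuousAt.snd (((B.localTriv i).continuousAt hmem).comp s.continuous.continuousAt)
  have hloc : ∀ y, (B.localTriv i (s y)).2 = val (s y) * (F i y)⁻¹ := fun y => by
    have h := B.localTriv_apply i (s y)
    rw [h]
    change (show G from (s y).2) * (F (idx (s y).1) (s y).1 * (F i (s y).1)⁻¹) = _
    rw [← mul_assoc]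
    simp only [val, hproj]
  have he : ∀ᶠ y in 𝓝 x, (B.localTriv i (s y)).2 = (B.localTriv i (s x)).2 :=
    hc.eventually (p := fun q => q = (B.localTriv i (s x)).2) (by
      rw [nhds_discrete]; exact Filter.eventually_pure.2 rfl)
  filter_upwards [he] with y hy
  rw [hloc, hloc] at hy
  rw [← hy, inv_mul_cancel_right]

end Gluing

/-! ### Cartan's theorem on a simply connected manifold. -/

section Cartan

open Set Filter
open scoped Topology

variable {E : Type*} [NormedAddCommGroup E] [NormedSpace ℝ E]
  {H L : Type*} [NormedAddCommGroup H] [NormedSpace ℝ H] [TopologicalSpace L]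
  [ChartedSpace H L]

/-- The pullback of the vector valued `1`-form `η` by the inverse of the chart around `x₀`. -/
noncomputable def chartForm (η : L → H →L[ℝ] E) (x₀ : L) (y : H) : H →L[ℝ] E :=
  (η ((extChartAt 𝓘(ℝ, H) x₀).symm y)).comp (modelDeriv (extChartAt 𝓘(ℝ, H) x₀).symm y)

theorem chartForm_self [IsManifold 𝓘(ℝ, H) 1 L] (η : L → H →L[ℝ] E) (x : L) :
    chartForm η x (extChartAt 𝓘(ℝ, H) x x) = η x := by
  rw [chartForm, extChartAt_to_inv, modelDeriv_extChartAt_symm_self, ContinuousLinearMap.comp_id]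

theorem modelDeriv_extChartAt_symm_comp [IsManifold 𝓘(ℝ, H) 1 L] {x₀ x : L}
    (hx : x ∈ (extChartAt 𝓘(ℝ, H) x₀).source) :
    (modelDeriv (extChartAt 𝓘(ℝ, H) x₀).symm (extChartAt 𝓘(ℝ, H) x₀ x) : H →L[ℝ] H).comp
      (modelDeriv (extChartAt 𝓘(ℝ, H) x₀) x) = ContinuousLinearMap.id ℝ H := by
  have := mfderivWithin_extChartAt_symm_comp_mfderiv_extChartAt' (I := 𝓘(ℝ, H)) hx
  rw [ModelWithCorners.range_eq_univ, mfderivWithin_univ] at this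
  exact this

theorem chartForm_comp_modelDeriv [IsManifold 𝓘(ℝ, H) 1 L] (η : L → H →L[ℝ] E) {x₀ x : L}
    (hx : x ∈ (extChartAt 𝓘(ℝ, H) x₀).source) :
    (chartForm η x₀ (extChartAt 𝓘(ℝ, H) x₀ x)).comp (modelDeriv (extChartAt 𝓘(ℝ, H) x₀) x) =
      η x := by
  rw [chartForm, ContinuousLinearMap.comp_assoc, modelDeriv_extChartAt_symm_comp hx,
    ContinuousLinearMap.comp_id, PartialEquiv.left_inv _ hx]

/-- The transition map between the charts around `x₀` and `x`. -/
noncomputable def chartTransition (H : Type*) {L : Type*} [NormedAddCommGroup H] [NormedSpace ℝ H]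
    [TopologicalSpace L] [ChartedSpace H L] (x₀ x : L) : H → H :=
  fun y => extChartAt 𝓘(ℝ, H) x ((extChartAt 𝓘(ℝ, H) x₀).symm y)

theorem contDiffAt_chartTransition [IsManifold 𝓘(ℝ, H) ∞ L] {x₀ x : L} {y : H}
    (hy : y ∈ (extChartAt 𝓘(ℝ, H) x₀).target)
    (hx : (extChartAt 𝓘(ℝ, H) x₀).symm y ∈ (extChartAt 𝓘(ℝ, H) x).source) :
    ContDiffAt ℝ ∞ (chartTransition H x₀ x) y := by
  have h1 : ContMDiffAt 𝓘(ℝ, H) 𝓘(ℝ, H) ∞ (chartTransition H x₀ x) y :=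
    ContMDiffAt.comp y (contMDiffAt_extChartAt' (by rwa [extChartAt_source] at hx))
      ((contMDiffOn_extChartAt_symm (n := ∞) x₀).contMDiffAt
        ((isOpen_extChartAt_target x₀).mem_nhds hy))
  exact h1.contDiffAt

/-- The two local expressions of η are related by pullback along the transition map, which lets the
Maurer-Cartan equation be moved between charts. -/
theorem chartForm_eq_comp_fderiv [IsManifold 𝓘(ℝ, H) ∞ L] (η : L → H →L[ℝ] E) {x₀ x : L} {y : H}
    (hy : y ∈ (extChartAt 𝓘(ℝ, H) x₀).target)
    (hx : (extChartAt 𝓘(ℝ, H) x₀).symm y ∈ (extChartAt 𝓘(ℝ, H) x).source) :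
    chartForm η x₀ y = (chartForm η x (chartTransition H x₀ x y)).comp
      (fderiv ℝ (chartTransition H x₀ x) y) := by
  have : IsManifold 𝓘(ℝ, H) 1 L := IsManifold.of_le (n := ∞) one_le_infty
  have h1 : HasModelDerivAt (chartTransition H x₀ x) y
      ((modelDeriv (extChartAt 𝓘(ℝ, H) x) ((extChartAt 𝓘(ℝ, H) x₀).symm y) : H →L[ℝ] H).comp
      (modelDeriv (extChartAt 𝓘(ℝ, H) x₀).symm y : H →L[ℝ] H)) := by
    exact HasModelDerivAt.comp (f := extChartAt 𝓘(ℝ, H) x) (ψ := (extChartAt 𝓘(ℝ, H) x₀).symm)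
      (hasModelDerivAt_extChartAt hx) (hasModelDerivAt_extChartAt_symm hy)
  rw [(hasModelDerivAt_iff_hasFDerivAt.1 h1).fderiv, ← ContinuousLinearMap.comp_assoc]
  have h2 := chartForm_comp_modelDeriv η hx
  have h3 : extChartAt 𝓘(ℝ, H) x ((extChartAt 𝓘(ℝ, H) x₀).symm y) = chartTransition H x₀ x y := rfl
  rw [h3] at h2
  rw [h2]
  rfl

variable {G : Type*} [TopologicalSpace G] [ChartedSpace E G] [Group G] [LieGroup 𝓘(ℝ, E) ∞ G]

/-- The Maurer-Cartan equation is preserved by pullbacks. -/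
theorem MaurerCartanEq.pullback {θ ζ : H → H →L[ℝ] E} {τ : H → H} {y : H}
    (hτ : ContDiffAt ℝ ∞ τ y) (hθ : DifferentiableAt ℝ θ (τ y))
    (hζ : ∀ᶠ z in 𝓝 y, ζ z = (θ (τ z)).comp (fderiv ℝ τ z))
    (h : MaurerCartanEq G (θ (τ y)) (fderiv ℝ θ (τ y))) :
    MaurerCartanEq G (ζ y) (fderiv ℝ ζ y) := by
  have h1 : HasFDerivAt (fun z => θ (τ z)) ((fderiv ℝ θ (τ y)).comp (fderiv ℝ τ y)) y :=
    HasFDerivAt.comp y (g := θ) (f := τ) hθ.hasFDerivAt (hτ.differentiableAt (by simp)).hasFDerivAt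
  have h2 : DifferentiableAt ℝ (fderiv ℝ τ) y :=
    (hτ.fderiv_right (m := 1) (by exact two_le_infty)).differentiableAt one_ne_zero
  have h3 := (h1.clm_comp h2.hasFDerivAt).congr_of_eventuallyEq hζ
  -- The extra term in the derivative of the pullback is θ(D²τ(v, w)); it is symmetric and drops out
  -- of the antisymmetrisation.
  have hsymm : IsSymmSndFDerivAt ℝ τ y :=
    hτ.isSymmSndFDerivAt (by simpa using two_le_infty)
  intro v w
  have h4 := h (fderiv ℝ τ y v) (fderiv ℝ τ y w)
  rw [h3.fderiv, hζ.self_of_nhds]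
  simp only [add_apply, ContinuousLinearMap.comp_apply,
    ContinuousLinearMap.compL_apply, ContinuousLinearMap.flip_apply]
  rw [hsymm.eq v w, ← h4]
  abel

variable [IsManifold 𝓘(ℝ, H) ∞ L]

/-- The exterior derivative is only defined at the centre of each chart. At another point of a chart
the equation is pulled back from the chart centred at that point. -/
theorem maurerCartanEq_chartForm {η : L → H →L[ℝ] E}
    (hη : ∀ x, ContDiffOn ℝ ∞ (chartForm η x) (extChartAt 𝓘(ℝ, H) x).target)
    (hflat : ∀ x, MaurerCartanEq G (chartForm η x (extChartAt 𝓘(ℝ, H) x x))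
      (fderiv ℝ (chartForm η x) (extChartAt 𝓘(ℝ, H) x x))) (x₀ : L) {y : H}
    (hy : y ∈ (extChartAt 𝓘(ℝ, H) x₀).target) :
    MaurerCartanEq G (chartForm η x₀ y) (fderiv ℝ (chartForm η x₀) y) := by
  set x := (extChartAt 𝓘(ℝ, H) x₀).symm y with hx
  have hxs : (extChartAt 𝓘(ℝ, H) x₀).symm y ∈ (extChartAt 𝓘(ℝ, H) x).source :=
    mem_extChartAt_source x
  refine MaurerCartanEq.pullback (τ := chartTransition H x₀ x) (θ := chartForm η x)
    (contDiffAt_chartTransition hy hxs) ?_ ?_ (hflat x)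
  · exact ((hη x).contDiffAt (extChartAt_target_mem_nhds x)).differentiableAt (by simp)
  · have hc : ContinuousAt (extChartAt 𝓘(ℝ, H) x₀).symm y := continuousAt_extChartAt_symm'' hy
    filter_upwards [(isOpen_extChartAt_target x₀).mem_nhds hy,
      hc.eventually ((isOpen_extChartAt_source x).mem_nhds hxs)] with z hz hz'
    exact chartForm_eq_comp_fderiv η hz hz'

theorem HasLogDerivAt.comp_extChartAt_symm {F : L → G} {η : L → H →L[ℝ] E} {x₀ : L} {y : H}
    (hy : y ∈ (extChartAt 𝓘(ℝ, H) x₀).target)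
    (h : HasLogDerivAt F ((extChartAt 𝓘(ℝ, H) x₀).symm y)
      (η ((extChartAt 𝓘(ℝ, H) x₀).symm y))) :
    HasLogDerivAt (fun z => F ((extChartAt 𝓘(ℝ, H) x₀).symm z)) y (chartForm η x₀ y) := by
  have : IsManifold 𝓘(ℝ, H) 1 L := IsManifold.of_le (n := ∞) one_le_infty
  exact h.comp (hasModelDerivAt_extChartAt_symm hy)

/-- Two maps from a manifold to `G` with the same logarithmic derivative which agree at a point
agree near it. -/
theorem HasLogDerivAt.eventually_eq_manifold {F₁ F₂ : L → G} {η : L → H →L[ℝ] E} {x : L}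
    (hη : ContDiffAt ℝ 1 (chartForm η x) (extChartAt 𝓘(ℝ, H) x x))
    (h₁ : ∀ᶠ y in 𝓝 x, HasLogDerivAt F₁ y (η y)) (h₂ : ∀ᶠ y in 𝓝 x, HasLogDerivAt F₂ y (η y))
    (h : F₁ x = F₂ x) : F₁ =ᶠ[𝓝 x] F₂ := by
  have hc : Tendsto (extChartAt 𝓘(ℝ, H) x).symm (𝓝 (extChartAt 𝓘(ℝ, H) x x)) (𝓝 x) := by
    have := continuousAt_extChartAt_symm (I := 𝓘(ℝ, H)) x
    rwa [ContinuousAt, extChartAt_to_inv] at this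
  have key : ∀ {F : L → G}, (∀ᶠ y in 𝓝 x, HasLogDerivAt F y (η y)) →
      ∀ᶠ y in 𝓝 (extChartAt 𝓘(ℝ, H) x x),
        HasLogDerivAt (fun z => F ((extChartAt 𝓘(ℝ, H) x).symm z)) y (chartForm η x y) :=
    fun hF => by
      filter_upwards [hc.eventually hF, extChartAt_target_mem_nhds x] with y hy1 hy2
      exact HasLogDerivAt.comp_extChartAt_symm hy2 hy1
  have := HasLogDerivAt.eventually_eq hη (key h₁) (key h₂) (by simpa using h)
  filter_upwards [(continuousAt_extChartAt (I := 𝓘(ℝ, H)) x).eventually this,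
    extChartAt_source_mem_nhds (I := 𝓘(ℝ, H)) x] with y hy hys
  simpa only [PartialEquiv.left_inv _ hys] using hy

/-- **Cartan's theorem**: a smooth `1`-form on a simply connected manifold, with values in the Lie
algebra of `G`, which satisfies the Maurer-Cartan equation, is the logarithmic derivative of a
smooth map to `G`. -/
theorem exists_contMDiff_hasLogDerivAt [CompleteSpace E] [SimplyConnectedSpace L]
    {η : L → H →L[ℝ] E}
    (hη : ∀ x, ContDiffOn ℝ ∞ (chartForm η x) (extChartAt 𝓘(ℝ, H) x).target)
    (hflat : ∀ x, MaurerCartanEq G (chartForm η x (extChartAt 𝓘(ℝ, H) x x))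
      (fderiv ℝ (chartForm η x) (extChartAt 𝓘(ℝ, H) x x))) :
    ∃ F : L → G, ContMDiff 𝓘(ℝ, H) 𝓘(ℝ, E) ∞ F ∧ ∀ x, HasLogDerivAt F x (η x) := by
  have : IsManifold 𝓘(ℝ, H) 1 L := IsManifold.of_le (n := ∞) one_le_infty
  have : LocallyPathConnectedSpace L := ChartedSpace.locallyPathConnectedSpace H L
  have hloc : ∀ x₀ : L, ∃ (U : Set L) (F : L → G), IsOpen U ∧ x₀ ∈ U ∧
      ContMDiffOn 𝓘(ℝ, H) 𝓘(ℝ, E) ∞ F U ∧ ∀ x ∈ U, HasLogDerivAt F x (η x) := by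
    intro x₀
    obtain ⟨F, t, ht, hxt, htt, hF, hd⟩ := exists_hasLogDerivAt
      (isOpen_extChartAt_target (I := 𝓘(ℝ, H)) x₀) (hη x₀)
      (fun y hy => maurerCartanEq_chartForm hη hflat x₀ hy) (mem_extChartAt_target x₀)
    refine ⟨(extChartAt 𝓘(ℝ, H) x₀).source ∩ extChartAt 𝓘(ℝ, H) x₀ ⁻¹' t,
      fun x => F (extChartAt 𝓘(ℝ, H) x₀ x),
      (continuousOn_extChartAt x₀).isOpen_inter_preimage (isOpen_extChartAt_source x₀) ht,
      ⟨mem_extChartAt_source x₀, hxt⟩, ?_, fun x hx => ?_⟩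
    · refine hF.comp ?_ fun x hx => hx.2
      have := contMDiffOn_extChartAt (I := 𝓘(ℝ, H)) (n := ∞) (x := x₀)
      rw [← extChartAt_source (I := 𝓘(ℝ, H))] at this
      exact this.mono inter_subset_left
    · have := (hd _ hx.2).comp (hasModelDerivAt_extChartAt hx.1)
      rwa [chartForm_comp_modelDeriv η hx.1] at this
  choose U F hU hxU hF hd using hloc
  have hη1 : ∀ x, ContDiffAt ℝ 1 (chartForm η x) (extChartAt 𝓘(ℝ, H) x x) := fun x =>
    ((hη x).contDiffAt (extChartAt_target_mem_nhds x)).of_le one_le_infty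
  -- On overlaps, `F i` and the left translate of `F j` with the same value at `x` have the same
  -- logarithmic derivative, so `F i * (F j)⁻¹` is locally constant.
  obtain ⟨g, hg⟩ := exists_eventually_eq_mul_of_simplyConnected U hU (fun x => ⟨x, hxU x⟩) F
    (fun i j x hi hj => by
      have := HasLogDerivAt.eventually_eq_manifold (hη1 x)
        (mem_of_superset ((hU i).mem_nhds hi) fun y hy => hd i y hy)
        (mem_of_superset ((hU j).mem_nhds hj) fun y hy =>
          (hd j y hy).mul_left (F i x * (F j x)⁻¹)) (by simp)
      filter_upwards [this] with y hy
      rw [hy, mul_inv_cancel_right])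
  refine ⟨g, fun x => ?_, fun x => ?_⟩
  · have h1 : ContMDiffAt 𝓘(ℝ, H) 𝓘(ℝ, E) ∞ (F x) x := (hF x).contMDiffAt ((hU x).mem_nhds (hxU x))
    have h2 : ContMDiffAt 𝓘(ℝ, H) 𝓘(ℝ, E) ∞ (fun y => g x * (F x x)⁻¹ * F x y) x :=
      (contMDiff_mul_left (I := 𝓘(ℝ, E)) (n := ∞)).contMDiffAt.comp x h1
    exact h2.congr_of_eventuallyEq (hg x x (hxU x))
  · exact ((hd x x (hxU x)).mul_left _).congr (hg x x (hxU x))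

/-- Maps from a connected manifold to `G` with the same logarithmic derivative differ by a left
translation. -/
theorem HasLogDerivAt.exists_eq_mul [PreconnectedSpace L] [Nonempty L] {F₁ F₂ : L → G}
    {η : L → H →L[ℝ] E}
    (hη : ∀ x, ContDiffOn ℝ ∞ (chartForm η x) (extChartAt 𝓘(ℝ, H) x).target)
    (h₁ : ∀ x, HasLogDerivAt F₁ x (η x)) (h₂ : ∀ x, HasLogDerivAt F₂ x (η x)) :
    ∃ a : G, ∀ x, F₂ x = a * F₁ x := by
  have hlc : IsLocallyConstant fun x => F₂ x * (F₁ x)⁻¹ := by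
    rw [IsLocallyConstant.iff_eventually_eq]
    intro x
    have := HasLogDerivAt.eventually_eq_manifold (F₁ := F₂)
      (F₂ := fun y => F₂ x * (F₁ x)⁻¹ * F₁ y)
      (((hη x).contDiffAt (extChartAt_target_mem_nhds x)).of_le one_le_infty)
      (Eventually.of_forall h₂) (Eventually.of_forall fun y => (h₁ y).mul_left _) (by simp)
    filter_upwards [this] with y hy
    rw [hy, mul_inv_cancel_right]
  have x₀ : L := Classical.arbitrary L
  refine ⟨F₂ x₀ * (F₁ x₀)⁻¹, fun x => ?_⟩
  rw [← hlc.apply_eq_of_preconnectedSpace x x₀, inv_mul_cancel_right]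

end Cartan

/-! ### The bracket of 𝔤 in terms of 𝔪 ≅ ℂ³ and the isotropy representation. -/

section LieAlgebraOfHomogeneousSpace

open FlatModel

namespace FlatModel

/-- The vector `conj (u × v)`. -/
noncomputable def conjCross (u v : Fin 3 → ℂ) : Fin 3 → ℂ := star (crossProduct u v)

theorem conjCross_swap (u v : Fin 3 → ℂ) : conjCross v u = -conjCross u v := by
  rw [conjCross, conjCross, ← cross_anticomm, star_neg]

theorem det_smul_row (u v : Fin 3 → ℂ) (c : ℂ) (i : Fin 3) :
    Matrix.det (Matrix.of ![u, v, c • Pi.single i 1]) = c * crossProduct u v i := by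
  fin_cases i <;> simp [Matrix.det_fin_three, crossProduct] <;> ring

theorem riesz_inner (u : Fin 3 → ℂ) : riesz (inner u) = u := by
  ext i
  have h1 : inner u (Pi.single i 1) = (u i).re := by simp [inner]
  have h2 : inner u (Pi.single i I) = (u i).im := by simp [inner]
  rw [riesz, h1, h2, mul_comm, re_add_im]

/-- ψ(u, v, iZ) = det(u, v, Z) = (u × v) · Z, whose real part is represented by the conjugate of u ×
v. -/
theorem riesz_psi (u v : Fin 3 → ℂ) :
    riesz (fun Z => (psi u v (I • Z)).re / 2) = (1 / 2 : ℂ) • conjCross u v := by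
  have h1 : ∀ i, psi u v (I • Pi.single i (1 : ℂ)) = crossProduct u v i := fun i => by
    rw [psi, det_smul_row, ← mul_assoc]; simp
  have h2 : ∀ i, psi u v (I • Pi.single i I) = I * crossProduct u v i := fun i => by
    have : (I • Pi.single i I : Fin 3 → ℂ) = (-1 : ℂ) • Pi.single i 1 := by
      rw [← Pi.single_smul, ← Pi.single_smul]; simp
    rw [psi, this, det_smul_row]; ring
  ext i
  rw [riesz]
  simp only [h1, h2]
  apply Complex.ext <;> simp [conjCross] <;> ring

/-- Special unitary matrices preserve `(u, v) ↦ conj (u × v)`. -/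
theorem conjCross_mulVec {U : Matrix (Fin 3) (Fin 3) ℂ}
    (hU : U ∈ Matrix.specialUnitaryGroup (Fin 3) ℂ) (u v : Fin 3 → ℂ) :
    conjCross (U *ᵥ u) (U *ᵥ v) = U *ᵥ conjCross u v := by
  obtain ⟨hU1, hU2⟩ := Matrix.mem_specialUnitaryGroup_iff.1 hU
  -- For a special unitary matrix the cofactor matrix is the entrywise conjugate, and cofactors
  -- govern the cross product of Uu and Uv. Conjugating the result gives back U.
  have hinv : U.adjugate = Uᴴ := by
    have h1 : U * Uᴴ = 1 := Matrix.mem_unitaryGroup_iff.1 hU1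
    have h2 : U.adjugate * U = 1 := by rw [Matrix.adjugate_mul, hU2, one_smul]
    calc U.adjugate = U.adjugate * (U * Uᴴ) := by rw [h1, mul_one]
      _ = Uᴴ := by rw [← mul_assoc, h2, one_mul]
  have hc : ∀ i j, U i j = star (U.adjugate j i) := fun i j => by
    rw [hinv, Matrix.conjTranspose_apply, star_star]
  have key : U *ᵥ conjCross u v =
      star (fun i => ∑ j, U.adjugate j i * crossProduct u v j) := by
    ext i
    simp only [Matrix.mulVec, dotProduct, Pi.star_apply, star_sum, star_mul', conjCross]
    exact Finset.sum_congr rfl fun j _ => by rw [← hc]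
  rw [key, conjCross]
  congr 1
  rw [Matrix.adjugate_fin_three]
  ext i
  fin_cases i <;>
    simp [crossProduct, Matrix.mulVec, dotProduct, Fin.sum_univ_three] <;> ring

theorem conjCross_smul_right (u v : Fin 3 → ℂ) (c : ℂ) :
    conjCross u (c • v) = star c • conjCross u v := by
  rw [conjCross, map_smul, star_smul, conjCross]

theorem eq_zero_of_conjCross_eq_zero {u : Fin 3 → ℂ} (h : ∀ v, conjCross u v = 0) : u = 0 := by
  have h' : ∀ v i, crossProduct u v i = 0 := fun v i => by
    have := congrFun (h v) i
    simpa [conjCross] using this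
  have h1 := h' ![1, 0, 0] 1
  have h2 := h' ![1, 0, 0] 2
  have h3 := h' ![0, 1, 0] 2
  simp [crossProduct] at h1 h2 h3
  ext i
  fin_cases i <;> simp [h1, h2, h3]

end FlatModel

variable {E : Type*} [NormedAddCommGroup E] [NormedSpace ℝ E]
  {G : Type*} [TopologicalSpace G] [ChartedSpace E G] [Group G]
  {M : Type*} [TopologicalSpace M] [ChartedSpace (EuclideanSpace ℝ (Fin 6)) M] [MulAction G M]

namespace InvariantSU3Structure

variable (S : InvariantSU3Structure (E := E) G M)

@[simp] theorem ζ_hPart (X : GroupLieAlgebra 𝓘(ℝ, E) G) : S.ζ (S.hPart X) = 0 := by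
  simp [hPart, S.ζ_b]

theorem hPart_of_ζ_eq_zero {X : GroupLieAlgebra 𝓘(ℝ, E) G} (h : S.ζ X = 0) : S.hPart X = X := by
  simp [hPart, h]

theorem hPart_add_b (X : GroupLieAlgebra 𝓘(ℝ, E) G) : S.hPart X + S.b (S.ζ X) = X := by
  simp [hPart]

theorem hPart_b (z : Fin 3 → ℂ) : S.hPart (S.b z) = 0 := by
  simp [hPart, S.ζ_b]

theorem hPart_add (X Y : GroupLieAlgebra 𝓘(ℝ, E) G) :
    S.hPart (X + Y) = S.hPart X + S.hPart Y := by
  simp only [hPart, map_add]; abel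

theorem hPart_smul (c : ℝ) (X : GroupLieAlgebra 𝓘(ℝ, E) G) :
    S.hPart (c • X) = c • S.hPart X := by
  simp only [hPart, map_smul, smul_sub]

/-- The matrix of the isotropy representation of the `𝔥`-component of `X`, on `𝔪 ≅ ℂ³`. -/
noncomputable def isotropy (X : GroupLieAlgebra 𝓘(ℝ, E) G) : Matrix (Fin 3) (Fin 3) ℂ :=
  Matrix.of fun i j => S.ζ ⁅S.hPart X, S.b (Pi.single j 1)⁆ i

theorem isotropy_eq_of_forall {X : GroupLieAlgebra 𝓘(ℝ, E) G} {A : Matrix (Fin 3) (Fin 3) ℂ}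
    (h : ∀ z, ⁅S.hPart X, S.b z⁆ = S.b (A *ᵥ z)) : S.isotropy X = A := by
  ext i j
  simp [isotropy, h, S.ζ_b]

theorem hPart_lie_b (X : GroupLieAlgebra 𝓘(ℝ, E) G) (z : Fin 3 → ℂ) :
    ⁅S.hPart X, S.b z⁆ = S.b (S.isotropy X *ᵥ z) := by
  obtain ⟨A, -, -, hA⟩ := S.ad_mem (S.hPart X) (S.ζ_hPart X)
  rw [S.isotropy_eq_of_forall hA, hA]

theorem ζ_hPart_lie_b (X : GroupLieAlgebra 𝓘(ℝ, E) G) (z : Fin 3 → ℂ) :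
    S.ζ ⁅S.hPart X, S.b z⁆ = S.isotropy X *ᵥ z := by
  rw [hPart_lie_b, S.ζ_b]

theorem conjTranspose_isotropy (X : GroupLieAlgebra 𝓘(ℝ, E) G) :
    (S.isotropy X)ᴴ = -S.isotropy X := by
  obtain ⟨A, hA, -, h⟩ := S.ad_mem (S.hPart X) (S.ζ_hPart X)
  rw [S.isotropy_eq_of_forall h, hA]

theorem isotropy_b (z : Fin 3 → ℂ) : S.isotropy (S.b z) = S.isotropy 0 := by
  have : S.hPart (S.b z) = S.hPart 0 := by rw [hPart_b]; simp [hPart]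
  simp only [isotropy, this]

variable [LieGroup 𝓘(ℝ, E) ∞ G] [CompleteSpace E]

attribute [local instance] LieGroup.minSmoothness_real

theorem isotropy_add (X Y : GroupLieAlgebra 𝓘(ℝ, E) G) :
    S.isotropy (X + Y) = S.isotropy X + S.isotropy Y := by
  ext i j
  simp [isotropy, hPart_add]

theorem isotropy_smul (c : ℝ) (X : GroupLieAlgebra 𝓘(ℝ, E) G) :
    S.isotropy (c • X) = c • S.isotropy X := by
  ext i j
  simp [isotropy, hPart_smul]

/-- The difference of the 𝔥-parts acts trivially on 𝔪, so it is zero by faithfulness. -/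
theorem ext_of_isotropy {X Y : GroupLieAlgebra 𝓘(ℝ, E) G} (h1 : S.ζ X = S.ζ Y)
    (h2 : S.isotropy X = S.isotropy Y) : X = Y := by
  rw [← S.hPart_add_b X, ← S.hPart_add_b Y, h1]
  congr 1
  rw [← sub_eq_zero]
  refine S.faithful _ (by simp) fun z => ?_
  rw [sub_lie, hPart_lie_b, hPart_lie_b, h2, sub_self]

theorem brM_swap (X Y : Fin 3 → ℂ) : S.brM Y X = -S.brM X Y := by
  rw [brM, ← lie_skew, map_neg, brM]

/-- Torsion-freeness: the last two terms of the Koszul formula are together symmetric in `X` and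
`Y`. -/
theorem leviCivita_sub (X Y : Fin 3 → ℂ) : S.leviCivita X Y - S.leviCivita Y X = S.brM X Y := by
  have hn : ∀ u v : Fin 3 → ℂ, FlatModel.inner (-u) v = -FlatModel.inner u v :=
    fun u v => by simp [FlatModel.inner]
  rw [← riesz_inner (S.brM X Y)]
  ext i
  simp only [leviCivita, riesz, Pi.sub_apply, S.brM_swap X Y, S.brM_swap X, S.brM_swap _ Y, hn]
  push_cast
  ring

variable {S}

/-- The canonical connection is zero on 𝔪, so Levi-Civita is minus the correction ½ Re ψ(X, Y, J ·).
-/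
theorem IsNearlyKahler.leviCivita_eq (hS : S.IsNearlyKahler) (X Y : Fin 3 → ℂ) :
    S.leviCivita X Y = -((1 / 2 : ℂ) • conjCross X Y) := by
  have := hS.canonical X Y
  rw [characteristic, riesz_psi] at this
  exact eq_neg_of_add_eq_zero_left this

theorem IsNearlyKahler.brM_eq (hS : S.IsNearlyKahler) (X Y : Fin 3 → ℂ) :
    S.brM X Y = -conjCross X Y := by
  rw [← S.leviCivita_sub, hS.leviCivita_eq, hS.leviCivita_eq, conjCross_swap X Y]
  ext i
  simp
  ring

/-- All terms with the connection map vanish, and only the action of [X, Y]_𝔥 survives. -/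
theorem IsNearlyKahler.curvature_eq (hS : S.IsNearlyKahler) (X Y Z : Fin 3 → ℂ) :
    S.curvature X Y Z = -(S.isotropy ⁅S.b X, S.b Y⁆ *ᵥ Z) := by
  rw [curvature, hS.canonical, hS.canonical, hS.canonical, ζ_hPart_lie_b]
  simp

/-- The Lie algebra of the stabiliser is closed under brackets, and the isotropy representation
preserves them. -/
theorem IsNearlyKahler.lie_hPart_hPart (hS : S.IsNearlyKahler) (X Y : GroupLieAlgebra 𝓘(ℝ, E) G) :
    S.ζ ⁅S.hPart X, S.hPart Y⁆ = 0 ∧ S.isotropy ⁅S.hPart X, S.hPart Y⁆ =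
      S.isotropy X * S.isotropy Y - S.isotropy Y * S.isotropy X := by
  set W := ⁅S.hPart X, S.hPart Y⁆ with hW
  set C := S.isotropy X * S.isotropy Y - S.isotropy Y * S.isotropy X with hC
  -- Jacobi identity: `W` acts on 𝔪 as the commutator of the two isotropy matrices, before anything
  -- is known about its 𝔪-part.
  have h1 : ∀ z, ⁅W, S.b z⁆ = S.b (C *ᵥ z) := fun z => by
    rw [hW, lie_lie, hPart_lie_b, hPart_lie_b, hPart_lie_b, hPart_lie_b, ← map_sub, hC,
      Matrix.sub_mulVec, Matrix.mulVec_mulVec, Matrix.mulVec_mulVec]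
  have h2 : ∀ z, conjCross (S.ζ W) z = (S.isotropy W - C) *ᵥ z := fun z => by
    have h := congrArg S.ζ (h1 z)
    rw [← S.hPart_add_b W, add_lie, map_add, ζ_hPart_lie_b, S.ζ_b] at h
    have h3 := hS.brM_eq (S.ζ W) z
    rw [brM] at h3
    rw [Matrix.sub_mulVec]
    have h4 : S.isotropy (S.hPart W + S.b (S.ζ W)) = S.isotropy W := by rw [S.hPart_add_b]
    rw [h3] at h
    rw [← h]
    simp
  -- In `h2` the left side is conjugate linear in `z` and the right side complex linear, so both
  -- vanish.
  have h3 : ∀ z, conjCross (S.ζ W) z = 0 := fun z => by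
    have h4 := h2 (I • z)
    rw [conjCross_smul_right, Matrix.mulVec_smul, ← h2] at h4
    have h5 : (-I - I) • conjCross (S.ζ W) z = 0 := by
      rw [sub_smul, ← h4]; simp
    refine (smul_eq_zero.1 h5).resolve_left fun h6 => ?_
    have := congrArg Complex.im h6
    norm_num at this
  have h4 : S.ζ W = 0 := eq_zero_of_conjCross_eq_zero h3
  refine ⟨h4, S.isotropy_eq_of_forall fun z => ?_⟩
  rw [S.hPart_of_ζ_eq_zero h4, h1]

/-- Expand along 𝔥 ⊕ 𝔪: [𝔥, 𝔥] has no 𝔪-part, [𝔥, 𝔪] is the isotropy action, and [𝔪, 𝔪]_𝔪 is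
`brM_eq`. -/
theorem IsNearlyKahler.ζ_lie (hS : S.IsNearlyKahler) (X Y : GroupLieAlgebra 𝓘(ℝ, E) G) :
    S.ζ ⁅X, Y⁆ = S.isotropy X *ᵥ S.ζ Y - S.isotropy Y *ᵥ S.ζ X - conjCross (S.ζ X) (S.ζ Y) := by
  have h := hS.brM_eq (S.ζ X) (S.ζ Y)
  rw [brM] at h
  conv_lhs => rw [← S.hPart_add_b X, ← S.hPart_add_b Y]
  rw [add_lie, lie_add, lie_add, map_add, map_add, map_add, (hS.lie_hPart_hPart X Y).1, h,
    ζ_hPart_lie_b, ← lie_skew, map_neg, ζ_hPart_lie_b]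
  abel

theorem IsNearlyKahler.isotropy_lie (hS : S.IsNearlyKahler) (X Y : GroupLieAlgebra 𝓘(ℝ, E) G) :
    S.isotropy ⁅X, Y⁆ = S.isotropy X * S.isotropy Y - S.isotropy Y * S.isotropy X
      + S.isotropy ⁅S.b (S.ζ X), S.b (S.ζ Y)⁆ := by
  have h0 : S.isotropy (0 : GroupLieAlgebra 𝓘(ℝ, E) G) = 0 := by
    have := S.isotropy_smul 0 0
    simpa using this
  conv_lhs => rw [← S.hPart_add_b X, ← S.hPart_add_b Y]
  rw [add_lie, lie_add, lie_add, isotropy_add, isotropy_add, isotropy_add,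
    (hS.lie_hPart_hPart X Y).2, hPart_lie_b, ← lie_skew, hPart_lie_b, ← map_neg, isotropy_b,
    isotropy_b, h0]
  abel

end InvariantSU3Structure

end LieAlgebraOfHomogeneousSpace

/-! ### Curvature under a change of gauge. -/

section GaugeTransformation

open Filter
open scoped Topology

variable {H : Type*} [NormedAddCommGroup H] [NormedSpace ℝ H]

/-- The behaviour of the curvature `dφ + φ ∧ φ` under the gauge transformation
`n = t φ t⁻¹ - dt t⁻¹`. -/
theorem gauge_curvature {𝔸 : Type*} [NormedRing 𝔸] [NormedAlgebra ℝ 𝔸] {t r : H → 𝔸}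
    {φ n : H → H →L[ℝ] 𝔸} {y : H} (ht : ContDiffAt ℝ 2 t y) (hr : DifferentiableAt ℝ r y)
    (hφ : DifferentiableAt ℝ φ y) (hn : DifferentiableAt ℝ n y) (htr : ∀ z, t z * r z = 1)
    (hrt : ∀ z, r z * t z = 1)
    (h : ∀ᶠ z in 𝓝 y, ∀ v, n z v = t z * φ z v * r z - fderiv ℝ t z v * r z) (v w : H) :
    fderiv ℝ n y v w - fderiv ℝ n y w v + (n y v * n y w - n y w * n y v) =
      t y * (fderiv ℝ φ y v w - fderiv ℝ φ y w v + (φ y v * φ y w - φ y w * φ y v)) * r y := by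
  have ht1 : DifferentiableAt ℝ t y := ht.differentiableAt (by norm_num)
  have ht2 : DifferentiableAt ℝ (fderiv ℝ t) y :=
    (ht.fderiv_right (m := 1) (by norm_num)).differentiableAt (by norm_num)
  have hsymm : fderiv ℝ (fderiv ℝ t) y v w = fderiv ℝ (fderiv ℝ t) y w v :=
    (ht.isSymmSndFDerivAt (by simp)).eq v w
  -- Here `r` is the inverse of `t`, so dr = -r dt r.
  have hdr : ∀ u, fderiv ℝ r y u = -(r y * fderiv ℝ t y u * r y) := fun u => by
    have h1 : fderiv ℝ (fun z => r z * t z) y u = 0 := by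
      rw [show (fun z => r z * t z) = fun _ => 1 from funext hrt]; simp
    have h3 := (hr.hasFDerivAt.mul' ht1.hasFDerivAt).fderiv
    rw [show fderiv ℝ (fun z => r z * t z) y = _ from h3] at h1
    have h2 : r y * fderiv ℝ t y u + fderiv ℝ r y u * t y = 0 := by simpa using h1
    calc fderiv ℝ r y u = fderiv ℝ r y u * t y * r y := by rw [mul_assoc, htr, mul_one]
      _ = -(r y * fderiv ℝ t y u * r y) := by
        rw [eq_neg_of_add_eq_zero_right h2, neg_mul]
  have hD : ∀ u w, fderiv ℝ n y u w = fderiv ℝ t y u * φ y w * r y + t y * fderiv ℝ φ y u w * r y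
      - t y * φ y w * (r y * fderiv ℝ t y u * r y) - fderiv ℝ (fderiv ℝ t) y u w * r y
      + fderiv ℝ t y w * (r y * fderiv ℝ t y u * r y) := fun u w => by
    have h1 : HasFDerivAt (fun z => n z w) _ y := hn.hasFDerivAt.clm_apply (hasFDerivAt_const w y)
    have h2 := hφ.hasFDerivAt.clm_apply (hasFDerivAt_const w y)
    have h3 := ht2.hasFDerivAt.clm_apply (hasFDerivAt_const w y)
    have h4 := ((ht1.hasFDerivAt.mul' h2).mul' hr.hasFDerivAt).sub (h3.mul' hr.hasFDerivAt)
    have h5 := congrArg (fun f => f u)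
      (h1.unique (h4.congr_of_eventuallyEq (h.mono fun z hz => hz w)))
    simp [hdr] at h5
    rw [h5]
    noncomm_ring
  have hrt' : ∀ a, r y * (t y * a) = a := fun a => by rw [← mul_assoc, hrt, one_mul]
  -- The second derivatives of `t` cancel by symmetry, and the terms with dt cancel after
  -- contracting `r * t`.
  rw [hD, hD, h.self_of_nhds v, h.self_of_nhds w, hsymm]
  simp only [mul_add, add_mul, mul_sub, sub_mul, mul_assoc, hrt']
  abel

end GaugeTransformation

/-! ### Calculus of matrix valued maps. -/

section MatrixValued

attribute [local instance] Matrix.linftyOpNormedRing Matrix.linftyOpNormedAlgebra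

/-- The topology of the operator norm on matrices. -/
@[reducible] noncomputable def linftyOpTopologicalSpace :
    TopologicalSpace (Matrix (Fin 3) (Fin 3) ℂ) :=
  PseudoMetricSpace.toUniformSpace.toTopologicalSpace

attribute [local instance 2000] linftyOpTopologicalSpace

variable {H : Type*} [NormedAddCommGroup H] [NormedSpace ℝ H]

/-- The entry of a matrix as a continuous linear map. -/
noncomputable def entryCLM (i j : Fin 3) : Matrix (Fin 3) (Fin 3) ℂ →L[ℝ] ℂ :=
  LinearMap.toContinuousLinearMap
    { toFun := fun A => A i j, map_add' := fun _ _ => rfl, map_smul' := fun _ _ => rfl }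

theorem entryCLM_apply (i j : Fin 3) (A : Matrix (Fin 3) (Fin 3) ℂ) : entryCLM i j A = A i j := rfl

theorem contDiffOn_matrix {f : H → Matrix (Fin 3) (Fin 3) ℂ} {s : Set H} {n : ℕ∞ω}
    (h : ∀ i j, ContDiffOn ℝ n (fun y => f y i j) s) : ContDiffOn ℝ n f s := by
  have : f = fun y => ∑ i, ∑ j, f y i j • Matrix.single i j (1 : ℂ) := by
    ext1 y
    conv_lhs => rw [Matrix.matrix_eq_sum_single (f y)]
    simp [Matrix.smul_single]
  rw [this]
  exact ContDiffOn.sum fun i _ => ContDiffOn.sum fun j _ => (h i j).smul contDiffOn_const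

theorem fderiv_matrix_apply {f : H → Matrix (Fin 3) (Fin 3) ℂ} {y : H}
    (h : DifferentiableAt ℝ f y) (v : H) (i j : Fin 3) :
    fderiv ℝ f y v i j = fderiv ℝ (fun z => f z i j) y v := by
  have := ((entryCLM i j).hasFDerivAt.comp y h.hasFDerivAt).fderiv
  exact (congrArg (fun f => f v) this).symm

/-- The matrix valued linear map with given entries. -/
noncomputable def ofEntriesCLM [FiniteDimensional ℝ H] (c : Fin 3 → Fin 3 → H →L[ℝ] ℂ) :
    H →L[ℝ] Matrix (Fin 3) (Fin 3) ℂ :=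
  LinearMap.toContinuousLinearMap
    { toFun := fun v => Matrix.of fun i j => c i j v
      map_add' := fun v w => by ext; simp
      map_smul' := fun a v => by ext; simp }

end MatrixValued

/-! ### The Maurer-Cartan equation split into its 𝔪- and 𝔥-components. -/

section ComponentsOfMaurerCartan

open FlatModel Filter
open scoped Topology

attribute [local instance] Matrix.linftyOpNormedRing Matrix.linftyOpNormedAlgebra
attribute [local instance 2000] linftyOpTopologicalSpace

variable {E : Type*} [NormedAddCommGroup E] [NormedSpace ℝ E] [FiniteDimensional ℝ E]
  {G : Type*} [TopologicalSpace G] [ChartedSpace E G] [Group G] [LieGroup 𝓘(ℝ, E) ∞ G]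
  {M : Type*} [TopologicalSpace M] [ChartedSpace (EuclideanSpace ℝ (Fin 6)) M] [MulAction G M]

theorem _root_.DifferentiableAt.map_fderiv_apply {H F F' : Type*} [NormedAddCommGroup H]
    [NormedSpace ℝ H] [NormedAddCommGroup F] [NormedSpace ℝ F] [NormedAddCommGroup F']
    [NormedSpace ℝ F'] {P : F →L[ℝ] F'} {η : H → H →L[ℝ] F} {ξ : H → H →L[ℝ] F'} {y : H}
    (hη : DifferentiableAt ℝ η y) (h : ∀ᶠ z in 𝓝 y, ∀ v, P (η z v) = ξ z v) (v w : H) :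
    P (fderiv ℝ η y v w) = fderiv ℝ ξ y v w := by
  have h1 := (ContinuousLinearMap.compL ℝ H F F' P).hasFDerivAt.comp y hη.hasFDerivAt
  have h2 := (h1.congr_of_eventuallyEq (h.mono fun z hz =>
    (ContinuousLinearMap.ext fun v => (hz v).symm : ξ z = P.comp (η z)))).fderiv
  rw [h2]; rfl

namespace InvariantSU3Structure

attribute [local instance] LieGroup.minSmoothness_real

variable (S : InvariantSU3Structure (E := E) G M)

theorem isotropy_zero : S.isotropy (0 : GroupLieAlgebra 𝓘(ℝ, E) G) = 0 := by
  have : CompleteSpace E := FiniteDimensional.complete ℝ E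
  simpa using S.isotropy_smul 0 0

/-- The projection to `𝔪 ≅ ℂ³` on the model space of `G`. -/
noncomputable def ζCLM : E →L[ℝ] (Fin 3 → ℂ) :=
  LinearMap.toContinuousLinearMap (S.ζ : E →ₗ[ℝ] (Fin 3 → ℂ))

/-- The isotropy representation on the model space of `G`. -/
noncomputable def isotropyCLM : E →L[ℝ] Matrix (Fin 3) (Fin 3) ℂ :=
  have : CompleteSpace E := FiniteDimensional.complete ℝ E
  LinearMap.toContinuousLinearMap
    { toFun := fun X : E => S.isotropy X
      map_add' := S.isotropy_add
      map_smul' := S.isotropy_smul }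

/-- A left inverse of `X ↦ (ζ X, isotropy X)`. -/
theorem exists_ofComponents : ∃ K : (Fin 3 → ℂ) × Matrix (Fin 3) (Fin 3) ℂ →L[ℝ] E,
    ∀ X, K (S.ζCLM X, S.isotropyCLM X) = X := by
  have : CompleteSpace E := FiniteDimensional.complete ℝ E
  have hinj : LinearMap.ker (S.ζCLM.prod S.isotropyCLM).toLinearMap = ⊥ :=
    LinearMap.ker_eq_bot.2 fun X Y h => by
      have h1 : S.ζCLM X = S.ζCLM Y := congrArg Prod.fst h
      have h2 : S.isotropyCLM X = S.isotropyCLM Y := congrArg Prod.snd h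
      exact S.ext_of_isotropy h1 h2
  obtain ⟨K, hK⟩ := LinearMap.exists_leftInverse_of_injective _ hinj
  exact ⟨LinearMap.toContinuousLinearMap K, fun X => congrArg (fun f => f X) hK⟩

/-- The `𝔤`-element with the given components, if there is one. -/
noncomputable def ofComponents : (Fin 3 → ℂ) × Matrix (Fin 3) (Fin 3) ℂ →L[ℝ] E :=
  S.exists_ofComponents.choose

theorem ofComponents_apply (X : E) : S.ofComponents (S.ζCLM X, S.isotropyCLM X) = X :=
  S.exists_ofComponents.choose_spec X

variable {H : Type*} [NormedAddCommGroup H] [NormedSpace ℝ H]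

variable {S} {η : H → H →L[ℝ] E} {ξ : H → H →L[ℝ] (Fin 3 → ℂ)} {y : H}

theorem fderiv_ζCLM (hη : DifferentiableAt ℝ η y)
    (hξ : ∀ᶠ z in 𝓝 y, ∀ v, S.ζCLM (η z v) = ξ z v) (v w : H) :
    S.ζCLM (fderiv ℝ η y v w) = fderiv ℝ ξ y v w :=
  hη.map_fderiv_apply hξ v w

theorem fderiv_isotropyCLM {n : H → H →L[ℝ] Matrix (Fin 3) (Fin 3) ℂ}
    (hη : DifferentiableAt ℝ η y) (hn : ∀ᶠ z in 𝓝 y, ∀ v, S.isotropyCLM (η z v) = n z v)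
    (v w : H) : S.isotropyCLM (fderiv ℝ η y v w) = fderiv ℝ n y v w :=
  hη.map_fderiv_apply hn v w

theorem IsNearlyKahler.ζCLM_modelBracket (hS : S.IsNearlyKahler) (X Y : E) :
    S.ζCLM (modelBracket G X Y) = S.isotropyCLM X *ᵥ S.ζCLM Y - S.isotropyCLM Y *ᵥ S.ζCLM X
      - conjCross (S.ζCLM X) (S.ζCLM Y) :=
  have : CompleteSpace E := FiniteDimensional.complete ℝ E
  hS.ζ_lie X Y

theorem IsNearlyKahler.isotropyCLM_modelBracket (hS : S.IsNearlyKahler) (X Y : E) :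
    S.isotropyCLM (modelBracket G X Y) = S.isotropyCLM X * S.isotropyCLM Y
      - S.isotropyCLM Y * S.isotropyCLM X + S.isotropy ⁅S.b (S.ζCLM X), S.b (S.ζCLM Y)⁆ :=
  have : CompleteSpace E := FiniteDimensional.complete ℝ E
  hS.isotropy_lie X Y

theorem eq_of_ζCLM_of_isotropyCLM {X Y : E} (h1 : S.ζCLM X = S.ζCLM Y)
    (h2 : S.isotropyCLM X = S.isotropyCLM Y) : X = Y :=
  have : CompleteSpace E := FiniteDimensional.complete ℝ E
  S.ext_of_isotropy h1 h2

/-- The Maurer-Cartan equation of `G` is equivalent to the structure equations of `M`. -/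
theorem IsNearlyKahler.maurerCartanEq_of_components (hS : S.IsNearlyKahler)
    {n : H → H →L[ℝ] Matrix (Fin 3) (Fin 3) ℂ} (hη : DifferentiableAt ℝ η y)
    (hξ : ∀ᶠ z in 𝓝 y, ∀ v, S.ζCLM (η z v) = ξ z v)
    (hn : ∀ᶠ z in 𝓝 y, ∀ v, S.isotropyCLM (η z v) = n z v)
    (h1 : ∀ v w, fderiv ℝ ξ y v w - fderiv ℝ ξ y w v + (n y v *ᵥ ξ y w - n y w *ᵥ ξ y v
      - conjCross (ξ y v) (ξ y w)) = 0)
    (h2 : ∀ v w, fderiv ℝ n y v w - fderiv ℝ n y w v + (n y v * n y w - n y w * n y v)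
      = -S.isotropy ⁅S.b (ξ y v), S.b (ξ y w)⁆) :
    MaurerCartanEq G (η y) (fderiv ℝ η y) := by
  intro v w
  refine eq_of_ζCLM_of_isotropyCLM (S := S) ?_ ?_
  · rw [map_add, map_sub, fderiv_ζCLM hη hξ, fderiv_ζCLM hη hξ, hS.ζCLM_modelBracket,
      hξ.self_of_nhds, hξ.self_of_nhds, hn.self_of_nhds, hn.self_of_nhds, h1, map_zero]
  · rw [map_add, map_sub, fderiv_isotropyCLM hη hn, fderiv_isotropyCLM hη hn,
      hS.isotropyCLM_modelBracket, hξ.self_of_nhds, hξ.self_of_nhds, hn.self_of_nhds,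
      hn.self_of_nhds, ← add_assoc, h2, neg_add_cancel, map_zero]

end InvariantSU3Structure

end ComponentsOfMaurerCartan

/-! ### The solution as vector and matrix valued forms. -/

section StructureEquations

open FlatModel Filter InvariantSU3Structure
open scoped Topology

attribute [local instance] Matrix.linftyOpNormedRing Matrix.linftyOpNormedAlgebra
attribute [local instance 2000] linftyOpTopologicalSpace

/-- The action of matrices on vectors, as a continuous bilinear map. -/
noncomputable def mulVecCLM :
    Matrix (Fin 3) (Fin 3) ℂ →L[ℝ] (Fin 3 → ℂ) →L[ℝ] (Fin 3 → ℂ) :=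
  LinearMap.toContinuousBilinearMap (LinearMap.mk₂ ℝ (fun A z => A *ᵥ z) Matrix.add_mulVec
    Matrix.smul_mulVec Matrix.mulVec_add fun c A z => Matrix.mulVec_smul A c z)

theorem mulVecCLM_apply (A : Matrix (Fin 3) (Fin 3) ℂ) (z : Fin 3 → ℂ) :
    mulVecCLM A z = A *ᵥ z := rfl

variable {L : Type*} [TopologicalSpace L] [ChartedSpace (EuclideanSpace ℝ (Fin 3)) L]

namespace OneForm

theorem vec_add (σ : Fin 3 → OneForm L) (x : L) (v w : TangentSpace (𝓡 3) x) :
    vec σ x (v + w) = vec σ x v + vec σ x w := by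
  ext; simp [vec]

theorem vec_smul (σ : Fin 3 → OneForm L) (x : L) (c : ℝ) (v : TangentSpace (𝓡 3) x) :
    vec σ x (c • v) = c • vec σ x v := by
  ext; simp [vec]

/-- The coframe `σ` as a `1`-form with values in `ℂ³`. -/
noncomputable def vecForm (σ : Fin 3 → OneForm L) (x : L) :
    EuclideanSpace ℝ (Fin 3) →L[ℝ] (Fin 3 → ℂ) :=
  LinearMap.toContinuousLinearMap
    { toFun := fun v => vec σ x v
      map_add' := vec_add σ x
      map_smul' := vec_smul σ x }

theorem vecForm_apply (σ : Fin 3 → OneForm L) (x : L) (v : EuclideanSpace ℝ (Fin 3)) (i : Fin 3) :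
    vecForm σ x v i = (σ i x v : ℂ) := rfl

/-- The `1`-form `φ = α + i β` with values in the matrices. -/
noncomputable def connForm (α β : Matrix (Fin 3) (Fin 3) (OneForm L)) (x : L) :
    EuclideanSpace ℝ (Fin 3) →L[ℝ] Matrix (Fin 3) (Fin 3) ℂ :=
  LinearMap.toContinuousLinearMap
    { toFun := fun v => connMatrix α β x v
      map_add' := fun v w => by
        ext i j
        have h1 := (α i j x).map_add v w
        have h2 := (β i j x).map_add v w
        simp only [connMatrix, Matrix.of_apply, Matrix.add_apply]
        refine (congrArg₂ (fun a b : ℝ => (a : ℂ) + I * b) h1 h2).trans ?_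
        push_cast; ring
      map_smul' := fun c v => by
        ext i j
        have h1 := (α i j x).map_smul c v
        have h2 := (β i j x).map_smul c v
        simp only [connMatrix, Matrix.of_apply, Matrix.smul_apply]
        refine (congrArg₂ (fun a b : ℝ => (a : ℂ) + I * b) h1 h2).trans ?_
        simp; ring }

theorem connForm_apply (α β : Matrix (Fin 3) (Fin 3) (OneForm L)) (x : L)
    (v : EuclideanSpace ℝ (Fin 3)) (i j : Fin 3) :
    connForm α β x v i j = (α i j x v : ℂ) + I * (β i j x v : ℂ) := rfl

/-- The derivative of `T` as a matrix valued `1`-form. -/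
noncomputable def derivForm (T : L → Matrix (Fin 3) (Fin 3) ℂ) (x : L) :
    EuclideanSpace ℝ (Fin 3) →L[ℝ] Matrix (Fin 3) (Fin 3) ℂ :=
  ofEntriesCLM fun i j => (modelDeriv (fun y => T y i j) x : EuclideanSpace ℝ (Fin 3) →L[ℝ] ℂ)

/-- The `1`-form `T σ` with values in `ℂ³`. -/
noncomputable def solderForm (σ : Fin 3 → OneForm L) (T : L → Matrix (Fin 3) (Fin 3) ℂ) (x : L) :
    EuclideanSpace ℝ (Fin 3) →L[ℝ] (Fin 3 → ℂ) :=
  (mulVecCLM (T x)).comp (vecForm σ x)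

theorem solderForm_apply (σ : Fin 3 → OneForm L) (T : L → Matrix (Fin 3) (Fin 3) ℂ) (x : L)
    (v : EuclideanSpace ℝ (Fin 3)) : solderForm σ T x v = T x *ᵥ vecForm σ x v := rfl

/-- The `1`-form `T φ T⁻¹ - dT T⁻¹`. -/
noncomputable def gaugeForm (α β : Matrix (Fin 3) (Fin 3) (OneForm L))
    (T : L → Matrix (Fin 3) (Fin 3) ℂ) (x : L) :
    EuclideanSpace ℝ (Fin 3) →L[ℝ] Matrix (Fin 3) (Fin 3) ℂ :=
  LinearMap.toContinuousLinearMap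
    { toFun := fun v => T x * connForm α β x v * (T x)ᴴ - derivForm T x v * (T x)ᴴ
      map_add' := fun v w => by simp only [map_add, mul_add, add_mul]; abel
      map_smul' := fun c v => by
        simp only [map_smul, Matrix.mul_smul, Matrix.smul_mul, smul_sub, RingHom.id_apply] }

theorem gaugeForm_apply (α β : Matrix (Fin 3) (Fin 3) (OneForm L))
    (T : L → Matrix (Fin 3) (Fin 3) ℂ) (x : L) (v : EuclideanSpace ℝ (Fin 3)) :
    gaugeForm α β T x v = T x * connForm α β x v * (T x)ᴴ - derivForm T x v * (T x)ᴴ := rfl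

theorem bracket_apply (σ : Fin 3 → OneForm L) (i j : Fin 3) (x : L) (v : TangentSpace (𝓡 3) x) :
    bracket σ i j x v = (!![0, σ 2 x v, -σ 1 x v; -σ 2 x v, 0, σ 0 x v; σ 1 x v, -σ 0 x v, 0] :
      Matrix (Fin 3) (Fin 3) ℝ) i j := by
  fin_cases i <;> fin_cases j <;> rfl

/-- The tangent space at `x` is identified with the model through the chart around `x`, so the
derivative of that chart at `x` is the identity. -/
theorem d_apply [IsManifold (𝓡 3) ∞ L] (θ : OneForm L) (x : L) (v w : EuclideanSpace ℝ (Fin 3)) :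
    θ.d x v w = fderiv ℝ (θ.inChart x) (extChartAt (𝓡 3) x x) v w
      - fderiv ℝ (θ.inChart x) (extChartAt (𝓡 3) x x) w v := by
  have : IsManifold (𝓡 3) 1 L := IsManifold.of_le (n := ∞) one_le_infty
  have h : ∀ v : EuclideanSpace ℝ (Fin 3),
      (modelDeriv (extChartAt (𝓡 3) x) x :
        EuclideanSpace ℝ (Fin 3) →L[ℝ] EuclideanSpace ℝ (Fin 3)) v = v := fun v => by
    rw [modelDeriv_extChartAt_self]; rfl
  change fderiv ℝ (θ.inChart x) (extChartAt (𝓡 3) x x)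
      ((modelDeriv (extChartAt (𝓡 3) x) x :
        EuclideanSpace ℝ (Fin 3) →L[ℝ] EuclideanSpace ℝ (Fin 3)) v)
      ((modelDeriv (extChartAt (𝓡 3) x) x :
        EuclideanSpace ℝ (Fin 3) →L[ℝ] EuclideanSpace ℝ (Fin 3)) w)
    - fderiv ℝ (θ.inChart x) (extChartAt (𝓡 3) x x)
      ((modelDeriv (extChartAt (𝓡 3) x) x :
        EuclideanSpace ℝ (Fin 3) →L[ℝ] EuclideanSpace ℝ (Fin 3)) w)
      ((modelDeriv (extChartAt (𝓡 3) x) x :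
        EuclideanSpace ℝ (Fin 3) →L[ℝ] EuclideanSpace ℝ (Fin 3)) v) = _
  rw [h, h]

end OneForm

end StructureEquations

/-! ### The structure equations imply the Maurer-Cartan equation of the Cartan form. -/

section CartanForm

open FlatModel Filter OneForm InvariantSU3Structure Set
open scoped Topology

attribute [local instance] Matrix.linftyOpNormedRing Matrix.linftyOpNormedAlgebra
attribute [local instance 2000] linftyOpTopologicalSpace

variable {E : Type*} [NormedAddCommGroup E] [NormedSpace ℝ E] [FiniteDimensional ℝ E]
  {G : Type*} [TopologicalSpace G] [ChartedSpace E G] [Group G] [LieGroup 𝓘(ℝ, E) ∞ G]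
  {M : Type*} [TopologicalSpace M] [ChartedSpace (EuclideanSpace ℝ (Fin 6)) M] [MulAction G M]
  [MulAction.IsPretransitive G M] {S : InvariantSU3Structure (E := E) G M}
  {L : Type*} [TopologicalSpace L] [ChartedSpace (EuclideanSpace ℝ (Fin 3)) L]
  {σ : Fin 3 → OneForm L} {α β : Matrix (Fin 3) (Fin 3) (OneForm L)}
  {T : L → Matrix (Fin 3) (Fin 3) ℂ}

namespace InvariantSU3Structure

attribute [local instance] LieGroup.minSmoothness_real

variable (S) in
/-- The `𝔤`-valued `1`-form `b (T σ) + A` of a solution of the structure equations, where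
`φ = T⁻¹ A T + T⁻¹ dT`. -/
noncomputable def cartanForm (σ : Fin 3 → OneForm L) (α β : Matrix (Fin 3) (Fin 3) (OneForm L))
    (T : L → Matrix (Fin 3) (Fin 3) ℂ) (x : L) : EuclideanSpace ℝ (Fin 3) →L[ℝ] E :=
  S.ofComponents.comp ((solderForm σ T x).prod (gaugeForm α β T x))

namespace IsLagrangianSolution

theorem mul_conjTranspose (h : S.IsLagrangianSolution σ α β T) (x : L) : T x * (T x)ᴴ = 1 :=
  Matrix.mem_unitaryGroup_iff.1 (Matrix.mem_specialUnitaryGroup_iff.1 (h.gauge_mem x)).1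

theorem conjTranspose_mul (h : S.IsLagrangianSolution σ α β T) (x : L) : (T x)ᴴ * T x = 1 :=
  mul_eq_one_comm.1 (h.mul_conjTranspose x)

/-- `ofComponents` is only a left inverse, so the prescribed pair must be shown to come from 𝔤: the
gauge condition supplies the element of 𝔥, to which b(Tσ) is added. -/
theorem exists_components (h : S.IsLagrangianSolution σ α β T) (x : L)
    (v : EuclideanSpace ℝ (Fin 3)) :
    ∃ Y : E, S.ζCLM Y = solderForm σ T x v ∧ S.isotropyCLM Y = gaugeForm α β T x v := by
  have : CompleteSpace E := FiniteDimensional.complete ℝ E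
  obtain ⟨X, hX, hX'⟩ := h.gauge_eq x v
  have h1 : S.isotropy X = gaugeForm α β T x v :=
    S.isotropy_eq_of_forall fun z => by rw [S.hPart_of_ζ_eq_zero hX]; exact hX' z
  refine ⟨X + S.b (solderForm σ T x v), ?_, ?_⟩
  · exact (map_add S.ζ X _).trans (by rw [hX, S.ζ_b, zero_add])
  · exact (S.isotropy_add X _).trans (by rw [h1, S.isotropy_b, S.isotropy_zero, add_zero])

theorem ζCLM_cartanForm (h : S.IsLagrangianSolution σ α β T) (x : L)
    (v : EuclideanSpace ℝ (Fin 3)) :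
    S.ζCLM (S.cartanForm σ α β T x v) = solderForm σ T x v := by
  obtain ⟨Y, h1, h2⟩ := h.exists_components x v
  have : S.cartanForm σ α β T x v = Y := by
    rw [← S.ofComponents_apply Y, h1, h2]; rfl
  rw [this, h1]

theorem isotropyCLM_cartanForm (h : S.IsLagrangianSolution σ α β T) (x : L)
    (v : EuclideanSpace ℝ (Fin 3)) :
    S.isotropyCLM (S.cartanForm σ α β T x v) = gaugeForm α β T x v := by
  obtain ⟨Y, h1, h2⟩ := h.exists_components x v
  have : S.cartanForm σ α β T x v = Y := by
    rw [← S.ofComponents_apply Y, h1, h2]; rfl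
  rw [this, h2]

theorem contDiffOn_vecForm (h : S.IsLagrangianSolution σ α β T) (x : L) :
    ContDiffOn ℝ ∞ (chartForm (vecForm σ) x) (extChartAt (𝓡 3) x).target :=
  contDiffOn_clm_apply.2 fun _ => contDiffOn_pi.2 fun i =>
    ofRealCLM.contDiff.comp_contDiffOn ((h.smooth_σ i x).clm_apply contDiffOn_const)

theorem contDiffOn_connForm (h : S.IsLagrangianSolution σ α β T) (x : L) :
    ContDiffOn ℝ ∞ (chartForm (connForm α β) x) (extChartAt (𝓡 3) x).target :=
  contDiffOn_clm_apply.2 fun _ => contDiffOn_matrix fun i j =>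
    (ofRealCLM.contDiff.comp_contDiffOn ((h.smooth_α i j x).clm_apply contDiffOn_const)).add
      (contDiffOn_const.mul
        (ofRealCLM.contDiff.comp_contDiffOn ((h.smooth_β i j x).clm_apply contDiffOn_const)))

variable [IsManifold (𝓡 3) ∞ L]

theorem contDiffOn_gauge_apply (h : S.IsLagrangianSolution σ α β T) (x : L) (i j : Fin 3) :
    ContDiffOn ℝ ∞ (fun y => T ((extChartAt (𝓡 3) x).symm y) i j) (extChartAt (𝓡 3) x).target :=
  contMDiffOn_iff_contDiffOn.1
    ((h.smooth_T i j).comp_contMDiffOn (contMDiffOn_extChartAt_symm (n := ∞) x))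

theorem contDiffOn_gauge (h : S.IsLagrangianSolution σ α β T) (x : L) :
    ContDiffOn ℝ ∞ (fun y => T ((extChartAt (𝓡 3) x).symm y)) (extChartAt (𝓡 3) x).target :=
  contDiffOn_matrix (h.contDiffOn_gauge_apply x)

theorem contDiffOn_conjTranspose_gauge (h : S.IsLagrangianSolution σ α β T) (x : L) :
    ContDiffOn ℝ ∞ (fun y => (T ((extChartAt (𝓡 3) x).symm y))ᴴ) (extChartAt (𝓡 3) x).target :=
  contDiffOn_matrix fun i j => conjCLE.contDiff.comp_contDiffOn (h.contDiffOn_gauge_apply x j i)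

theorem chartForm_derivForm (h : S.IsLagrangianSolution σ α β T) (x : L)
    {y : EuclideanSpace ℝ (Fin 3)} (hy : y ∈ (extChartAt (𝓡 3) x).target)
    (v : EuclideanSpace ℝ (Fin 3)) :
    chartForm (derivForm T) x y v = fderiv ℝ (fun y => T ((extChartAt (𝓡 3) x).symm y)) y v := by
  have : IsManifold (𝓡 3) 1 L := IsManifold.of_le (n := ∞) one_le_infty
  have hn := (isOpen_extChartAt_target (I := 𝓡 3) x).mem_nhds hy
  ext i j
  rw [fderiv_matrix_apply (((h.contDiffOn_gauge x).contDiffAt hn).differentiableAt (by simp))]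
  have h1 : HasModelDerivAt (fun z => T z i j) ((extChartAt (𝓡 3) x).symm y)
      (modelDeriv (fun z => T z i j) ((extChartAt (𝓡 3) x).symm y) :
        EuclideanSpace ℝ (Fin 3) →L[ℝ] ℂ) :=
    MDifferentiableAt.hasModelDerivAt ((h.smooth_T i j _).mdifferentiableAt (by simp))
  have h2 := hasModelDerivAt_iff_hasFDerivAt.1 (h1.comp (hasModelDerivAt_extChartAt_symm hy))
  rw [h2.fderiv]
  rfl

theorem chartForm_gaugeForm (h : S.IsLagrangianSolution σ α β T) (x : L)
    {y : EuclideanSpace ℝ (Fin 3)} (hy : y ∈ (extChartAt (𝓡 3) x).target)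
    (v : EuclideanSpace ℝ (Fin 3)) :
    chartForm (gaugeForm α β T) x y v =
      T ((extChartAt (𝓡 3) x).symm y) * chartForm (connForm α β) x y v
          * (T ((extChartAt (𝓡 3) x).symm y))ᴴ
        - fderiv ℝ (fun y => T ((extChartAt (𝓡 3) x).symm y)) y v
          * (T ((extChartAt (𝓡 3) x).symm y))ᴴ := by
  rw [← h.chartForm_derivForm x hy]
  rfl

theorem contDiffOn_solderForm (h : S.IsLagrangianSolution σ α β T) (x : L) :
    ContDiffOn ℝ ∞ (chartForm (solderForm σ T) x) (extChartAt (𝓡 3) x).target :=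
  contDiffOn_clm_apply.2 fun _ =>
    (mulVecCLM.contDiff.comp_contDiffOn (h.contDiffOn_gauge x)).clm_apply
    ((h.contDiffOn_vecForm x).clm_apply contDiffOn_const)

theorem contDiffOn_gaugeForm (h : S.IsLagrangianSolution σ α β T) (x : L) :
    ContDiffOn ℝ ∞ (chartForm (gaugeForm α β T) x) (extChartAt (𝓡 3) x).target := by
  refine contDiffOn_clm_apply.2 fun v => ContDiffOn.congr ?_ fun y hy =>
    h.chartForm_gaugeForm x hy v
  have h1 := (h.contDiffOn_gauge x).fderiv_of_isOpen (m := ∞)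
    (isOpen_extChartAt_target (I := 𝓡 3) x) (by simp)
  exact (((h.contDiffOn_gauge x).mul ((h.contDiffOn_connForm x).clm_apply contDiffOn_const)).mul
    (h.contDiffOn_conjTranspose_gauge x)).sub
    ((h1.clm_apply contDiffOn_const).mul (h.contDiffOn_conjTranspose_gauge x))

theorem contDiffOn_cartanForm (h : S.IsLagrangianSolution σ α β T) (x : L) :
    ContDiffOn ℝ ∞ (chartForm (S.cartanForm σ α β T) x) (extChartAt (𝓡 3) x).target :=
  contDiffOn_clm_apply.2 fun _ => S.ofComponents.contDiff.comp_contDiffOn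
    (((h.contDiffOn_solderForm x).clm_apply contDiffOn_const).prodMk
      ((h.contDiffOn_gaugeForm x).clm_apply contDiffOn_const))

theorem eq₁_apply (h : S.IsLagrangianSolution σ α β T) (i : Fin 3) (x : L)
    (v w : TangentSpace (𝓡 3) x) : ∑ j, (β i j x v * σ j x w - β i j x w * σ j x v) = 0 := by
  have h1 := congrFun (congrFun (congrFun (h.eq₁ i) x) v) w
  simpa only [Finset.sum_apply, wedge, Pi.zero_apply] using h1

theorem eq₂_apply (h : S.IsLagrangianSolution σ α β T) (i : Fin 3) (x : L)
    (v w : TangentSpace (𝓡 3) x) :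
    (σ i).d x v w = -∑ j, (α i j x v * σ j x w - α i j x w * σ j x v) - 1 / 2 * ∑ j,
      ((!![0, σ 2 x v, -σ 1 x v; -σ 2 x v, 0, σ 0 x v; σ 1 x v, -σ 0 x v, 0] :
          Matrix (Fin 3) (Fin 3) ℝ) i j * σ j x w
        - (!![0, σ 2 x w, -σ 1 x w; -σ 2 x w, 0, σ 0 x w; σ 1 x w, -σ 0 x w, 0] :
          Matrix (Fin 3) (Fin 3) ℝ) i j * σ j x v) := by
  have h1 := congrFun (congrFun (congrFun (h.eq₂ i) x) v) w
  simpa only [Finset.sum_apply, wedge, Pi.sub_apply, Pi.neg_apply, Pi.smul_apply, smul_eq_mul,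
    bracket_apply] using h1

theorem eq₃_apply (h : S.IsLagrangianSolution σ α β T) (i j : Fin 3) (x : L)
    (v w : TangentSpace (𝓡 3) x) :
    (α i j).d x v w = -∑ k, (α i k x v * α k j x w - α i k x w * α k j x v)
      + ∑ k, (β i k x v * β k j x w - β i k x w * β k j x v)
      + (S.curvatureForm σ T i j x v w).re := by
  have h1 := congrFun (congrFun (congrFun (h.eq₃ i j) x) v) w
  simpa only [Finset.sum_apply, wedge, Pi.sub_apply, Pi.neg_apply, Pi.add_apply, Rσσ,
    sub_neg_eq_add]
    using h1

theorem eq₄_apply (h : S.IsLagrangianSolution σ α β T) (i j : Fin 3) (x : L)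
    (v w : TangentSpace (𝓡 3) x) :
    (β i j).d x v w = -∑ k, (β i k x v * α k j x w - β i k x w * α k j x v)
      - ∑ k, (α i k x v * β k j x w - α i k x w * β k j x v)
      + (S.curvatureForm σ T i j x v w).im := by
  have h1 := congrFun (congrFun (congrFun (h.eq₄ i j) x) v) w
  simpa only [Finset.sum_apply, wedge, Pi.sub_apply, Pi.neg_apply, Sσσ, sub_neg_eq_add] using h1

/-- The first structure equation: `dσ + φ ∧ σ = conj (σ × σ)`. -/
theorem fderiv_vecForm (h : S.IsLagrangianSolution σ α β T) (x : L)
    (v w : EuclideanSpace ℝ (Fin 3)) :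
    fderiv ℝ (chartForm (vecForm σ) x) (extChartAt (𝓡 3) x x) v w
      - fderiv ℝ (chartForm (vecForm σ) x) (extChartAt (𝓡 3) x x) w v
      + (connForm α β x v *ᵥ vecForm σ x w - connForm α β x w *ᵥ vecForm σ x v
        - conjCross (vecForm σ x v) (vecForm σ x w)) = 0 := by
  have hd := ((h.contDiffOn_vecForm x).contDiffAt
    (extChartAt_target_mem_nhds x)).differentiableAt (by simp)
  have hE : ∀ v w i, fderiv ℝ (chartForm (vecForm σ) x) (extChartAt (𝓡 3) x x) v w i =
      (fderiv ℝ ((σ i).inChart x) (extChartAt (𝓡 3) x x) v w : ℂ) := fun v w i => by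
    have hσ := ((h.smooth_σ i x).contDiffAt (extChartAt_target_mem_nhds x)).differentiableAt
      (by simp)
    have h1 := hd.map_fderiv_apply (P := ContinuousLinearMap.proj (R := ℝ) (φ := fun _ => ℂ) i)
      (ξ := fun y => ofRealCLM.comp ((σ i).inChart x y)) (Eventually.of_forall fun _ _ => rfl) v w
    have h2 := hσ.map_fderiv_apply (P := ofRealCLM)
      (ξ := fun y => ofRealCLM.comp ((σ i).inChart x y)) (Eventually.of_forall fun _ _ => rfl) v w
    exact h1.trans h2.symm
  ext i
  have h1 := congrArg (fun t : ℝ => (t : ℂ)) (h.eq₁_apply i x v w)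
  have h2 := congrArg (fun t : ℝ => (t : ℂ)) ((d_apply _ x v w).symm.trans (h.eq₂_apply i x v w))
  simp only [Pi.add_apply, Pi.sub_apply, hE, conjCross, Matrix.mulVec, dotProduct, vecForm_apply,
    connForm_apply, Fin.sum_univ_three] at h1 h2 ⊢
  push_cast at h1 h2
  rw [h2]
  -- As [σ(v)]σ(w) = -σ(v) × σ(w), the bracket terms of the equation for dσ give the cross product,
  -- with no conjugation on real vectors. What remains is i times β ∧ σ = 0.
  fin_cases i <;>
  · simp [crossProduct, vecForm_apply] at h1 ⊢
    linear_combination I * h1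

/-- The second structure equation: `dφ + φ ∧ φ` is the curvature. -/
theorem fderiv_connForm (h : S.IsLagrangianSolution σ α β T) (x : L)
    (v w : EuclideanSpace ℝ (Fin 3)) :
    fderiv ℝ (chartForm (connForm α β) x) (extChartAt (𝓡 3) x x) v w
      - fderiv ℝ (chartForm (connForm α β) x) (extChartAt (𝓡 3) x x) w v
      + (connForm α β x v * connForm α β x w - connForm α β x w * connForm α β x v) =
    Matrix.of fun i j => S.curvatureForm σ T i j x v w := by
  have hd := ((h.contDiffOn_connForm x).contDiffAt
    (extChartAt_target_mem_nhds x)).differentiableAt (by simp)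
  have hE : ∀ v w i j, fderiv ℝ (chartForm (connForm α β) x) (extChartAt (𝓡 3) x x) v w i j =
      (fderiv ℝ ((α i j).inChart x) (extChartAt (𝓡 3) x x) v w : ℂ)
        + I * (fderiv ℝ ((β i j).inChart x) (extChartAt (𝓡 3) x x) v w : ℂ) := fun v w i j => by
    have hα := ((h.smooth_α i j x).contDiffAt (extChartAt_target_mem_nhds x)).differentiableAt
      (by simp)
    have hβ := ((h.smooth_β i j x).contDiffAt (extChartAt_target_mem_nhds x)).differentiableAt
      (by simp)
    have h1 := hd.map_fderiv_apply (P := entryCLM i j)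
      (ξ := fun y => ofRealCLM.comp ((α i j).inChart x y)
        + I • ofRealCLM.comp ((β i j).inChart x y)) (Eventually.of_forall fun _ _ => rfl) v w
    have h2 := hα.map_fderiv_apply (P := ofRealCLM)
      (ξ := fun y => ofRealCLM.comp ((α i j).inChart x y)) (Eventually.of_forall fun _ _ => rfl) v w
    have h3 := hβ.map_fderiv_apply (P := I • ofRealCLM)
      (ξ := fun y => I • ofRealCLM.comp ((β i j).inChart x y))
      (Eventually.of_forall fun _ _ => rfl) v w
    rw [entryCLM_apply] at h1
    rw [h1, fderiv_fun_add (by fun_prop) (by fun_prop)]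
    exact congrArg₂ (· + ·) h2.symm h3.symm
  ext i j
  have h3 := congrArg (fun t : ℝ => (t : ℂ)) ((d_apply _ x v w).symm.trans (h.eq₃_apply i j x v w))
  have h4 := congrArg (fun t : ℝ => I * (t : ℂ))
    ((d_apply _ x v w).symm.trans (h.eq₄_apply i j x v w))
  have hre := re_add_im (S.curvatureForm σ T i j x v w)
  simp only [Fin.sum_univ_three] at h3 h4
  push_cast at h3 h4
  simp only [Matrix.add_apply, Matrix.sub_apply, hE, Matrix.mul_apply, Fin.sum_univ_three,
    Matrix.of_apply, connForm_apply]
  -- The equation for dα plus i times the one for dβ; i² = -1 accounts for the sign of β ∧ β.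
  linear_combination (exp := 1) h3 + h4 + hre + (β i 0 x v * β 0 j x w + β i 1 x v * β 1 j x w
    + β i 2 x v * β 2 j x w - β i 0 x w * β 0 j x v - β i 1 x w * β 1 j x v
    - β i 2 x w * β 2 j x v : ℂ) * I_sq

/-- In d(Tσ) = dT ∧ σ + T dσ the first term cancels against the -dT T⁻¹ of the gauge form, and T
commutes with `conjCross` because it is special unitary. -/
theorem fderiv_solderForm (h : S.IsLagrangianSolution σ α β T) (x : L)
    (v w : EuclideanSpace ℝ (Fin 3)) :
    fderiv ℝ (chartForm (solderForm σ T) x) (extChartAt (𝓡 3) x x) v w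
      - fderiv ℝ (chartForm (solderForm σ T) x) (extChartAt (𝓡 3) x x) w v
      + (gaugeForm α β T x v *ᵥ solderForm σ T x w - gaugeForm α β T x w *ᵥ solderForm σ T x v
        - conjCross (solderForm σ T x v) (solderForm σ T x w)) = 0 := by
  have : IsManifold (𝓡 3) 1 L := IsManifold.of_le (n := ∞) one_le_infty
  have hn := extChartAt_target_mem_nhds (I := 𝓡 3) x
  have ht := ((h.contDiffOn_gauge x).contDiffAt hn).differentiableAt (by simp)
  have hs := ((h.contDiffOn_vecForm x).contDiffAt hn).differentiableAt (by simp)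
  have hξ := ((h.contDiffOn_solderForm x).contDiffAt hn).differentiableAt (by simp)
  have hE : ∀ v w, fderiv ℝ (chartForm (solderForm σ T) x) (extChartAt (𝓡 3) x x) v w =
      derivForm T x v *ᵥ vecForm σ x w
        + T x *ᵥ fderiv ℝ (chartForm (vecForm σ) x) (extChartAt (𝓡 3) x x) v w := fun v w => by
    have h1 := hξ.hasFDerivAt.clm_apply (hasFDerivAt_const w _)
    have h2 := mulVecCLM.hasFDerivAt_of_bilinear ht.hasFDerivAt
      (hs.hasFDerivAt.clm_apply (hasFDerivAt_const w _))
    have h3 := congrArg (fun f => f v) (h1.unique h2)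
    have h4 := h.chartForm_derivForm x (mem_extChartAt_target x) v
    simp only [ContinuousLinearMap.flip_apply, ContinuousLinearMap.comp_zero, zero_add, add_apply,
      ContinuousLinearMap.precompR_apply, ContinuousLinearMap.precompL_apply, mulVecCLM_apply,
      extChartAt_to_inv, ← h4, chartForm_self] at h3
    rw [h3, add_comm]
    rfl
  have hs0 := congrArg (T x *ᵥ ·) (h.fderiv_vecForm x v w)
  have hTT : ∀ z, (T x)ᴴ *ᵥ (T x *ᵥ z) = z := fun z => by
    rw [Matrix.mulVec_mulVec, h.conjTranspose_mul, Matrix.one_mulVec]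
  rw [hE, hE]
  simp only [gaugeForm_apply, solderForm_apply, conjCross_mulVec (h.gauge_mem x),
    Matrix.sub_mulVec, ← Matrix.mulVec_mulVec, hTT]
  simp only [Matrix.mulVec_add, Matrix.mulVec_sub, Matrix.mulVec_zero] at hs0
  rw [← hs0]
  abel

/-- The curvature of φ is expressed in the basis of columns of T; the gauge transformation
conjugates it back by T to minus the isotropy matrix of [X, Y]. -/
theorem fderiv_gaugeForm (hS : S.IsNearlyKahler) (h : S.IsLagrangianSolution σ α β T) (x : L)
    (v w : EuclideanSpace ℝ (Fin 3)) :
    fderiv ℝ (chartForm (gaugeForm α β T) x) (extChartAt (𝓡 3) x x) v w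
      - fderiv ℝ (chartForm (gaugeForm α β T) x) (extChartAt (𝓡 3) x x) w v
      + (gaugeForm α β T x v * gaugeForm α β T x w - gaugeForm α β T x w * gaugeForm α β T x v) =
    -S.isotropy ⁅S.b (solderForm σ T x v), S.b (solderForm σ T x w)⁆ := by
  have : IsManifold (𝓡 3) 1 L := IsManifold.of_le (n := ∞) one_le_infty
  have : CompleteSpace E := FiniteDimensional.complete ℝ E
  have hn := extChartAt_target_mem_nhds (I := 𝓡 3) x
  have h1 := gauge_curvature (n := chartForm (gaugeForm α β T) x)
    (((h.contDiffOn_gauge x).contDiffAt hn).of_le two_le_infty)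
    (((h.contDiffOn_conjTranspose_gauge x).contDiffAt hn).differentiableAt (by simp))
    (((h.contDiffOn_connForm x).contDiffAt hn).differentiableAt (by simp))
    (((h.contDiffOn_gaugeForm x).contDiffAt hn).differentiableAt (by simp))
    (fun y => h.mul_conjTranspose _) (fun y => h.conjTranspose_mul _)
    (mem_of_superset hn fun y hy => h.chartForm_gaugeForm x hy) v w
  rw [chartForm_self, chartForm_self, extChartAt_to_inv, h.fderiv_connForm] at h1
  rw [h1]
  have hc : (Matrix.of fun i j => S.curvatureForm σ T i j x v w) =
      -((T x)ᴴ * (S.isotropy ⁅S.b (solderForm σ T x v), S.b (solderForm σ T x w)⁆ * T x)) := by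
    ext i j
    change ((T x)ᴴ *ᵥ S.curvature (solderForm σ T x v) (solderForm σ T x w)
      (fun k => T x k j)) i = _
    rw [hS.curvature_eq, Matrix.mulVec_neg]
    rfl
  rw [hc, mul_neg, neg_mul, ← mul_assoc, ← mul_assoc, h.mul_conjTranspose, one_mul, mul_assoc,
    h.mul_conjTranspose, mul_one]

theorem maurerCartanEq_cartanForm (hS : S.IsNearlyKahler) (h : S.IsLagrangianSolution σ α β T)
    (x : L) : MaurerCartanEq G (chartForm (S.cartanForm σ α β T) x (extChartAt (𝓡 3) x x))
      (fderiv ℝ (chartForm (S.cartanForm σ α β T) x) (extChartAt (𝓡 3) x x)) := by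
  have : IsManifold (𝓡 3) 1 L := IsManifold.of_le (n := ∞) one_le_infty
  refine hS.maurerCartanEq_of_components (ξ := chartForm (solderForm σ T) x)
    (n := chartForm (gaugeForm α β T) x)
    (((h.contDiffOn_cartanForm x).contDiffAt
      (extChartAt_target_mem_nhds x)).differentiableAt (by simp))
    (Eventually.of_forall fun y v => h.ζCLM_cartanForm _ _)
    (Eventually.of_forall fun y v => h.isotropyCLM_cartanForm _ _) (fun v w => ?_) fun v w => ?_
  · rw [chartForm_self, chartForm_self]
    exact h.fderiv_solderForm x v w
  · rw [chartForm_self, chartForm_self]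
    exact h.fderiv_gaugeForm hS x v w

end IsLagrangianSolution

end InvariantSU3Structure

end CartanForm

/-! ### Invariance of the flat tensors under SU(3). -/

section SpecialUnitaryInvariance

open FlatModel

namespace FlatModel

variable {U : Matrix (Fin 3) (Fin 3) ℂ}

theorem inner_mulVec (hU : U ∈ Matrix.specialUnitaryGroup (Fin 3) ℂ) (u v : Fin 3 → ℂ) :
    inner (U *ᵥ u) (U *ᵥ v) = inner u v := by
  have h : Uᴴ * U = 1 := Matrix.mem_unitaryGroup_iff'.1 (Matrix.mem_specialUnitaryGroup_iff.1 hU).1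
  rw [inner, inner, Matrix.star_mulVec, Matrix.dotProduct_mulVec, Matrix.vecMul_vecMul, h,
    Matrix.vecMul_one]

theorem kahler_mulVec (hU : U ∈ Matrix.specialUnitaryGroup (Fin 3) ℂ) (u v : Fin 3 → ℂ) :
    kahler (U *ᵥ u) (U *ᵥ v) = kahler u v := by
  rw [kahler, ← Matrix.mulVec_smul, inner_mulVec hU, kahler]

theorem psi_mulVec (hU : U ∈ Matrix.specialUnitaryGroup (Fin 3) ℂ) (u v w : Fin 3 → ℂ) :
    psi (U *ᵥ u) (U *ᵥ v) (U *ᵥ w) = psi u v w := by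
  have h : Matrix.of ![U *ᵥ u, U *ᵥ v, U *ᵥ w] = Matrix.of ![u, v, w] * Uᵀ := by
    ext i j
    fin_cases i <;> simp [Matrix.mul_apply, Matrix.mulVec, dotProduct, mul_comm]
  rw [psi, h, Matrix.det_mul, Matrix.det_transpose, (Matrix.mem_specialUnitaryGroup_iff.1 hU).2,
    mul_one, psi]

end FlatModel

end SpecialUnitaryInvariance

/-! ### Frames and invariant tensors of `M = G/H`. -/

section HomogeneousSpace

open FlatModel

variable {E : Type*} [NormedAddCommGroup E] [NormedSpace ℝ E] [FiniteDimensional ℝ E]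
  {G : Type*} [TopologicalSpace G] [ChartedSpace E G] [Group G] [LieGroup 𝓘(ℝ, E) ∞ G]
  {M : Type*} [TopologicalSpace M] [ChartedSpace (EuclideanSpace ℝ (Fin 6)) M]
  [MulAction G M] [ContMDiffSMul 𝓘(ℝ, E) (𝓡 6) ∞ G M]

/-- The derivative at `1` of `h ↦ (g h) • o`, between the model spaces. -/
noncomputable def orbitLie (o : M) (g : G) : E →L[ℝ] EuclideanSpace ℝ (Fin 6) :=
  modelDeriv (fun h : G => (g * h) • o) 1

theorem contMDiff_smul_point (E : Type*) [NormedAddCommGroup E] [NormedSpace ℝ E] {G : Type*}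
    [TopologicalSpace G] [ChartedSpace E G] [Group G] {M : Type*} [TopologicalSpace M]
    [ChartedSpace (EuclideanSpace ℝ (Fin 6)) M] [MulAction G M]
    [ContMDiffSMul 𝓘(ℝ, E) (𝓡 6) ∞ G M] (a : G) :
    ContMDiff (𝓡 6) (𝓡 6) ∞ fun p : M => a • p :=
  (contMDiff_const (I' := 𝓘(ℝ, E))).smul contMDiff_id

theorem hasModelDerivAt_smul (E : Type*) [NormedAddCommGroup E] [NormedSpace ℝ E] {G : Type*}
    [TopologicalSpace G] [ChartedSpace E G] [Group G] {M : Type*} [TopologicalSpace M]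
    [ChartedSpace (EuclideanSpace ℝ (Fin 6)) M] [MulAction G M]
    [ContMDiffSMul 𝓘(ℝ, E) (𝓡 6) ∞ G M] (a : G) (p : M) :
    HasModelDerivAt (fun p : M => a • p) p (modelDeriv (fun p : M => a • p) p :
      EuclideanSpace ℝ (Fin 6) →L[ℝ] EuclideanSpace ℝ (Fin 6)) :=
  MDifferentiableAt.hasModelDerivAt
    ((contMDiff_smul_point E a p).mdifferentiableAt (by simp))

theorem contMDiff_orbit (o : M) : ContMDiff 𝓘(ℝ, E) (𝓡 6) ∞ fun h : G => h • o :=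
  contMDiff_id.smul contMDiff_const

theorem hasModelDerivAt_orbit (o : M) (g : G) :
    HasModelDerivAt (fun h : G => h • o) g (modelDeriv (fun h : G => h • o) g :
      E →L[ℝ] EuclideanSpace ℝ (Fin 6)) :=
  MDifferentiableAt.hasModelDerivAt
    ((contMDiff_orbit o g).mdifferentiableAt (by simp))

theorem orbitLie_eq_comp_leftDeriv (o : M) (g : G) :
    orbitLie o g = (modelDeriv (fun h : G => h • o) g : E →L[ℝ] EuclideanSpace ℝ (Fin 6)).comp
      (leftDeriv g 1 : E →L[ℝ] E) := by
  have h : HasModelDerivAt (fun h : G => h • o) (g * 1) (modelDeriv (fun h : G => h • o) g :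
      E →L[ℝ] EuclideanSpace ℝ (Fin 6)) := by
    rw [mul_one]; exact hasModelDerivAt_orbit o g
  exact (h.comp (hasModelDerivAt_mul_left g 1)).modelDeriv_eq

theorem hasModelDerivAt_orbitLie (o : M) (g : G) :
    HasModelDerivAt (fun h : G => (g * h) • o) 1
      (orbitLie o g : E →L[ℝ] EuclideanSpace ℝ (Fin 6)) := by
  have h : HasModelDerivAt (fun h : G => h • o) (g * 1) (modelDeriv (fun h : G => h • o) g :
      E →L[ℝ] EuclideanSpace ℝ (Fin 6)) := by
    rw [mul_one]; exact hasModelDerivAt_orbit o g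
  rw [orbitLie_eq_comp_leftDeriv]
  exact h.comp (hasModelDerivAt_mul_left g 1)

theorem orbitLie_mul (o : M) (a g : G) :
    (orbitLie o (a * g) : E →L[ℝ] EuclideanSpace ℝ (Fin 6)) =
      (modelDeriv (fun p : M => a • p) (g • o) :
        EuclideanSpace ℝ (Fin 6) →L[ℝ] EuclideanSpace ℝ (Fin 6)).comp (orbitLie o g) := by
  have h : HasModelDerivAt (fun p : M => a • p) ((g * 1) • o)
      (modelDeriv (fun p : M => a • p) (g • o) :
        EuclideanSpace ℝ (Fin 6) →L[ℝ] EuclideanSpace ℝ (Fin 6)) := by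
    rw [mul_one]; exact hasModelDerivAt_smul E a _
  have h1 := (h.comp (ψ := fun k : G => (g * k) • o)
    (hasModelDerivAt_orbitLie (E := E) o g)).modelDeriv_eq
  rw [← h1, orbitLie]
  congr 1
  ext k
  rw [mul_assoc, mul_smul]

theorem modelDeriv_smul_injective (E : Type*) [NormedAddCommGroup E] [NormedSpace ℝ E] {G : Type*}
    [TopologicalSpace G] [ChartedSpace E G] [Group G] {M : Type*} [TopologicalSpace M]
    [ChartedSpace (EuclideanSpace ℝ (Fin 6)) M] [MulAction G M]
    [ContMDiffSMul 𝓘(ℝ, E) (𝓡 6) ∞ G M] (a : G) (p : M) :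
    Function.Injective (modelDeriv (fun p : M => a • p) p :
      EuclideanSpace ℝ (Fin 6) →L[ℝ] EuclideanSpace ℝ (Fin 6)) := by
  have h1 := (hasModelDerivAt_smul E a⁻¹ (a • p)).comp (hasModelDerivAt_smul E a p)
  simp only [inv_smul_smul] at h1
  have h2 := h1.unique (hasModelDerivAt_id p)
  exact Function.LeftInverse.injective fun v => congrArg (fun f => f v) h2

/-- By equivariance the derivative at `g` is that at 1 followed by an isomorphism, so its kernel is
𝔥 for every `g`. -/
theorem orbitLie_eq_zero_iff (o : M) (g : G) (X : E) :
    orbitLie o g X = 0 ↔ orbitLie o (1 : G) X = 0 := by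
  have h := orbitLie_mul (E := E) o g 1
  rw [mul_one] at h
  rw [h]
  exact map_eq_zero_iff _ (modelDeriv_smul_injective E g _)

/-- Since h⁻¹ fixes o, (ghk) · o = g(hkh⁻¹) · o: changing the frame by `h` amounts to applying
Ad(h). -/
theorem orbitLie_mul_of_mem_stabilizer {o : M} {h : G} (hh : h ∈ MulAction.stabilizer G o) (g : G)
    (X : E) : orbitLie o (g * h) X =
      orbitLie o g ((modelDeriv (fun k : G => h * k * h⁻¹) 1 : E →L[ℝ] E) X) := by
  have hc : ContMDiff 𝓘(ℝ, E) 𝓘(ℝ, E) ∞ fun k : G => h * k * h⁻¹ :=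
    (contMDiff_const.mul contMDiff_id).mul contMDiff_const
  have h1 : HasModelDerivAt (fun k : G => h * k * h⁻¹) 1
      (modelDeriv (fun k : G => h * k * h⁻¹) 1 : E →L[ℝ] E) :=
    MDifferentiableAt.hasModelDerivAt ((hc 1).mdifferentiableAt (by simp))
  have h2 : HasModelDerivAt (fun k : G => (g * k) • o) (h * 1 * h⁻¹)
      (orbitLie o g : E →L[ℝ] _) := by
    rw [mul_one, mul_inv_cancel]; exact hasModelDerivAt_orbitLie o g
  have h3 := (h2.comp (ψ := fun k : G => h * k * h⁻¹) h1).modelDeriv_eq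
  have h4 : (fun k : G => (g * (h * k * h⁻¹)) • o) = fun k : G => (g * h * k) • o := by
    ext k
    have : h⁻¹ • o = o := inv_mem hh
    simp only [mul_smul, this]
  rw [h4] at h3
  exact congrArg (fun f => f X) h3

namespace InvariantSU3Structure

variable (S : InvariantSU3Structure (E := E) G M)

/-- The inclusion of `𝔪 ≅ ℂ³` in the model space of `G`. -/
noncomputable def bModel : (Fin 3 → ℂ) →ₗ[ℝ] E := S.b

/-- The frame of `M` given by `g`, with values in the model space. -/
noncomputable def frameModel (g : G) : (Fin 3 → ℂ) →ₗ[ℝ] EuclideanSpace ℝ (Fin 6) :=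
  (orbitLie S.o g : E →L[ℝ] EuclideanSpace ℝ (Fin 6)).toLinearMap ∘ₗ S.bModel

theorem frameModel_apply (g : G) (z : Fin 3 → ℂ) :
    S.frameModel g z = (orbitLie S.o g : E →L[ℝ] _) (S.bModel z) := rfl

theorem ζCLM_bModel (z : Fin 3 → ℂ) : S.ζCLM (S.bModel z) = z := S.ζ_b z

theorem frame_eq_frameModel (g : G) (z : Fin 3 → ℂ) : S.frame g z = S.frameModel g z := by
  rw [frameModel_apply, orbitLie_eq_comp_leftDeriv]
  rfl

theorem orbitLie_one_eq_zero_iff (X : E) : orbitLie S.o (1 : G) X = 0 ↔ S.ζCLM X = 0 := by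
  rw [orbitLie_eq_comp_leftDeriv, leftDeriv_one_left]
  exact (S.ζ_eq_zero_iff X).symm

theorem orbitLie_eq_frameModel (g : G) (X : E) :
    orbitLie S.o g X = S.frameModel g (S.ζCLM X) := by
  rw [← sub_eq_zero, frameModel_apply, ← map_sub, orbitLie_eq_zero_iff,
    orbitLie_one_eq_zero_iff, map_sub, ζCLM_bModel, sub_self]

theorem frameModel_injective (g : G) : Function.Injective (S.frameModel g) := by
  refine (injective_iff_map_eq_zero _).2 fun z hz => ?_
  rwa [frameModel_apply, orbitLie_eq_zero_iff, orbitLie_one_eq_zero_iff, ζCLM_bModel] at hz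

/-- An injective map between real vector spaces of dimension 6. -/
theorem frameModel_surjective (g : G) : Function.Surjective (S.frameModel g) := by
  refine (LinearMap.injective_iff_surjective_of_finrank_eq_finrank ?_).1 (S.frameModel_injective g)
  simp [Module.finrank_pi_fintype, Complex.finrank_real_complex]

theorem frameModel_mul (a g : G) (z : Fin 3 → ℂ) : S.frameModel (a * g) z =
    (modelDeriv (fun p : M => a • p) (g • S.o) :
      EuclideanSpace ℝ (Fin 6) →L[ℝ] EuclideanSpace ℝ (Fin 6)) (S.frameModel g z) := by
  rw [frameModel_apply, orbitLie_mul]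
  rfl

variable [MulAction.IsPretransitive G M]

theorem rep_smul (p : M) : S.rep p • S.o = p := (MulAction.exists_smul_eq G S.o p).choose_spec

theorem coords_frameModel_rep (p : M) (z : Fin 3 → ℂ) :
    S.coords p (S.frameModel (S.rep p) z) = z := by
  have h : ∃ w, (S.frame (S.rep p) w : EuclideanSpace ℝ (Fin 6)) = S.frameModel (S.rep p) z :=
    ⟨z, S.frame_eq_frameModel _ z⟩
  have h1 := Classical.epsilon_spec h
  rw [frame_eq_frameModel] at h1
  exact S.frameModel_injective _ h1

/-- The coordinates in any adapted frame differ by a special unitary transformation from those used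
in the definition of the invariant tensors. -/
theorem exists_coords_frameModel {p : M} {g : G} (hg : g • S.o = p) :
    ∃ U ∈ Matrix.specialUnitaryGroup (Fin 3) ℂ, ∀ z, S.coords p (S.frameModel g z) = U *ᵥ z := by
  -- Two frames over `p` differ by an element of the stabiliser, which acts on 𝔪 by a special
  -- unitary matrix.
  have hh : (S.rep p)⁻¹ * g ∈ MulAction.stabilizer G S.o := by
    rw [MulAction.mem_stabilizer_iff, mul_smul, hg, inv_smul_eq_iff, S.rep_smul]
  obtain ⟨U, hU, h⟩ := S.Ad_mem _ hh
  refine ⟨U, hU, fun z => ?_⟩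
  have h1 := orbitLie_mul_of_mem_stabilizer hh (S.rep p) (S.bModel z)
  have h2 : (modelDeriv (fun k : G => (S.rep p)⁻¹ * g * k * ((S.rep p)⁻¹ * g)⁻¹) 1 : E →L[ℝ] E)
      (S.bModel z) = S.bModel (U *ᵥ z) := h z
  rw [mul_inv_cancel_left, h2] at h1
  exact (congrArg (S.coords p) h1).trans (S.coords_frameModel_rep p _)

theorem metric_frameModel {p : M} {g : G} (hg : g • S.o = p) (u v : Fin 3 → ℂ) :
    S.metric p (S.frameModel g u) (S.frameModel g v) = FlatModel.inner u v := by
  obtain ⟨U, hU, h⟩ := S.exists_coords_frameModel hg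
  exact (congrArg₂ FlatModel.inner (h u) (h v)).trans (inner_mulVec hU u v)

theorem kahlerForm_frameModel {p : M} {g : G} (hg : g • S.o = p) (u v : Fin 3 → ℂ) :
    S.kahlerForm p (S.frameModel g u) (S.frameModel g v) = kahler u v := by
  obtain ⟨U, hU, h⟩ := S.exists_coords_frameModel hg
  exact (congrArg₂ kahler (h u) (h v)).trans (kahler_mulVec hU u v)

theorem volForm_frameModel {p : M} {g : G} (hg : g • S.o = p) (u v w : Fin 3 → ℂ) :
    S.volForm p (S.frameModel g u) (S.frameModel g v) (S.frameModel g w) = psi u v w := by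
  obtain ⟨U, hU, h⟩ := S.exists_coords_frameModel hg
  exact (congr (congrArg₂ psi (h u) (h v)) (h w)).trans (psi_mulVec hU u v w)

/-- `G` acts on `M` by isometries. -/
theorem isIsometry_smul (a : G) : S.IsIsometry fun p => a • p where
  bijective := MulAction.bijective a
  smooth := contMDiff_smul_point E a
  metric_eq p v w := by
    obtain ⟨z, rfl⟩ := S.frameModel_surjective (S.rep p) v
    obtain ⟨z', rfl⟩ := S.frameModel_surjective (S.rep p) w
    have h : ∀ z, (modelDeriv (fun p : M => a • p) p :
        EuclideanSpace ℝ (Fin 6) →L[ℝ] EuclideanSpace ℝ (Fin 6)) (S.frameModel (S.rep p) z) =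
        S.frameModel (a * S.rep p) z := fun z => by
      rw [frameModel_mul, S.rep_smul]
    have h1 : S.metric (a • p)
        ((modelDeriv (fun p : M => a • p) p :
          EuclideanSpace ℝ (Fin 6) →L[ℝ] EuclideanSpace ℝ (Fin 6)) (S.frameModel (S.rep p) z))
        ((modelDeriv (fun p : M => a • p) p :
          EuclideanSpace ℝ (Fin 6) →L[ℝ] EuclideanSpace ℝ (Fin 6)) (S.frameModel (S.rep p) z')) =
        FlatModel.inner z z' := by
      rw [h, h, S.metric_frameModel (by rw [mul_smul, S.rep_smul])]
    exact h1.trans (S.metric_frameModel (S.rep_smul p) z z').symm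

end InvariantSU3Structure

end HomogeneousSpace

/-! ### The Levi-Civita connection along an adapted lift. -/

section Immersions

open FlatModel Filter OneForm InvariantSU3Structure Set
open scoped Topology

attribute [local instance] Matrix.linftyOpNormedRing Matrix.linftyOpNormedAlgebra
attribute [local instance 2000] linftyOpTopologicalSpace

section Coframes

variable {H : Type*} [NormedAddCommGroup H] [NormedSpace ℝ H] [FiniteDimensional ℝ H]

theorem eq_zero_of_coframe {s : Fin 3 → H →L[ℝ] ℝ} (hs : LinearIndependent ℝ s)
    (hH : Module.finrank ℝ H = 3) {v : H} (h : ∀ i, s i v = 0) : v = 0 := by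
  have h1 : LinearIndependent ℝ fun i => (s i : H →ₗ[ℝ] ℝ) :=
    hs.map' (ContinuousLinearMap.coeLM ℝ) (LinearMap.ker_eq_bot.2 fun _ _ h =>
      ContinuousLinearMap.coe_injective h)
  have h2 := h1.span_eq_top_of_card_eq_finrank' (by
    rw [Subspace.dual_finrank_eq, hH, Fintype.card_fin])
  refine (Module.forall_dual_apply_eq_zero_iff ℝ v).1 fun θ => ?_
  have hθ : θ ∈ Submodule.span ℝ (range fun i => (s i : H →ₗ[ℝ] ℝ)) := h2 ▸ Submodule.mem_top
  induction hθ using Submodule.span_induction with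
  | mem x hx => obtain ⟨i, rfl⟩ := hx; exact h i
  | zero => rfl
  | add x y _ _ hx hy => rw [LinearMap.add_apply, hx, hy, add_zero]
  | smul c x _ hx => rw [LinearMap.smul_apply, hx, smul_zero]

theorem exists_apply_eq_of_coframe {s : Fin 3 → H →L[ℝ] ℝ} (hs : LinearIndependent ℝ s)
    (hH : Module.finrank ℝ H = 3) (z : Fin 3 → ℝ) : ∃ v, ∀ i, s i v = z i := by
  have h1 : Function.Injective (LinearMap.pi fun i => (s i : H →ₗ[ℝ] ℝ)) :=
    (injective_iff_map_eq_zero _).2 fun v hv => eq_zero_of_coframe hs hH fun i => congrFun hv i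
  obtain ⟨v, hv⟩ := (LinearMap.injective_iff_surjective_of_finrank_eq_finrank
    (by rw [hH, Module.finrank_fin_fun])).1 h1 z
  exact ⟨v, fun i => congrFun hv i⟩

end Coframes

/-- A skew symmetric matrix of `1`-forms `κ` with `κ ∧ σ = 0` vanishes. -/
theorem eq_zero_of_skew_of_wedge_eq_zero {V : Type*} {s : V → Fin 3 → ℂ}
    {κ : V → Matrix (Fin 3) (Fin 3) ℂ} (hs : ∀ i, ∃ v, s v = Pi.single i 1)
    (hκ : ∀ v, (κ v)ᵀ = -κ v) (h : ∀ v w, κ v *ᵥ s w = κ w *ᵥ s v) (v : V) : κ v = 0 := by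
  have hskew : ∀ v u w, s u ⬝ᵥ (κ v *ᵥ s w) = -(s w ⬝ᵥ (κ v *ᵥ s u)) := fun v u w => by
    rw [Matrix.dotProduct_mulVec, ← Matrix.mulVec_transpose, hκ, Matrix.neg_mulVec,
      neg_dotProduct, dotProduct_comm]
  -- The trilinear expression is antisymmetric in `(u, w)` and symmetric in `(v, w)`, hence zero, as
  -- in the uniqueness of the Levi-Civita connection.
  have hzero : ∀ v u w, s u ⬝ᵥ (κ v *ᵥ s w) = 0 := fun v u w => by
    have h1 : s u ⬝ᵥ (κ v *ᵥ s w) = -(s u ⬝ᵥ (κ v *ᵥ s w)) :=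
      calc s u ⬝ᵥ (κ v *ᵥ s w) = s u ⬝ᵥ (κ w *ᵥ s v) := by rw [h]
        _ = -(s v ⬝ᵥ (κ w *ᵥ s u)) := hskew _ _ _
        _ = -(s v ⬝ᵥ (κ u *ᵥ s w)) := by rw [h]
        _ = s w ⬝ᵥ (κ u *ᵥ s v) := by rw [hskew u v w, neg_neg]
        _ = s w ⬝ᵥ (κ v *ᵥ s u) := by rw [h]
        _ = -(s u ⬝ᵥ (κ v *ᵥ s w)) := hskew _ _ _
    exact self_eq_neg.1 h1
  ext i j
  obtain ⟨u, hu⟩ := hs i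
  obtain ⟨w, hw⟩ := hs j
  have := hzero v u w
  rw [hu, hw] at this
  simpa using this

variable {E : Type*} [NormedAddCommGroup E] [NormedSpace ℝ E] [FiniteDimensional ℝ E]
  {G : Type*} [TopologicalSpace G] [ChartedSpace E G] [Group G] [LieGroup 𝓘(ℝ, E) ∞ G]
  {M : Type*} [TopologicalSpace M] [ChartedSpace (EuclideanSpace ℝ (Fin 6)) M] [MulAction G M]
  [ContMDiffSMul 𝓘(ℝ, E) (𝓡 6) ∞ G M]
  [MulAction.IsPretransitive G M] {S : InvariantSU3Structure (E := E) G M}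
  {L : Type*} [TopologicalSpace L] [ChartedSpace (EuclideanSpace ℝ (Fin 3)) L]
  {σ : Fin 3 → OneForm L} {α β : Matrix (Fin 3) (Fin 3) (OneForm L)}
  {T : L → Matrix (Fin 3) (Fin 3) ℂ}

namespace InvariantSU3Structure

attribute [local instance] LieGroup.minSmoothness_real

/-- The 𝔥-part of the logarithmic derivative is tangent to the fibre, so only the 𝔪-part reaches
`M`. -/
theorem hasModelDerivAt_orbit_of_hasLogDerivAt {F : L → G} {x : L}
    {η : EuclideanSpace ℝ (Fin 3) →L[ℝ] E} (h : HasLogDerivAt F x η) :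
    HasModelDerivAt (fun y => F y • S.o) x
      ((S.frameModel (F x)).toContinuousLinearMap.comp (S.ζCLM.comp η)) := by
  have h1 := (_root_.hasModelDerivAt_orbit (E := E) S.o (F x)).comp h
  have h2 : (S.frameModel (F x)).toContinuousLinearMap.comp (S.ζCLM.comp η) =
      (orbitLie S.o (F x) : E →L[ℝ] _).comp η :=
    ContinuousLinearMap.ext fun v => (S.orbitLie_eq_frameModel (F x) (η v)).symm
  rw [h2, orbitLie_eq_comp_leftDeriv]
  exact h1

theorem maurerCartan_eq {F : L → G} {x : L} {η : EuclideanSpace ℝ (Fin 3) →L[ℝ] E}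
    (h : HasLogDerivAt F x η) (v : EuclideanSpace ℝ (Fin 3)) : maurerCartan F x v = η v :=
  h.modelDeriv_apply v

/-- As σ(v) is real, conjugation has no effect; the minus sign turns the -½ of the Levi-Civita
connection into +½[σ]. -/
theorem conjCross_vec (σ : Fin 3 → OneForm L) (x : L) (v : EuclideanSpace ℝ (Fin 3))
    (i j : Fin 3) : conjCross (vecForm σ x v) (Pi.single j 1) i = -(bracket σ i j x v : ℂ) := by
  have h := bracket_apply σ i j x v
  rw [h]
  fin_cases i <;> fin_cases j <;> simp [conjCross, crossProduct, vecForm_apply]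

/-- The Levi-Civita connection in the tangent frame of an adapted lift. -/
theorem IsNearlyKahler.leviCivitaFrame_eq (hS : S.IsNearlyKahler)
    (hT : ∀ x, T x ∈ Matrix.specialUnitaryGroup (Fin 3) ℂ) {F : L → G} {x : L}
    {η : EuclideanSpace ℝ (Fin 3) →L[ℝ] E} (h : HasLogDerivAt F x η)
    (hη : ∀ v, S.ζCLM (η v) = solderForm σ T x v) (i j : Fin 3) (v : EuclideanSpace ℝ (Fin 3)) :
    S.leviCivitaFrame T F i j x v =
      ((T x)ᴴ * (derivForm T x v + S.isotropyCLM (η v) * T x)) i j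
        + 1 / 2 * (bracket σ i j x v : ℂ) := by
  have hTT : ∀ z, (T x)ᴴ *ᵥ (T x *ᵥ z) = z := fun z => by
    have : (T x)ᴴ * T x = 1 :=
      Matrix.mem_unitaryGroup_iff'.1 (Matrix.mem_specialUnitaryGroup_iff.1 (hT x)).1
    rw [Matrix.mulVec_mulVec, this, Matrix.one_mulVec]
  have hcol : (fun k => T x k j) = T x *ᵥ Pi.single j 1 := by
    ext k; simp
  have h1 : S.leviCivitaAlong F (fun y k => T y k j) x v =
      (fun k => derivForm T x v k j) + S.isotropyCLM (η v) *ᵥ (fun k => T x k j)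
        + S.leviCivita (S.ζCLM (η v)) (fun k => T x k j) := by
    have hm := maurerCartan_eq h v
    have h2 : S.ζ ⁅S.hPart (maurerCartan F x v), S.b (fun k => T x k j)⁆ =
        S.isotropyCLM (η v) *ᵥ (fun k => T x k j) := by
      rw [S.ζ_hPart_lie_b, hm]; rfl
    have h3 : S.leviCivita (S.ζ (maurerCartan F x v)) (fun k => T x k j) =
        S.leviCivita (S.ζCLM (η v)) (fun k => T x k j) := by rw [hm]; rfl
    exact congrArg₂ (· + ·) (congrArg₂ (· + ·) rfl h2) h3
  have h4 : S.leviCivitaFrame T F i j x v =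
    ((T x)ᴴ *ᵥ S.leviCivitaAlong F (fun y k => T y k j) x v) i := rfl
  have h5 : ((T x)ᴴ * (derivForm T x v + S.isotropyCLM (η v) * T x)) i j =
      ((T x)ᴴ *ᵥ ((fun k => derivForm T x v k j)
        + S.isotropyCLM (η v) *ᵥ (fun k => T x k j))) i := rfl
  rw [h4, h1, h5, hS.leviCivita_eq, hη, solderForm_apply, hcol, conjCross_mulVec (hT x),
    Matrix.mulVec_add _ _ (-_), Matrix.mulVec_neg, Matrix.mulVec_smul, hTT,
    Pi.add_apply, Pi.neg_apply, Pi.smul_apply, conjCross_vec]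
  simp

namespace IsLagrangianSolution

theorem exists_vecForm_eq (h : S.IsLagrangianSolution σ α β T) (x : L) (i : Fin 3) :
    ∃ v, vecForm σ x v = Pi.single i 1 := by
  obtain ⟨v, hv⟩ := exists_apply_eq_of_coframe (H := EuclideanSpace ℝ (Fin 3)) (h.coframe x)
    (by simp) (Pi.single i 1)
  refine ⟨v, funext fun k => ?_⟩
  have : ((σ k x v : ℝ) : ℂ) = ((Pi.single i 1 : Fin 3 → ℝ) k : ℂ) := congrArg _ (hv k)
  rw [vecForm_apply]
  refine this.trans ?_
  by_cases hk : k = i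
  · subst hk; simp
  · simp [hk]

theorem solderForm_injective (h : S.IsLagrangianSolution σ α β T) (x : L) :
    Function.Injective (solderForm σ T x) := by
  refine (injective_iff_map_eq_zero _).2 fun v hv => ?_
  have h1 : vecForm σ x v = 0 := by
    rw [← Matrix.one_mulVec (vecForm σ x v), ← h.conjTranspose_mul x, ← Matrix.mulVec_mulVec,
      ← solderForm_apply, hv, Matrix.mulVec_zero]
  exact eq_zero_of_coframe (H := EuclideanSpace ℝ (Fin 3)) (h.coframe x) (by simp) fun i =>
    ofReal_injective (congrFun h1 i)

end IsLagrangianSolution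

end InvariantSU3Structure

end Immersions

/-! ### Existence and uniqueness of the immersion. -/

section MainTheorem

open FlatModel Filter OneForm InvariantSU3Structure Set
open scoped Topology

attribute [local instance] Matrix.linftyOpNormedRing Matrix.linftyOpNormedAlgebra
attribute [local instance 2000] linftyOpTopologicalSpace

variable {E : Type*} [NormedAddCommGroup E] [NormedSpace ℝ E] [FiniteDimensional ℝ E]
  {G : Type*} [TopologicalSpace G] [ChartedSpace E G] [Group G] [LieGroup 𝓘(ℝ, E) ∞ G]
  {M : Type*} [TopologicalSpace M] [ChartedSpace (EuclideanSpace ℝ (Fin 6)) M] [MulAction G M]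
  [ContMDiffSMul 𝓘(ℝ, E) (𝓡 6) ∞ G M]
  [MulAction.IsPretransitive G M] {S : InvariantSU3Structure (E := E) G M}
  {L : Type*} [TopologicalSpace L] [ChartedSpace (EuclideanSpace ℝ (Fin 3)) L]
  {σ : Fin 3 → OneForm L} {α β : Matrix (Fin 3) (Fin 3) (OneForm L)}
  {T : L → Matrix (Fin 3) (Fin 3) ℂ}

namespace InvariantSU3Structure

attribute [local instance] LieGroup.minSmoothness_real

namespace IsLagrangianSolution

/-- The moving frame T undoes the gauge transformation, so the connection matrix in the frame of
`df` is φ itself. -/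
theorem conjTranspose_mul_gaugeForm (h : S.IsLagrangianSolution σ α β T) (x : L)
    (v : EuclideanSpace ℝ (Fin 3)) :
    (T x)ᴴ * (derivForm T x v + gaugeForm α β T x v * T x) = connForm α β x v := by
  rw [gaugeForm_apply, sub_mul, mul_assoc, mul_assoc _ _ (T x), h.conjTranspose_mul, mul_one,
    mul_one, add_sub_cancel, ← mul_assoc, h.conjTranspose_mul, one_mul]

/-- The immersion given by a map to `G` which integrates the Cartan form. -/
theorem modelDeriv_orbit (h : S.IsLagrangianSolution σ α β T) {F : L → G} {x : L}
    (hF : HasLogDerivAt F x (S.cartanForm σ α β T x)) (v : EuclideanSpace ℝ (Fin 3)) :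
    (modelDeriv (fun y => F y • S.o) x :
      EuclideanSpace ℝ (Fin 3) →L[ℝ] EuclideanSpace ℝ (Fin 6)) v =
      S.frameModel (F x) (solderForm σ T x v) := by
  rw [(hasModelDerivAt_orbit_of_hasLogDerivAt hF).modelDeriv_eq, ← h.ζCLM_cartanForm]
  rfl

theorem inner_solderForm (h : S.IsLagrangianSolution σ α β T) (x : L)
    (v w : EuclideanSpace ℝ (Fin 3)) :
    FlatModel.inner (solderForm σ T x v) (solderForm σ T x w) = ∑ i, σ i x v * σ i x w := by
  rw [solderForm_apply, solderForm_apply, inner_mulVec (h.gauge_mem x)]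
  simp [FlatModel.inner, dotProduct, vecForm_apply]

theorem kahler_solderForm (h : S.IsLagrangianSolution σ α β T) (x : L)
    (v w : EuclideanSpace ℝ (Fin 3)) : kahler (solderForm σ T x v) (solderForm σ T x w) = 0 := by
  rw [solderForm_apply, solderForm_apply, kahler_mulVec (h.gauge_mem x)]
  simp [kahler, FlatModel.inner, dotProduct, vecForm_apply]

/-- After removing T by invariance, the determinant of real vectors is real, and ψ is -i times it.
-/
theorem psi_solderForm_re (h : S.IsLagrangianSolution σ α β T) (x : L)
    (u v w : EuclideanSpace ℝ (Fin 3)) :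
    (psi (solderForm σ T x u) (solderForm σ T x v) (solderForm σ T x w)).re = 0 := by
  rw [solderForm_apply, solderForm_apply, solderForm_apply, psi_mulVec (h.gauge_mem x)]
  simp [psi, Matrix.det_fin_three, vecForm_apply]

theorem isSpecialLagrangianImmersion (h : S.IsLagrangianSolution σ α β T) {F : L → G}
    (hs : ContMDiff (𝓡 3) 𝓘(ℝ, E) ∞ F)
    (hF : ∀ x, HasLogDerivAt F x (S.cartanForm σ α β T x)) :
    S.IsSpecialLagrangianImmersion fun x => F x • S.o where
  smooth := hs.smul contMDiff_const
  immersion x v w hvw := by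
    have h1 := (h.modelDeriv_orbit (hF x) v).symm.trans
      (Eq.trans hvw (h.modelDeriv_orbit (hF x) w))
    exact h.solderForm_injective x (S.frameModel_injective _ h1)
  lagrangian x v w :=
    (congrArg₂ (S.kahlerForm (F x • S.o)) (h.modelDeriv_orbit (hF x) v)
      (h.modelDeriv_orbit (hF x) w)).trans
      ((S.kahlerForm_frameModel rfl _ _).trans (h.kahler_solderForm x v w))
  special x u v w :=
    (congrArg re ((congr (congrArg₂ (S.volForm (F x • S.o)) (h.modelDeriv_orbit (hF x) u)
      (h.modelDeriv_orbit (hF x) v)) (h.modelDeriv_orbit (hF x) w)).trans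
      (S.volForm_frameModel rfl _ _ _))).trans (h.psi_solderForm_re x u v w)

theorem isAdaptedLift (h : S.IsLagrangianSolution σ α β T) {F : L → G}
    (hs : ContMDiff (𝓡 3) 𝓘(ℝ, E) ∞ F)
    (hF : ∀ x, HasLogDerivAt F x (S.cartanForm σ α β T x)) :
    S.IsAdaptedLift σ T (fun x => F x • S.o) F where
  smooth := hs
  lift _ := rfl
  adapted x v := (h.modelDeriv_orbit (hF x) v).trans (S.frame_eq_frameModel _ _).symm

theorem metric_mfderiv (h : S.IsLagrangianSolution σ α β T) {F : L → G} {x : L}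
    (hF : HasLogDerivAt F x (S.cartanForm σ α β T x)) (v w : TangentSpace (𝓡 3) x) :
    S.metric (F x • S.o) (mfderiv (𝓡 3) (𝓡 6) (fun y => F y • S.o) x v)
      (mfderiv (𝓡 3) (𝓡 6) (fun y => F y • S.o) x w) = ∑ i, σ i x v * σ i x w :=
  (congrArg₂ (S.metric (F x • S.o)) (h.modelDeriv_orbit hF v) (h.modelDeriv_orbit hF w)).trans
    ((S.metric_frameModel rfl _ _).trans (h.inner_solderForm x v w))

theorem leviCivitaFrame_eq (hS : S.IsNearlyKahler) (h : S.IsLagrangianSolution σ α β T) {F : L → G}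
    {x : L} (hF : HasLogDerivAt F x (S.cartanForm σ α β T x)) (i j : Fin 3)
    (v : EuclideanSpace ℝ (Fin 3)) :
    S.leviCivitaFrame T F i j x v =
      ((α i j x v : ℂ) + I * (β i j x v : ℂ)) + 1 / 2 * (bracket σ i j x v : ℂ) := by
  rw [hS.leviCivitaFrame_eq h.gauge_mem hF (h.ζCLM_cartanForm x), h.isotropyCLM_cartanForm,
    h.conjTranspose_mul_gaugeForm, connForm_apply]

theorem tangentialForm_eq (hS : S.IsNearlyKahler) (h : S.IsLagrangianSolution σ α β T) {F : L → G}
    {x : L} (hF : HasLogDerivAt F x (S.cartanForm σ α β T x)) (i j : Fin 3)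
    (v : TangentSpace (𝓡 3) x) :
    S.tangentialForm T F i j x v = α i j x v + 1 / 2 * bracket σ i j x v :=
  (congrArg re (h.leviCivitaFrame_eq hS hF i j v)).trans (by simp)

theorem secondFundamentalForm_eq (hS : S.IsNearlyKahler) (h : S.IsLagrangianSolution σ α β T)
    {F : L → G} {x : L} (hF : HasLogDerivAt F x (S.cartanForm σ α β T x)) (i j : Fin 3)
    (v : TangentSpace (𝓡 3) x) : S.secondFundamentalForm T F i j x v = β i j x v :=
  (congrArg im (h.leviCivitaFrame_eq hS hF i j v)).trans (by simp)

end IsLagrangianSolution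

/-- Adaptedness prescribes df in the frame F, and frames are injective: this fixes the 𝔪-part of
F⁻¹dF and says nothing about the 𝔥-part. -/
theorem ζCLM_of_isAdaptedLift {f : L → M} {F : L → G} (h : S.IsAdaptedLift σ T f F) {x : L}
    {η : EuclideanSpace ℝ (Fin 3) →L[ℝ] E} (hη : HasLogDerivAt F x η)
    (v : EuclideanSpace ℝ (Fin 3)) : S.ζCLM (η v) = solderForm σ T x v := by
  obtain rfl : (fun y => F y • S.o) = f := funext h.lift
  have h1 := (h.adapted x v).trans (S.frame_eq_frameModel _ _)
  have h2 := congrArg (fun A => A v) (hasModelDerivAt_orbit_of_hasLogDerivAt (S := S) hη).modelDeriv_eq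
  exact S.frameModel_injective (F x) (h2.symm.trans h1)

variable [IsManifold (𝓡 3) ∞ L]

/-- By pointwise uniqueness of logarithmic derivatives, the chart expression of η coincides near the
centre with the smooth form from `exists_hasLogDerivAt`, so it may be differentiated. -/
theorem maurerCartanEq_of_contMDiff {F : L → G} (hF : ContMDiff (𝓡 3) 𝓘(ℝ, E) ∞ F)
    {η : L → EuclideanSpace ℝ (Fin 3) →L[ℝ] E} (hη : ∀ x, HasLogDerivAt F x (η x)) (x : L) :
    DifferentiableAt ℝ (chartForm η x) (extChartAt (𝓡 3) x x) ∧
    MaurerCartanEq G (chartForm η x (extChartAt (𝓡 3) x x))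
      (fderiv ℝ (chartForm η x) (extChartAt (𝓡 3) x x)) := by
  have : CompleteSpace E := FiniteDimensional.complete ℝ E
  have hn := extChartAt_target_mem_nhds (I := 𝓡 3) x
  have h1 : ∀ᶠ y in 𝓝 (extChartAt (𝓡 3) x x),
      HasLogDerivAt (fun z => F ((extChartAt (𝓡 3) x).symm z)) y (chartForm η x y) :=
    mem_of_superset hn fun y hy => (hη _).comp_extChartAt_symm hy
  obtain ⟨θ, hθ, h2⟩ := ContMDiffAt.exists_hasLogDerivAt (G := G)
    (F := fun z => F ((extChartAt (𝓡 3) x).symm z)) (x₀ := extChartAt (𝓡 3) x x)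
    (mem_of_superset hn fun y hy => (hF _).comp y
      ((contMDiffOn_extChartAt_symm (n := ∞) x).contMDiffAt
        ((isOpen_extChartAt_target x).mem_nhds hy)))
  have h3 : chartForm η x =ᶠ[𝓝 (extChartAt (𝓡 3) x x)] θ := by
    filter_upwards [h1, h2] with y h1 h2 using h1.unique h2
  have hd := (hθ.differentiableAt (by simp)).congr_of_eventuallyEq h3
  exact ⟨hd, HasLogDerivAt.maurerCartanEq hd h1⟩

/-- An adapted lift whose second fundamental form is `β` integrates the Cartan form. -/
theorem IsLagrangianSolution.hasLogDerivAt_of_isAdaptedLift (hS : S.IsNearlyKahler)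
    (h : S.IsLagrangianSolution σ α β T) {f : L → M} {F : L → G} (hF : S.IsAdaptedLift σ T f F)
    (hβ : ∀ (i j : Fin 3) (x : L) (v : TangentSpace (𝓡 3) x),
      S.secondFundamentalForm T F i j x v = β i j x v) (x : L) :
    HasLogDerivAt F x (S.cartanForm σ α β T x) := by
  have : IsManifold (𝓡 3) 1 L := IsManifold.of_le (n := ∞) one_le_infty
  set η : L → EuclideanSpace ℝ (Fin 3) →L[ℝ] E := fun x =>
    (leftDeriv (F x)⁻¹ (F x) : E →L[ℝ] E).comp
      (modelDeriv F x : EuclideanSpace ℝ (Fin 3) →L[ℝ] E) with hηdef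
  have hη : ∀ x, HasLogDerivAt F x (η x) := fun x =>
    MDifferentiableAt.hasLogDerivAt ((hF.smooth x).mdifferentiableAt (by simp))
  have hζ : ∀ x v, S.ζCLM (η x v) = solderForm σ T x v := fun x v =>
    ζCLM_of_isAdaptedLift hF (hη x) v
  obtain ⟨hd, hmc⟩ := maurerCartanEq_of_contMDiff hF.smooth hη x
  -- The discrepancy of the 𝔥-parts, the only freedom left.
  set D : EuclideanSpace ℝ (Fin 3) → Matrix (Fin 3) (Fin 3) ℂ := fun v =>
    S.isotropyCLM (η x v) - gaugeForm α β T x v with hD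
  -- D ∧ Tσ = 0: compare the 𝔪-part of the Maurer-Cartan equation of `F` with the first structure
  -- equation. The 𝔪-parts agree, so the derivative and cross product terms cancel.
  have hDξ : ∀ v w, D v *ᵥ solderForm σ T x w = D w *ᵥ solderForm σ T x v := fun v w => by
    have h1 := congrArg S.ζCLM (hmc v w)
    have hev : ∀ᶠ z in 𝓝 (extChartAt (𝓡 3) x x), ∀ v,
        S.ζCLM (chartForm η x z v) = chartForm (solderForm σ T) x z v :=
      Eventually.of_forall fun z v => hζ _ _
    rw [map_add, map_sub, fderiv_ζCLM hd hev, fderiv_ζCLM hd hev, hS.ζCLM_modelBracket,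
      chartForm_self, hζ, hζ, map_zero, ← h.fderiv_solderForm x v w, add_right_inj,
      sub_left_inj] at h1
    rw [hD, Matrix.sub_mulVec, Matrix.sub_mulVec]
    rw [← sub_eq_zero] at h1 ⊢
    rw [← h1]
    abel
  have hskew : ∀ v, (D v)ᴴ = -D v := fun v => by
    have h1 : (S.isotropyCLM (η x v))ᴴ = -S.isotropyCLM (η x v) := S.conjTranspose_isotropy _
    have h2 : (gaugeForm α β T x v)ᴴ = -gaugeForm α β T x v := by
      rw [← h.isotropyCLM_cartanForm]; exact S.conjTranspose_isotropy _
    simp only [hD, Matrix.conjTranspose_sub, h1, h2, neg_sub_neg, neg_sub]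
  have hκ : ∀ v, (T x)ᴴ * (derivForm T x v + S.isotropyCLM (η x v) * T x) =
      connForm α β x v + (T x)ᴴ * D v * T x := fun v => by
    rw [← h.conjTranspose_mul_gaugeForm, hD]
    noncomm_ring
  -- The imaginary part of the connection matrix is the second fundamental form, already accounted
  -- for by β.
  have him : ∀ v i j, (((T x)ᴴ * D v * T x) i j).im = 0 := fun v i j => by
    have h1 : (S.leviCivitaFrame T F i j x v).im = (β i j x v : ℝ) := hβ i j x v
    rw [hS.leviCivitaFrame_eq h.gauge_mem (hη x) (hζ x), hκ,
      Matrix.add_apply, connForm_apply] at h1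
    simpa using h1
  -- Conjugated by T, the discrepancy is skew-Hermitian and real, hence skew, and its wedge with σ
  -- vanishes.
  have hzero : ∀ v, (T x)ᴴ * D v * T x = 0 := by
    refine eq_zero_of_skew_of_wedge_eq_zero (s := vecForm σ x) (h.exists_vecForm_eq x)
      (fun v => ?_) fun v w => ?_
    · have h1 : ((T x)ᴴ * D v * T x)ᴴ = -((T x)ᴴ * D v * T x) := by
        rw [Matrix.conjTranspose_mul, Matrix.conjTranspose_mul, hskew,
          Matrix.conjTranspose_conjTranspose, neg_mul, mul_neg, mul_assoc]
      rw [← h1]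
      ext i j
      exact (conj_eq_iff_im.2 (him v j i)).symm
    · have h1 := congrArg ((T x)ᴴ *ᵥ ·) (hDξ v w)
      simpa only [solderForm_apply, Matrix.mulVec_mulVec, mul_assoc] using h1
  have hDzero : ∀ v, D v = 0 := fun v =>
    calc D v = T x * ((T x)ᴴ * D v * T x) * (T x)ᴴ := by
          rw [mul_assoc _ (D v), ← mul_assoc (T x), h.mul_conjTranspose, one_mul, mul_assoc,
            h.mul_conjTranspose, mul_one]
      _ = 0 := by rw [hzero, mul_zero, zero_mul]
  have heq : η x = S.cartanForm σ α β T x := ContinuousLinearMap.ext fun v =>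
    eq_of_ζCLM_of_isotropyCLM (S := S) (by rw [hζ, h.ζCLM_cartanForm])
      (by rw [h.isotropyCLM_cartanForm]; exact sub_eq_zero.1 (hDzero v))
  rw [← heq]
  exact hη x

end InvariantSU3Structure

end MainTheorem

theorem mainTheorem3
    {E : Type*} [NormedAddCommGroup E] [NormedSpace ℝ E] [FiniteDimensional ℝ E]
    {G : Type*} [TopologicalSpace G] [T2Space G] [SecondCountableTopology G] [ChartedSpace E G]
    [Group G] [LieGroup 𝓘(ℝ, E) ∞ G]
    {M : Type*} [TopologicalSpace M] [T2Space M] [SecondCountableTopology M]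
    [ChartedSpace (EuclideanSpace ℝ (Fin 6)) M] [IsManifold (𝓡 6) ∞ M]
    [MulAction G M] [ContMDiffSMul 𝓘(ℝ, E) (𝓡 6) ∞ G M] [MulAction.IsPretransitive G M]
    (S : InvariantSU3Structure (E := E) G M) (hS : S.IsNearlyKahler)
    {L : Type*} [TopologicalSpace L] [T2Space L] [SecondCountableTopology L]
    [ChartedSpace (EuclideanSpace ℝ (Fin 3)) L] [IsManifold (𝓡 3) ∞ L] [SimplyConnectedSpace L]
    (σ : Fin 3 → OneForm L) (α β : Matrix (Fin 3) (Fin 3) (OneForm L))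
    (T : L → Matrix (Fin 3) (Fin 3) ℂ) (hsol : S.IsLagrangianSolution σ α β T) :
    ∃ (f : L → M) (F : L → G),
      S.IsSpecialLagrangianImmersion f ∧ S.IsAdaptedLift σ T f F ∧
      (∀ (x : L) (v w : TangentSpace (𝓡 3) x),
        S.metric (f x) (mfderiv (𝓡 3) (𝓡 6) f x v) (mfderiv (𝓡 3) (𝓡 6) f x w)
          = ∑ i, σ i x v * σ i x w) ∧
      (∀ (i j : Fin 3) (x : L) (v : TangentSpace (𝓡 3) x),
        S.tangentialForm T F i j x v = α i j x v + 1 / 2 * OneForm.bracket σ i j x v) ∧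
      (∀ (i j : Fin 3) (x : L) (v : TangentSpace (𝓡 3) x),
        S.secondFundamentalForm T F i j x v = β i j x v) ∧
      ∀ (f' : L → M) (F' : L → G),
        S.IsSpecialLagrangianImmersion f' → S.IsAdaptedLift σ T f' F' →
        (∀ (i j : Fin 3) (x : L) (v : TangentSpace (𝓡 3) x),
          S.secondFundamentalForm T F' i j x v = β i j x v) →
        ∃ g : G, S.IsIsometry (fun p => g • p) ∧ ∀ x, f' x = g • f x := by
  have : CompleteSpace E := FiniteDimensional.complete ℝ E
  obtain ⟨F, hs, hF⟩ := exists_contMDiff_hasLogDerivAt (G := G) hsol.contDiffOn_cartanForm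
    (hsol.maurerCartanEq_cartanForm hS)
  refine ⟨fun x => F x • S.o, F, hsol.isSpecialLagrangianImmersion hs hF, hsol.isAdaptedLift hs hF,
    fun x v w => hsol.metric_mfderiv (hF x) v w,
    fun i j x v => hsol.tangentialForm_eq hS (hF x) i j v,
    fun i j x v => hsol.secondFundamentalForm_eq hS (hF x) i j v, fun f' F' _ hF' hβ => ?_⟩
  obtain ⟨a, ha⟩ := HasLogDerivAt.exists_eq_mul hsol.contDiffOn_cartanForm hF
    (hsol.hasLogDerivAt_of_isAdaptedLift hS hF' hβ)
  exact ⟨a, S.isIsometry_smul a, fun x => by rw [← hF'.lift, ha, mul_smul]⟩
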